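/- **Setting.** Let $\Omega\subset\mathbb R^n$ be open. Let $C^1_0(\Omega,\mathbb R^n)$ be the space of $C^1$ vector fields on $\Omega$ which, together with their derivative, vanish on $\partial\Omega$ and at infinity. Let $V\subset C^1_0(\Omega,\mathbb R^n)$ be an admissible Hilbert space, i.e. $\|u\|_\infty+\|Du\|_\infty\le C\|u\|_V$ for all $u\in V$ and some constant $C$, regarded as a reproducing kernel Hilbert space with matrix-valued reproducing kernel $K$; put $\mathcal K(\varphi)=\int_\Omega K(\cdot,y)\varphi(y)\,dy$. Let $\mathcal X^2=L^2([0,1],V)$. For $v\in\mathcal X^2$ let $\varphi^v_t$ be the flow $\varphi_t^v(x)=x+\int_0^t v(s,\varphi_s^v(x))\,ds$, let $\varphi^v_{s,t}=\varphi^v_t\circ(\varphi^v_s)^{-1}$ for $s,t\in[0,1]$, let $\varphi.f=f\circ\varphi^{-1}$, and let $|D\varphi|$ be the Jacobian determinant of $\varphi$. Let $X$ be a normed space of images, with a continuous linear map $\iota:X\to L^2(\Omega,\mathbb R)$ with dense range (for example $X=L^2(\Omega,\mathbb R)$ and $\iota=\mathrm{id}$, or a dense space of smoother images with its inclusion); for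 $f\in X$ we also write $f$ for $\iota f$. A functional $\Phi:X\to\mathbb R$ has gradient $G\in L^2(\Omega,\mathbb R)$ at $f$ if it is Fréchet differentiable at $f$ with $D\Phi(f)h=\langle G,h\rangle_{L^2(\Omega)}$ for all $h\in X$. Let $\mathcal D$ be a data discrepancy, $\mathcal T_t$ ($0\le t\le 1$) forward operators defined on $L^2(\Omega,\mathbb R)$, $g$ time-dependent data, and $\mathcal D_{g_t}(F)=\mathcal D(\mathcal T_t(F),g(t,\cdot))$ for $F\in L^2(\Omega,\mathbb R)$. Assume that every $\mathcal D_{g_t}$ is Fréchet differentiable on $L^2(\Omega,\mathbb R)$, with gradient $\nabla\mathcal D_{g_t}$; that $t\mapsto\mathcal D_{g_t}(F)$ is integrable on $[0,1]$ for every $F$; and that every $F_0\in L^2(\Omega,\mathbb R)$ has a neighbourhood $U$ and an integrable function $L$ on $[0,1]$ with $\|\nabla\mathcal D_{g_t}(F)\|_{L^2}\le L(t)$ for all $F\in U$ and $t\in[0,1]$. Let $\mathcal R_1:X\to\mathbb R$ and $\mu_1,\mu_2\in\mathbb R$ (in particular $\mu_1,\mu_2\ge 0$), and put $$J_1(f,v)=\int_0^1\Bigl[\mathcal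 D_{g_t}(\varphi_{0,t}^v.f)+\mu_2\int_0^t\|v(\tau,\cdot)\|_V^2\,d\tau\Bigr]dt+\mu_1\mathcal R_1(f),\qquad (f,v)\in X\times\mathcal X^2 .$$ **Theorem.** The flows exist and are bijections of $\Omega$, for all $F\in L^2(\Omega,\mathbb R)$ and $s,t\in[0,1]$ the functions $\varphi_{0,t}^v.F$ and $|D\varphi_{s,t}^v|\,F(\varphi_{s,t}^v)$ are in $L^2(\Omega,\mathbb R)$, and the integrals defining $J_1$ converge, as do all integrals below. Let $v\in\mathcal X^2$, and let $f\in X$ be (represented on $\Omega$ by) a differentiable function with $\nabla f\in L^2(\Omega,\mathbb R^n)$, such that $\mathcal R_1$ has a gradient $\nabla\mathcal R_1(f)$ at $f$. 1. $J_1(f,\cdot):\mathcal X^2\to\mathbb R$ is Fréchet differentiable at $v$, and its $\mathcal X^2$-gradient is $$\nabla_vJ_1(f,v)(t,\cdot)=\mathcal K\Bigl(-\nabla(\varphi_{0,t}^v.f)\int_t^1|D\varphi_{t,\tau}^v|\;\nabla\mathcal D_{g_\tau}(\varphi_{0,\tau}^v.f)(\varphi_{t,\tau}^v)\,d\tau\Bigr)+2\mu_2(1-t)\,v(t,\cdot)$$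 for almost every $t\in[0,1]$, where the time integral is taken in $L^2(\Omega,\mathbb R)$; the first term is a well-defined element of $V$ for every $t\in[0,1]$. 2. $J_1(\cdot,v):X\to\mathbb R$ has at $f$ the gradient $$\nabla_fJ_1(f,v)=\int_0^1|D\varphi_{0,t}^v|\;\nabla\mathcal D_{g_t}(\varphi_{0,t}^v.f)(\varphi_{0,t}^v)\,dt+\mu_1\nabla\mathcal R_1(f).$$ 3. The first-order optimality conditions for minimising $J_1$ over $X\times\mathcal X^2$ are that both gradients vanish: if $(f,v)$ is a local (in particular, a global) minimiser of $J_1$, then $\nabla_vJ_1(f,v)=0$ in $\mathcal X^2$ and $\nabla_fJ_1(f,v)=0$. -/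

import Mathlib

open MeasureTheory Set Filter Topology

noncomputable section

namespace LDDMM

/-- The ambient Euclidean space `ℝⁿ`. -/
abbrev Space (n : ℕ) : Type := EuclideanSpace ℝ (Fin n)

/-- The Hilbert space `L²(Ω, ℝ)` of images on `Ω ⊆ ℝⁿ`. -/
abbrev ImageL2 {n : ℕ} (Ω : Set (Space n)) : Type :=
  Lp ℝ 2 ((volume : Measure (Space n)).restrict Ω)

/-- The Hilbert space `L²([0,1], V)` of time-dependent velocity fields. -/
abbrev VelocityL2 (V : Type*) [NormedAddCommGroup V] : Type _ :=
  Lp V 2 ((volume : Measure ℝ).restrict (Icc 0 1))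

/-- `u ∈ C¹₀(Ω, ℝⁿ)`: continuously differentiable vector fields on the open set `Ω` such that `u`
and `Du` vanish on the boundary of `Ω` and at infinity. A field on `Ω` is identified with its
extension by zero to `ℝⁿ`, which is again `C¹`. -/
structure IsC10 {n : ℕ} (Ω : Set (Space n)) (u : Space n → Space n) : Prop where
  contDiff : ContDiff ℝ 1 u
  eq_zero : ∀ x, x ∉ Ω → u x = 0
  fderiv_eq_zero : ∀ x, x ∉ Ω → fderiv ℝ u x = 0
  tendsto_zero : Tendsto u (cocompact (Space n)) (𝓝 0)
  tendsto_fderiv_zero : Tendsto (fderiv ℝ u) (cocompact (Space n)) (𝓝 0)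

section Fields

variable {n : ℕ} {V : Type*} [NormedAddCommGroup V] [InnerProductSpace ℝ V]
  [RKHS ℝ V (Space n) (Space n)]

/-- A Hilbert space `V` of vector fields is admissible on `Ω` if it is continuously embedded in
`C¹₀(Ω, ℝⁿ)` with the norm `‖u‖_∞ + ‖Du‖_∞`. -/
structure IsAdmissible (Ω : Set (Space n)) (V : Type*) [NormedAddCommGroup V]
    [InnerProductSpace ℝ V] [RKHS ℝ V (Space n) (Space n)] : Prop where
  isC10 : ∀ u : V, IsC10 Ω (⇑u)
  norm_le : ∃ C : ℝ, ∀ (u : V) (x y : Space n), ‖u x‖ + ‖fderiv ℝ (⇑u) y‖ ≤ C * ‖u‖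

/-- `γ` solves `γ' (t) = v (t, γ (t))`, `γ (0) = x` on `[0,1]`, in integrated form (the field is only
square integrable in time). -/
structure IsFlowLine (v : VelocityL2 V) (x : Space n) (γ : ℝ → Space n) : Prop where
  continuousOn : ContinuousOn γ (Icc 0 1)
  integrable : IntegrableOn (fun s => (v s : V) (γ s)) (Icc 0 1)
  eq_integral : ∀ t ∈ Icc (0 : ℝ) 1, γ t = x + ∫ s in (0 : ℝ)..t, (v s : V) (γ s)

/-- The flow `φ_t^v` of the velocity field `v`: `t ↦ flow v t x` is the (unique on `[0,1]`) solution
starting at `x`. -/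
def flow (v : VelocityL2 V) (t : ℝ) (x : Space n) : Space n :=
  Classical.epsilon (IsFlowLine v x) t

/-- `φ_{s,t}^v = φ_t^v ∘ (φ_s^v)⁻¹`. -/
def transition (v : VelocityL2 V) (s t : ℝ) : Space n → Space n :=
  flow v t ∘ Function.invFun (flow v s)

/-- The geometric group action `ψ . u = u ∘ ψ⁻¹` on functions. -/
def geomAct (ψ : Space n → Space n) (u : Space n → ℝ) : Space n → ℝ :=
  u ∘ Function.invFun ψ

/-- The function `|Dψ| (u ∘ ψ)`, with `|Dψ|` the determinant of the Jacobian. -/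
def jacComp (ψ : Space n → Space n) (u : Space n → ℝ) : Space n → ℝ :=
  fun x => (fderiv ℝ ψ x).det * u (ψ x)

/-- The class in `L²(Ω, ℝ)` of a square integrable function. -/
def toL2 (Ω : Set (Space n)) (u : Space n → ℝ) : ImageL2 Ω :=
  open Classical in if h : MemLp u 2 (volume.restrict Ω) then h.toLp u else 0

/-- The deformed image `φ_{0,t}^v . F`, as an element of `L²(Ω, ℝ)`. -/
def deformed {Ω : Set (Space n)} (v : VelocityL2 V) (t : ℝ) (F : ImageL2 Ω) : ImageL2 Ω :=
  toL2 Ω (geomAct (transition v 0 t) F)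

/-- The integral operator `φ ↦ ∫_Ω K(·, y) φ(y) dy` of the reproducing kernel `K` of `V`. -/
def kernelOp (Ω : Set (Space n)) (V : Type*) [NormedAddCommGroup V] [InnerProductSpace ℝ V]
    [CompleteSpace V] [RKHS ℝ V (Space n) (Space n)] (φ : Space n → Space n) (x : Space n) :
    Space n :=
  ∫ y in Ω, RKHS.kernel V x y (φ y)

end Fields

/-- The data term `D_{g_t}(F) = D(A_t(F), g(t))`. -/
def dataTerm {n : ℕ} {Ω : Set (Space n)} {Y : Type*} (D : Y → Y → ℝ) (A : ℝ → ImageL2 Ω → Y)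
    (g : ℝ → Y) (t : ℝ) (F : ImageL2 Ω) : ℝ :=
  D (A t F) (g t)

/-- The data terms `M t : L²(Ω) → ℝ`, `t ∈ [0,1]`, are differentiable, integrable in time for every
image, and their gradients are, locally uniformly in the image, dominated by an integrable function
of time. -/
structure IsDifferentiableDataTerm {n : ℕ} {Ω : Set (Space n)} (M : ℝ → ImageL2 Ω → ℝ) :
    Prop where
  differentiable : ∀ t ∈ Icc (0 : ℝ) 1, Differentiable ℝ (M t)
  integrable : ∀ F, IntegrableOn (fun t => M t F) (Icc 0 1)
  dominated : ∀ F₀, ∃ r > 0, ∃ L : ℝ → ℝ, IntegrableOn L (Icc 0 1) ∧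
    ∀ t ∈ Icc (0 : ℝ) 1, ∀ F ∈ Metric.ball F₀ r, ‖gradient (M t) F‖ ≤ L t

/-- Let `ι : X → L²(Ω)` realise the elements of a normed space `X` as images. The functional
`Φ : X → ℝ` is (Fréchet) differentiable at `f` with `L²`-gradient `G`, that is
`DΦ(f) h = ⟨G, h⟩_{L²(Ω)}`. For `X = L²(Ω)` this is the usual gradient. -/
def HasL2GradientAt {n : ℕ} {Ω : Set (Space n)} {X : Type*} [NormedAddCommGroup X]
    [NormedSpace ℝ X] (ι : X →L[ℝ] ImageL2 Ω) (Φ : X → ℝ) (G : ImageL2 Ω) (f : X) : Prop :=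
  HasFDerivAt Φ ((innerSL ℝ G).comp ι) f

section Functional

variable {n : ℕ} {Ω : Set (Space n)} {V : Type*} [NormedAddCommGroup V] [InnerProductSpace ℝ V]
  [RKHS ℝ V (Space n) (Space n)]

/-- The objective
`J₁(f, v) = ∫₀¹ [D_{g_t}(φ_{0,t}^v . f) + μ₂ ∫₀ᵗ ‖v(τ,·)‖²_V dτ] dt + μ₁ R₁(f)`,
where `M t` stands for `D_{g_t}`. -/
def objective {X : Type*} [NormedAddCommGroup X] [NormedSpace ℝ X] (ι : X →L[ℝ] ImageL2 Ω)
    (M : ℝ → ImageL2 Ω → ℝ) (R₁ : X → ℝ) (μ₁ μ₂ : ℝ) (f : X) (v : VelocityL2 V) : ℝ :=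
  (∫ t in (0 : ℝ)..1,
      (M t (deformed v t (ι f)) + μ₂ * ∫ τ in (0 : ℝ)..t, ‖(v τ : V)‖ ^ 2))
    + μ₁ * R₁ f

/-- `|Dφ_{t,τ}^v| ∇D_{g_τ}(φ_{0,τ}^v . F)(φ_{t,τ}^v)` as an element of `L²(Ω)`. -/
def pulledGradient (M : ℝ → ImageL2 Ω → ℝ) (v : VelocityL2 V) (F : ImageL2 Ω) (t τ : ℝ) :
    ImageL2 Ω :=
  toL2 Ω (jacComp (transition v t τ) (gradient (M τ) (deformed v τ F) : ImageL2 Ω))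

/-- The vector field
`-∇(φ_{0,t}^v . f) ∫_t^1 |Dφ_{t,τ}^v| ∇D_{g_τ}(φ_{0,τ}^v . f)(φ_{t,τ}^v) dτ` on `Ω`. Here `f` is a
function, `F` its class in `L²(Ω)`, and the time integral is the Bochner integral in `L²(Ω)`. -/
def forceField (M : ℝ → ImageL2 Ω → ℝ) (v : VelocityL2 V) (F : ImageL2 Ω) (f : Space n → ℝ)
    (t : ℝ) (y : Space n) : Space n :=
  -((∫ τ in t..1, pulledGradient M v F t τ : ImageL2 Ω) y •
    gradient (geomAct (transition v 0 t) f) y)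

/-- The flow of every velocity field exists and consists of bijections of `Ω`, deformed and
pulled back images are square integrable, and the objective is given by convergent integrals. -/
structure IsWellDefined (Ω : Set (Space n)) (V : Type*) [NormedAddCommGroup V]
    [InnerProductSpace ℝ V] [RKHS ℝ V (Space n) (Space n)] (M : ℝ → ImageL2 Ω → ℝ) : Prop where
  flow_isFlowLine : ∀ (v : VelocityL2 V) (x : Space n), IsFlowLine v x (fun t => flow v t x)
  flow_bijective : ∀ (v : VelocityL2 V), ∀ t ∈ Icc (0 : ℝ) 1,
    Function.Bijective (flow v t) ∧ BijOn (flow v t) Ω Ω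
  memLp_geomAct : ∀ (v : VelocityL2 V), ∀ t ∈ Icc (0 : ℝ) 1, ∀ F : ImageL2 Ω,
    MemLp (geomAct (transition v 0 t) F) 2 (volume.restrict Ω)
  memLp_jacComp : ∀ (v : VelocityL2 V), ∀ s ∈ Icc (0 : ℝ) 1, ∀ t ∈ Icc (0 : ℝ) 1,
    ∀ F : ImageL2 Ω, MemLp (jacComp (transition v s t) F) 2 (volume.restrict Ω)
  integrable_data : ∀ (v : VelocityL2 V) (F : ImageL2 Ω),
    IntegrableOn (fun t => M t (deformed v t F)) (Icc 0 1)
  integrable_pulledGradient : ∀ (v : VelocityL2 V) (F : ImageL2 Ω), ∀ t ∈ Icc (0 : ℝ) 1,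
    IntegrableOn (pulledGradient M v F t) (Icc t 1)

end Functional

end LDDMM

end

/-!
Extending `v` by zero in time, its flow `φ_{s,t}` solves a linear-growth ODE with Lipschitz right
hand side, hence is a two-parameter group of `C¹` diffeomorphisms. By Duhamel's principle, the
derivative of `φ_{τ,0}` in the direction `w` is an integral over `q` of the responses to the
impulses `w(q)`, so that the deformed image `f ∘ φ_{τ,0}` has the derivative
`w ↦ -∫₀^τ ⟨∇(f ∘ φ_{q,0}), w(q)⟩ ∘ φ_{τ,q} dq` in `L²(Ω)`.

Dominated convergence carries this derivative through the time integral of the data term. Fubini on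
the triangle `0 ≤ q ≤ τ ≤ 1` and the change of variables `φ_{τ,q}`, whose adjoint in `L²(Ω)` is
`G ↦ |Dφ_{q,τ}| G ∘ φ_{q,τ}`, then move everything except `w(q)` into one force field at each time
`q`, of which the kernel operator gives the Riesz representative in `V`. The gradient in `f` is the
same computation without the flow derivative, since the data term depends on `f` linearly through
`f ∘ φ_{t,0}`.
-/

noncomputable section

namespace LDDMM

section AbsolutelyContinuous

lemma absolutelyContinuousOnInterval_comp_of_lipschitzOnWith {f g : ℝ → ℝ} {a b : ℝ} {K : NNReal}
    (hg : LipschitzOnWith K g (f '' uIcc a b)) (hf : AbsolutelyContinuousOnInterval f a b) :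
    AbsolutelyContinuousOnInterval (g ∘ f) a b := by
  have hbound := Tendsto.const_mul (K : ℝ) hf
  rw [mul_zero] at hbound
  refine squeeze_zero' (Eventually.of_forall fun I => Finset.sum_nonneg fun _ _ => dist_nonneg)
    (eventually_inf_principal.2 <| Eventually.of_forall fun I hI => ?_) hbound
  rw [Finset.mul_sum]
  exact Finset.sum_le_sum fun i hi => hg.dist_le_mul _ (mem_image_of_mem f (hI.1 i hi).1) _
    (mem_image_of_mem f (hI.1 i hi).2)

lemma integral_mul_exp_integral {l : ℝ → ℝ} (hl : Integrable l) (k s t : ℝ) :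
    k * ∫ r in s..t, l r * Real.exp (k * ∫ u in s..r, l u) =
      Real.exp (k * ∫ u in s..t, l u) - 1 := by
  have hprim : AbsolutelyContinuousOnInterval (fun r => k * ∫ u in s..r, l u) s t :=
    (hl.intervalIntegrable.absolutelyContinuousOnInterval_intervalIntegral
      left_mem_uIcc).const_mul k
  obtain ⟨K, hK⟩ := (Real.contDiff_exp (n := 1)).locallyLipschitz.locallyLipschitzOn
    |>.exists_lipschitzOnWith_of_compact (isCompact_uIcc.image_of_continuousOn hprim.continuousOn)
  have hftc :=
    (absolutelyContinuousOnInterval_comp_of_lipschitzOnWith hK hprim).integral_deriv_eq_sub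
  simp only [Function.comp_apply, intervalIntegral.integral_same, mul_zero, Real.exp_zero] at hftc
  rw [← hftc, ← intervalIntegral.integral_const_mul]
  refine intervalIntegral.integral_congr_ae ?_
  filter_upwards [LocallyIntegrable.ae_hasDerivAt_integral
    hl.locallyIntegrable] with r hr _
  rw [((Real.hasDerivAt_exp _).comp r ((hr s).const_mul k)).deriv]
  ring

end AbsolutelyContinuous

section Caratheodory

/-- The weight of the Bielecki norm for which Picard iteration with Lipschitz rate `l` started at
time `s` is a contraction. -/
def bieleckiWeight (l : ℝ → ℝ) (s t : ℝ) : ℝ :=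
  Real.exp (2 * |∫ r in s..t, l r|)

lemma one_le_bieleckiWeight (l : ℝ → ℝ) (s t : ℝ) : 1 ≤ bieleckiWeight l s t :=
  Real.one_le_exp (by positivity)

lemma bieleckiWeight_pos (l : ℝ → ℝ) (s t : ℝ) : 0 < bieleckiWeight l s t :=
  Real.exp_pos _

lemma continuous_bieleckiWeight {l : ℝ → ℝ} (hl : Integrable l) (s : ℝ) :
    Continuous (bieleckiWeight l s) :=
  Real.continuous_exp.comp
    ((intervalIntegral.continuous_primitive (fun _ _ => hl.intervalIntegrable) s).abs.const_mul 2)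

lemma abs_intervalIntegral_le_integral {l : ℝ → ℝ} (hl : Integrable l) (hl0 : 0 ≤ l) (s t : ℝ) :
    |∫ r in s..t, l r| ≤ ∫ r, l r := by
  rw [intervalIntegral.abs_integral_eq_abs_integral_uIoc, abs_of_nonneg (integral_nonneg hl0)]
  exact setIntegral_le_integral hl (Eventually.of_forall hl0)

lemma bieleckiWeight_le {l : ℝ → ℝ} (hl : Integrable l) (hl0 : 0 ≤ l) (s t : ℝ) :
    bieleckiWeight l s t ≤ Real.exp (2 * ∫ r, l r) := by
  unfold bieleckiWeight
  gcongr
  exact abs_intervalIntegral_le_integral hl hl0 s t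

lemma abs_integral_mul_bieleckiWeight_le {l : ℝ → ℝ} (hl : Integrable l) (hl0 : 0 ≤ l)
    (s t : ℝ) : |∫ r in s..t, l r * bieleckiWeight l s r| ≤ bieleckiWeight l s t / 2 := by
  have of_sign (k : ℝ) (hk : |k| = 2)
      (hsign : ∀ r ∈ uIcc s t, 2 * |∫ u in s..r, l u| = k * ∫ u in s..r, l u) :
      |∫ r in s..t, l r * bieleckiWeight l s r| ≤ bieleckiWeight l s t / 2 := by
    have hweight : ∀ r ∈ uIcc s t, bieleckiWeight l s r = Real.exp (k * ∫ u in s..r, l u) :=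
      fun r hr => by rw [bieleckiWeight, hsign r hr]
    have hexact : k * ∫ r in s..t, l r * bieleckiWeight l s r = bieleckiWeight l s t - 1 := by
      rw [hweight t right_mem_uIcc, ← integral_mul_exp_integral hl,
        intervalIntegral.integral_congr fun r hr => congrArg (l r * ·) (hweight r hr)]
    have habs := congrArg abs hexact
    rw [abs_mul, hk, abs_of_nonneg (sub_nonneg.2 (one_le_bieleckiWeight l s t))] at habs
    linarith
  rcases le_total s t with hst | hts
  · refine of_sign 2 (by simp) fun r hr => ?_
    rw [uIcc_of_le hst] at hr
    rw [abs_of_nonneg (intervalIntegral.integral_nonneg_of_forall hr.1 hl0)]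
  · refine of_sign (-2) (by simp) fun r hr => ?_
    rw [uIcc_of_ge hts] at hr
    rw [intervalIntegral.integral_symm, abs_neg,
      abs_of_nonneg (intervalIntegral.integral_nonneg_of_forall hr.2 hl0)]
    ring

/-- The maximum of `u / bieleckiWeight l s` is at most `2 a`, as it is at most `a` plus half of
itself. -/
lemma le_of_le_add_abs_integral_mul {l u : ℝ → ℝ} {s T a : ℝ} (hl : Integrable l) (hl0 : 0 ≤ l)
    (ha : 0 ≤ a) (hu : ContinuousOn u (uIcc s T)) (hu0 : ∀ t ∈ uIcc s T, 0 ≤ u t)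
    (hle : ∀ t ∈ uIcc s T, u t ≤ a + |∫ r in s..t, l r * u r|) :
    u T ≤ 2 * Real.exp (2 * ∫ r, l r) * a := by
  have hw := bieleckiWeight_pos l s
  have hwc := continuous_bieleckiWeight hl s
  obtain ⟨q, hq, hmax⟩ := isCompact_uIcc.exists_isMaxOn nonempty_uIcc
    (hu.div hwc.continuousOn fun t _ => (hw t).ne')
  set m := u q / bieleckiWeight l s q
  have hm0 : 0 ≤ m := div_nonneg (hu0 q hq) (hw q).le
  have hum : ∀ r ∈ uIcc s T, u r ≤ m * bieleckiWeight l s r := fun r hr =>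
    (div_le_iff₀ (hw r)).1 (hmax hr)
  have hhalf : |∫ r in s..q, l r * u r| ≤ m * (bieleckiWeight l s q / 2) := by
    refine le_trans (b := |∫ r in s..q, m * (l r * bieleckiWeight l s r)|) ?_ <| by
      rw [intervalIntegral.integral_const_mul, abs_mul, abs_of_nonneg hm0]
      exact mul_le_mul_of_nonneg_left (abs_integral_mul_bieleckiWeight_le hl hl0 s q) hm0
    rw [← Real.norm_eq_abs]
    refine intervalIntegral.norm_integral_le_abs_of_norm_le ?_
      ((hl.intervalIntegrable.mul_continuousOn hwc.continuousOn).const_mul m)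
    filter_upwards [ae_restrict_mem measurableSet_uIoc] with r hr
    have hrT := uIcc_subset_uIcc_left hq (uIoc_subset_uIcc hr)
    rw [Real.norm_of_nonneg (mul_nonneg (hl0 r) (hu0 r hrT)), mul_left_comm]
    exact mul_le_mul_of_nonneg_left (hum r hrT) (hl0 r)
  have hm2 : m ≤ 2 * a := by
    have huq : u q = m * bieleckiWeight l s q := (div_mul_cancel₀ _ (hw q).ne').symm
    have ham : a ≤ a * bieleckiWeight l s q :=
      le_mul_of_one_le_right ha (one_le_bieleckiWeight l s q)
    refine le_of_mul_le_mul_right ?_ (hw q)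
    linarith [hle q hq]
  calc u T ≤ m * bieleckiWeight l s T := hum T right_mem_uIcc
    _ ≤ 2 * a * Real.exp (2 * ∫ r, l r) :=
      mul_le_mul hm2 (bieleckiWeight_le hl hl0 s T) (hw T).le (by positivity)
    _ = 2 * Real.exp (2 * ∫ r, l r) * a := by ring

variable {E : Type*} [NormedAddCommGroup E]

/-- A time-dependent vector field which is Lipschitz in space and bounded at the origin with an
integrable rate. Measurability in time is asked for along continuous curves only. -/
structure IsCaratheodory (b : ℝ → E → E) (l : ℝ → ℝ) : Prop where
  aestronglyMeasurable : ∀ γ : ℝ → E, Continuous γ → AEStronglyMeasurable fun r => b r (γ r)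
  norm_sub_le : ∀ r x y, ‖b r x - b r y‖ ≤ l r * ‖x - y‖
  norm_zero_le : ∀ r, ‖b r 0‖ ≤ l r
  integrable_rate : Integrable l

namespace IsCaratheodory

variable {b : ℝ → E → E} {l : ℝ → ℝ}

lemma rate_nonneg (hb : IsCaratheodory b l) : 0 ≤ l :=
  fun r => (norm_nonneg _).trans (hb.norm_zero_le r)

lemma norm_le (hb : IsCaratheodory b l) (r : ℝ) (x : E) : ‖b r x‖ ≤ l r * (‖x‖ + 1) := by
  have hsub := hb.norm_sub_le r x 0
  rw [sub_zero] at hsub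
  linarith [norm_le_norm_sub_add (b r x) (b r 0), hb.norm_zero_le r]

lemma intervalIntegrable (hb : IsCaratheodory b l) {γ : ℝ → E} (hγ : Continuous γ) (s t : ℝ) :
    IntervalIntegrable (fun r => b r (γ r)) volume s t :=
  (hb.integrable_rate.intervalIntegrable.mul_continuousOn
    (hγ.norm.add continuous_const).continuousOn).mono_fun' (hb.aestronglyMeasurable γ hγ).restrict
      (Eventually.of_forall fun r => hb.norm_le r (γ r))

variable [NormedSpace ℝ E]

lemma norm_integral_sub_integral_le (hb : IsCaratheodory b l) {γ γ' : ℝ → E} (hγ : Continuous γ)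
    (hγ' : Continuous γ') {s m : ℝ} (h : ∀ r, ‖γ r - γ' r‖ ≤ m * bieleckiWeight l s r) (t : ℝ) :
    ‖(∫ r in s..t, b r (γ r)) - ∫ r in s..t, b r (γ' r)‖ ≤ m * bieleckiWeight l s t / 2 := by
  have hm : 0 ≤ m := nonneg_of_mul_nonneg_left ((norm_nonneg _).trans (h s))
    (bieleckiWeight_pos l s s)
  rw [← intervalIntegral.integral_sub (hb.intervalIntegrable hγ _ _)
    (hb.intervalIntegrable hγ' _ _)]
  calc ‖∫ r in s..t, (b r (γ r) - b r (γ' r))‖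
      ≤ |∫ r in s..t, m * (l r * bieleckiWeight l s r)| := by
        refine intervalIntegral.norm_integral_le_abs_of_norm_le (Eventually.of_forall fun r => ?_)
          ((hb.integrable_rate.intervalIntegrable.mul_continuousOn
            (continuous_bieleckiWeight hb.integrable_rate s).continuousOn).const_mul m)
        refine (hb.norm_sub_le r _ _).trans ?_
        rw [mul_left_comm]
        exact mul_le_mul_of_nonneg_left (h r) (hb.rate_nonneg r)
    _ = m * |∫ r in s..t, l r * bieleckiWeight l s r| := by
        rw [intervalIntegral.integral_const_mul, abs_mul, abs_of_nonneg hm]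
    _ ≤ m * bieleckiWeight l s t / 2 := by
        rw [mul_div_assoc]
        exact mul_le_mul_of_nonneg_left
          (abs_integral_mul_bieleckiWeight_le hb.integrable_rate hb.rate_nonneg s t) hm

lemma norm_integral_le (hb : IsCaratheodory b l) {γ : ℝ → E} (hγ : Continuous γ) {s m : ℝ}
    (h : ∀ r, ‖γ r‖ ≤ m * bieleckiWeight l s r) (t : ℝ) :
    ‖∫ r in s..t, b r (γ r)‖ ≤ m * bieleckiWeight l s t / 2 + ∫ r, l r := by
  have hzero : ‖∫ r in s..t, b r 0‖ ≤ ∫ r, l r :=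
    (intervalIntegral.norm_integral_le_abs_of_norm_le (Eventually.of_forall hb.norm_zero_le)
      hb.integrable_rate.intervalIntegrable).trans
      (abs_intervalIntegral_le_integral hb.integrable_rate hb.rate_nonneg s t)
  have hsub := hb.norm_integral_sub_integral_le hγ (continuous_const (y := (0 : E)))
    (by simpa using h) t
  linarith [norm_le_norm_sub_add (∫ r in s..t, b r (γ r)) (∫ r in s..t, b r 0)]

end IsCaratheodory

variable [NormedSpace ℝ E] {b : ℝ → E → E} {l : ℝ → ℝ}

/-- `γ` solves `γ' = b(·, γ)`, `γ(s) = x` in integrated form. -/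
structure IsSolution (b : ℝ → E → E) (s : ℝ) (x : E) (γ : ℝ → E) : Prop where
  continuous : Continuous γ
  eq_integral : ∀ t, γ t = x + ∫ r in s..t, b r (γ r)

open BoundedContinuousFunction in
lemma IsCaratheodory.exists_isSolution [CompleteSpace E] (hb : IsCaratheodory b l) (s : ℝ)
    (x : E) : ∃ γ, IsSolution b s x γ := by
  let w := bieleckiWeight l s
  have hw : Continuous w := continuous_bieleckiWeight hb.integrable_rate s
  have hw0 : ∀ t, 0 < w t := bieleckiWeight_pos l s
  let curve : (ℝ →ᵇ E) → ℝ → E := fun η t => w t • η t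
  have hcurve : ∀ η, Continuous (curve η) := fun η => hw.smul η.continuous
  have norm_curve : ∀ (η : ℝ →ᵇ E) r, ‖curve η r‖ ≤ ‖η‖ * w r := fun η r => by
    rw [norm_smul, Real.norm_of_nonneg (hw0 r).le, mul_comm]
    exact mul_le_mul_of_nonneg_right (η.norm_coe_le_norm r) (hw0 r).le
  let picard : (ℝ →ᵇ E) → ℝ → E := fun η t => (w t)⁻¹ • (x + ∫ r in s..t, b r (curve η r))
  have hpicard : ∀ η, Continuous (picard η) := fun η =>
    (hw.inv₀ fun t => (hw0 t).ne').smul (continuous_const.add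
      (intervalIntegral.continuous_primitive (hb.intervalIntegrable (hcurve η)) s))
  have hbound : ∀ η t, ‖picard η t‖ ≤ ‖x‖ + ‖η‖ / 2 + ∫ r, l r := fun η t => by
    rw [norm_smul, norm_inv, Real.norm_of_nonneg (hw0 t).le, inv_mul_le_iff₀ (hw0 t)]
    have h1w : ‖x‖ + ∫ r, l r ≤ w t * (‖x‖ + ∫ r, l r) := le_mul_of_one_le_left
      (add_nonneg (norm_nonneg x) (integral_nonneg hb.rate_nonneg)) (one_le_bieleckiWeight l s t)
    linarith [norm_add_le x (∫ r in s..t, b r (curve η r)),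
      hb.norm_integral_le (hcurve η) (norm_curve η) t]
  have hdist : ∀ η η' t, ‖picard η t - picard η' t‖ ≤ 1 / 2 * ‖η - η'‖ := fun η η' t => by
    have hcurve_sub : ∀ r, ‖curve η r - curve η' r‖ ≤ ‖η - η'‖ * w r := fun r => by
      rw [← smul_sub]
      exact norm_curve (η - η') r
    rw [← smul_sub, add_sub_add_left_eq_sub, norm_smul, norm_inv,
      Real.norm_of_nonneg (hw0 t).le, inv_mul_le_iff₀ (hw0 t)]
    linarith [hb.norm_integral_sub_integral_le (hcurve η) (hcurve η') hcurve_sub t]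
  let P : (ℝ →ᵇ E) → (ℝ →ᵇ E) := fun η =>
    ofNormedAddCommGroup (picard η) (hpicard η) _ (hbound η)
  have hP : ContractingWith (1 / 2) P :=
    ⟨by norm_num, LipschitzWith.of_dist_le_mul fun η η' => (dist_le (by positivity)).2 fun t => by
      rw [dist_eq_norm, dist_eq_norm]
      exact (hdist η η' t).trans_eq (by norm_num)⟩
  refine ⟨curve (hP.fixedPoint P), hcurve _, fun t => ?_⟩
  have hfix : picard (hP.fixedPoint P) t = hP.fixedPoint P t :=
    congrArg (fun η : ℝ →ᵇ E => η t) hP.fixedPoint_isFixedPt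
  change w t • hP.fixedPoint P t = _
  rw [← hfix]
  exact smul_inv_smul₀ (hw0 t).ne' _

lemma IsSolution.norm_sub_le_of_approx (hb : IsCaratheodory b l) {ρ d γ : ℝ → E} {e : ℝ → ℝ}
    {s T ε : ℝ} {x y : E} (hγ : IsSolution b s x γ) (hρ : ContinuousOn ρ (uIcc s T))
    (hd : IntervalIntegrable d volume s T) (hρd : ∀ t ∈ uIcc s T, ρ t = y + ∫ r in s..t, d r)
    (hde : ∀ᵐ r, r ∈ uIoc s T → ‖d r - b r (ρ r)‖ ≤ e r) (he0 : 0 ≤ e) (he : Integrable e)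
    (hε : ∫ r, e r ≤ ε) :
    ‖ρ T - γ T‖ ≤ 2 * Real.exp (2 * ∫ r, l r) * (‖y - x‖ + ε) := by
  have hε0 : 0 ≤ ε := (integral_nonneg he0).trans hε
  refine le_of_le_add_abs_integral_mul (u := fun t => ‖ρ t - γ t‖) hb.integrable_rate
    hb.rate_nonneg (by positivity) (hρ.sub hγ.continuous.continuousOn).norm
    (fun t _ => norm_nonneg _) fun t ht => ?_
  have hsub : uIcc s t ⊆ uIcc s T := uIcc_subset_uIcc_left ht
  have hle : IntervalIntegrable (fun r => l r * ‖ρ r - γ r‖) volume s t :=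
    hb.integrable_rate.intervalIntegrable.mul_continuousOn
      ((hρ.mono hsub).sub hγ.continuous.continuousOn).norm
  have hdiff : ρ t - γ t = (y - x) + ∫ r in s..t, (d r - b r (γ r)) := by
    rw [intervalIntegral.integral_sub (hd.mono_set hsub) (hb.intervalIntegrable hγ.continuous s t),
      hρd t ht, hγ.eq_integral t]
    abel
  have hint : ‖∫ r in s..t, (d r - b r (γ r))‖ ≤ |∫ r in s..t, (l r * ‖ρ r - γ r‖ + e r)| := by
    refine intervalIntegral.norm_integral_le_abs_of_norm_le ?_ (hle.add he.intervalIntegrable)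
    rw [ae_restrict_iff' measurableSet_uIoc]
    filter_upwards [hde] with r hr hrt
    have := hr (uIoc_subset_uIoc_of_uIcc_subset_uIcc hsub hrt)
    linarith [norm_sub_le_norm_sub_add_norm_sub (d r) (b r (ρ r)) (b r (γ r)),
      hb.norm_sub_le r (ρ r) (γ r)]
  rw [intervalIntegral.integral_add hle he.intervalIntegrable] at hint
  calc ‖ρ t - γ t‖ ≤ ‖y - x‖ + ‖∫ r in s..t, (d r - b r (γ r))‖ := hdiff ▸ norm_add_le _ _
    _ ≤ ‖y - x‖ + (|∫ r in s..t, l r * ‖ρ r - γ r‖| + ε) := by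
      gcongr
      refine hint.trans ((abs_add_le _ _).trans ?_)
      gcongr
      exact (abs_intervalIntegral_le_integral he he0 s t).trans hε
    _ = ‖y - x‖ + ε + |∫ r in s..t, l r * ‖ρ r - γ r‖| := by ring

/-- The solution of `γ' = b(·, γ)`, `γ(s) = x`; a junk value if there is none. -/
def solution (b : ℝ → E → E) (s : ℝ) (x : E) : ℝ → E :=
  Classical.epsilon (IsSolution b s x)

namespace IsCaratheodory

variable [CompleteSpace E]

lemma isSolution_solution (hb : IsCaratheodory b l) (s : ℝ) (x : E) :
    IsSolution b s x (solution b s x) :=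
  Classical.epsilon_spec (hb.exists_isSolution s x)

lemma continuous_solution (hb : IsCaratheodory b l) (s : ℝ) (x : E) :
    Continuous (solution b s x) :=
  (hb.isSolution_solution s x).continuous

lemma solution_eq_integral (hb : IsCaratheodory b l) (s : ℝ) (x : E) (t : ℝ) :
    solution b s x t = x + ∫ r in s..t, b r (solution b s x r) :=
  (hb.isSolution_solution s x).eq_integral t

lemma solution_self (hb : IsCaratheodory b l) (s : ℝ) (x : E) : solution b s x s = x := by
  rw [hb.solution_eq_integral, intervalIntegral.integral_same, add_zero]

lemma eq_solution_of_mem_uIcc (hb : IsCaratheodory b l) {s T : ℝ} {x : E} {γ : ℝ → E}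
    (hγ : ContinuousOn γ (uIcc s T)) (hint : IntervalIntegrable (fun r => b r (γ r)) volume s T)
    (heq : ∀ t ∈ uIcc s T, γ t = x + ∫ r in s..t, b r (γ r)) : γ T = solution b s x T := by
  simpa [sub_eq_zero] using (hb.isSolution_solution s x).norm_sub_le_of_approx hb hγ hint heq
    (e := 0) (ε := 0) (by simp) le_rfl (integrable_zero _ _ _) (by simp)

lemma eq_solution (hb : IsCaratheodory b l) {s : ℝ} {x : E} {γ : ℝ → E}
    (hγ : IsSolution b s x γ) : γ = solution b s x :=
  funext fun T => hb.eq_solution_of_mem_uIcc hγ.continuous.continuousOn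
    (hb.intervalIntegrable hγ.continuous s T) fun t _ => hγ.eq_integral t

lemma solution_trans (hb : IsCaratheodory b l) (s t : ℝ) (x : E) :
    solution b t (solution b s x t) = solution b s x :=
  (hb.eq_solution ⟨hb.continuous_solution s x, fun u => by
    rw [hb.solution_eq_integral s x u, hb.solution_eq_integral s x t, add_assoc,
      intervalIntegral.integral_add_adjacent_intervals] <;>
    exact hb.intervalIntegrable (hb.continuous_solution s x) _ _⟩).symm

end IsCaratheodory

end Caratheodory

section FDerivModulus

variable {E F : Type*} [NormedAddCommGroup E] [NormedSpace ℝ E] [NormedAddCommGroup F]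
  [NormedSpace ℝ F] {u w : E → F} {K L δ : ℝ}

/-- The modulus of continuity of the derivative of `u` at scale `δ`; a junk value if the derivative
is unbounded. -/
def fderivModulus (u : E → F) (δ : ℝ) : ℝ :=
  ⨆ p : {p : E × E // ‖p.1 - p.2‖ ≤ δ}, ‖fderiv ℝ u p.1.1 - fderiv ℝ u p.1.2‖

lemma fderivModulus_nonneg (u : E → F) (δ : ℝ) : 0 ≤ fderivModulus u δ :=
  Real.iSup_nonneg fun _ => norm_nonneg _

lemma norm_fderiv_sub_le_two_mul (hK : ∀ x, ‖fderiv ℝ u x‖ ≤ K) (x y : E) :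
    ‖fderiv ℝ u x - fderiv ℝ u y‖ ≤ 2 * K := by
  linarith [norm_sub_le (fderiv ℝ u x) (fderiv ℝ u y), hK x, hK y]

lemma fderivModulus_le (hK : ∀ x, ‖fderiv ℝ u x‖ ≤ K) (δ : ℝ) : fderivModulus u δ ≤ 2 * K :=
  Real.iSup_le (fun _ => norm_fderiv_sub_le_two_mul hK _ _)
    (mul_nonneg zero_le_two ((norm_nonneg _).trans (hK 0)))

lemma norm_fderiv_sub_le_fderivModulus (hK : ∀ x, ‖fderiv ℝ u x‖ ≤ K) {x y : E}
    (h : ‖x - y‖ ≤ δ) : ‖fderiv ℝ u x - fderiv ℝ u y‖ ≤ fderivModulus u δ :=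
  le_ciSup (f := fun p : {p : E × E // ‖p.1 - p.2‖ ≤ δ} => ‖fderiv ℝ u p.1.1 - fderiv ℝ u p.1.2‖)
    ⟨2 * K, by rintro _ ⟨_, rfl⟩; exact norm_fderiv_sub_le_two_mul hK _ _⟩ ⟨(x, y), h⟩

lemma fderivModulus_mono (hK : ∀ x, ‖fderiv ℝ u x‖ ≤ K) : Monotone (fderivModulus u) :=
  fun _ _ h => Real.iSup_le (fun p => norm_fderiv_sub_le_fderivModulus hK (p.2.trans h))
    (fderivModulus_nonneg _ _)

lemma fderivModulus_le_add (hK : ∀ x, ‖fderiv ℝ w x‖ ≤ K)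
    (hL : ∀ x, ‖fderiv ℝ u x - fderiv ℝ w x‖ ≤ L) (δ : ℝ) :
    fderivModulus u δ ≤ fderivModulus w δ + 2 * L := by
  have hL0 : 0 ≤ L := (norm_nonneg _).trans (hL 0)
  refine Real.iSup_le (fun p => ?_) (add_nonneg (fderivModulus_nonneg w δ) (by positivity))
  obtain ⟨⟨x, y⟩, hxy⟩ := p
  calc ‖fderiv ℝ u x - fderiv ℝ u y‖
      = ‖(fderiv ℝ w x - fderiv ℝ w y)
          + ((fderiv ℝ u x - fderiv ℝ w x) - (fderiv ℝ u y - fderiv ℝ w y))‖ := by congr 1; abel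
    _ ≤ fderivModulus w δ + (L + L) := (norm_add_le _ _).trans
        (add_le_add (norm_fderiv_sub_le_fderivModulus hK hxy)
          ((norm_sub_le _ _).trans (add_le_add (hL x) (hL y))))
    _ = fderivModulus w δ + 2 * L := by ring

lemma tendsto_fderivModulus (hu : UniformContinuous (fderiv ℝ u)) :
    Tendsto (fderivModulus u) (𝓝 0) (𝓝 0) := by
  rw [Metric.tendsto_nhds_nhds]
  intro ε hε
  obtain ⟨δ, hδ, h⟩ := Metric.uniformContinuous_iff.1 hu (ε / 2) (half_pos hε)
  refine ⟨δ, hδ, fun {d} hd => ?_⟩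
  rw [Real.dist_eq, sub_zero] at hd ⊢
  rw [abs_of_nonneg (fderivModulus_nonneg u d)]
  refine lt_of_le_of_lt (Real.iSup_le (fun p => ?_) (half_pos hε).le) (half_lt_self hε)
  rw [← dist_eq_norm]
  exact (h (by rw [dist_eq_norm]; exact p.2.trans_lt ((le_abs_self d).trans_lt hd))).le

lemma norm_sub_sub_fderiv_le (hu : Differentiable ℝ u) (hK : ∀ x, ‖fderiv ℝ u x‖ ≤ K) {x y : E}
    (h : ‖y - x‖ ≤ δ) : ‖u y - u x - fderiv ℝ u x (y - x)‖ ≤ fderivModulus u δ * ‖y - x‖ := by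
  refine (convex_closedBall x δ).norm_image_sub_le_of_norm_hasFDerivWithin_le'
    (fun z _ => (hu z).hasFDerivAt.hasFDerivWithinAt) (fun z hz => ?_)
    (Metric.mem_closedBall_self ((norm_nonneg _).trans h)) (mem_closedBall_iff_norm.2 h)
  exact norm_fderiv_sub_le_fderivModulus hK (mem_closedBall_iff_norm.1 hz)

end FDerivModulus

section Admissible

variable {E : Type*} [NormedAddCommGroup E] [InnerProductSpace ℝ E] {Ω : Set E} {V : Type*}
  [NormedAddCommGroup V] [InnerProductSpace ℝ V] [RKHS ℝ V E E] {C : ℝ}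

/-- The consequences of admissibility which govern the flows, with an explicit embedding
constant `C`. -/
structure IsAdmissibleWith (Ω : Set E) (V : Type*) [NormedAddCommGroup V]
    [InnerProductSpace ℝ V] [RKHS ℝ V E E] (C : ℝ) : Prop where
  nonneg : 0 ≤ C
  contDiff : ∀ u : V, ContDiff ℝ 1 u
  uniformContinuous : ∀ u : V, UniformContinuous (fderiv ℝ u)
  eq_zero : ∀ (u : V) (x), x ∉ Ω → u x = 0
  norm_le : ∀ (u : V) (x : E), ‖u x‖ ≤ C * ‖u‖
  norm_fderiv_le : ∀ (u : V) (x : E), ‖fderiv ℝ u x‖ ≤ C * ‖u‖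

lemma IsAdmissible.exists_isAdmissibleWith {n : ℕ} {Ω : Set (Space n)}
    [RKHS ℝ V (Space n) (Space n)] (h : IsAdmissible Ω V) : ∃ C, IsAdmissibleWith Ω V C := by
  obtain ⟨C, hC⟩ := h.norm_le
  have hb : ∀ (u : V) (x y : Space n), ‖u x‖ + ‖fderiv ℝ u y‖ ≤ max C 0 * ‖u‖ := fun u x y =>
    (hC u x y).trans (mul_le_mul_of_nonneg_right (le_max_left _ _) (norm_nonneg _))
  exact ⟨max C 0,
    { nonneg := le_max_right _ _
      contDiff := fun u => (h.isC10 u).contDiff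
      uniformContinuous := fun u =>
        ((h.isC10 u).contDiff.continuous_fderiv one_ne_zero).uniformContinuous_of_tendsto_cocompact
          (h.isC10 u).tendsto_fderiv_zero
      eq_zero := fun u => (h.isC10 u).eq_zero
      norm_le := fun u x => (le_add_of_nonneg_right (norm_nonneg _)).trans (hb u x x)
      norm_fderiv_le := fun u x => (le_add_of_nonneg_left (norm_nonneg _)).trans (hb u x x) }⟩

namespace IsAdmissibleWith

lemma differentiable (hV : IsAdmissibleWith Ω V C) (u : V) : Differentiable ℝ u :=
  (hV.contDiff u).differentiable one_ne_zero

lemma hasFDerivAt (hV : IsAdmissibleWith Ω V C) (u : V) (x : E) :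
    HasFDerivAt u (fderiv ℝ u x) x :=
  (hV.differentiable u x).hasFDerivAt

lemma fderiv_sub (hV : IsAdmissibleWith Ω V C) (u w : V) (x : E) :
    fderiv ℝ (⇑(u - w)) x = fderiv ℝ u x - fderiv ℝ w x := by
  rw [RKHS.coe_sub]
  exact ((hV.hasFDerivAt u x).sub (hV.hasFDerivAt w x)).fderiv

lemma norm_fderiv_sub_le (hV : IsAdmissibleWith Ω V C) (u w : V) (x : E) :
    ‖fderiv ℝ u x - fderiv ℝ w x‖ ≤ C * ‖u - w‖ := by
  rw [← hV.fderiv_sub]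
  exact hV.norm_fderiv_le _ _

lemma norm_sub_le (hV : IsAdmissibleWith Ω V C) (u : V) (x y : E) :
    ‖u x - u y‖ ≤ C * ‖u‖ * ‖x - y‖ :=
  convex_univ.norm_image_sub_le_of_norm_hasFDerivWithin_le
    (fun z _ => (hV.hasFDerivAt u z).hasFDerivWithinAt) (fun z _ => hV.norm_fderiv_le u z)
    (mem_univ _) (mem_univ _)

lemma continuous_eval (hV : IsAdmissibleWith Ω V C) : Continuous fun p : V × E => p.1 p.2 :=
  continuous_prod_of_continuous_lipschitzWith (fun p : V × E => p.1 p.2) ⟨C, hV.nonneg⟩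
    (fun u => (hV.contDiff u).continuous) fun x => LipschitzWith.of_dist_le_mul fun u w => by
      rw [dist_eq_norm, dist_eq_norm, ← Pi.sub_apply, ← RKHS.coe_sub]
      exact hV.norm_le _ _

lemma continuous_fderiv_eval (hV : IsAdmissibleWith Ω V C) :
    Continuous fun p : V × E => fderiv ℝ (⇑p.1) p.2 :=
  continuous_prod_of_continuous_lipschitzWith (fun p : V × E => fderiv ℝ (⇑p.1) p.2)
    ⟨C, hV.nonneg⟩ (fun u => (hV.uniformContinuous u).continuous)
    fun x => LipschitzWith.of_dist_le_mul fun u w => by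
      rw [dist_eq_norm, dist_eq_norm]
      exact hV.norm_fderiv_sub_le u w x

lemma continuous_fderivModulus (hV : IsAdmissibleWith Ω V C) (δ : ℝ) :
    Continuous fun u : V => fderivModulus u δ := by
  refine (LipschitzWith.of_le_add_mul' (2 * C) fun u w => ?_).continuous
  rw [dist_eq_norm, mul_assoc]
  exact fderivModulus_le_add (hV.norm_fderiv_le w) (hV.norm_fderiv_sub_le u w) δ

end IsAdmissibleWith

end Admissible

section ExtendZero

variable {V : Type*} [NormedAddCommGroup V]

/-- A velocity field on `[0,1]`, extended by zero to all times. -/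
def extendZero (v : VelocityL2 V) (r : ℝ) : V := (Icc (0 : ℝ) 1).indicator v r

lemma extendZero_of_mem (v : VelocityL2 V) {r : ℝ} (hr : r ∈ Icc (0 : ℝ) 1) :
    extendZero v r = v r :=
  indicator_of_mem hr _

lemma stronglyMeasurable_extendZero (v : VelocityL2 V) : StronglyMeasurable (extendZero v) :=
  (Lp.stronglyMeasurable v).indicator measurableSet_Icc

lemma extendZero_ae_eq {v : VelocityL2 V} {w : ℝ → V}
    (h : ∀ᵐ r ∂(volume.restrict (Icc (0 : ℝ) 1)), v r = w r) :
    ∀ᵐ r, extendZero v r = (Icc (0 : ℝ) 1).indicator w r := by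
  rw [ae_restrict_iff' measurableSet_Icc] at h
  filter_upwards [h] with r hr
  by_cases hm : r ∈ Icc (0 : ℝ) 1
  · rw [extendZero_of_mem v hm, hr hm, indicator_of_mem hm]
  · rw [extendZero, indicator_of_notMem hm, indicator_of_notMem hm]

lemma extendZero_add (v w : VelocityL2 V) :
    ∀ᵐ r, extendZero (v + w) r = extendZero v r + extendZero w r := by
  filter_upwards [extendZero_ae_eq (Lp.coeFn_add v w)] with r hr
  rw [hr, indicator_add']
  rfl

lemma extendZero_sub (v w : VelocityL2 V) :
    ∀ᵐ r, extendZero (v - w) r = extendZero v r - extendZero w r := by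
  filter_upwards [extendZero_ae_eq (Lp.coeFn_sub v w)] with r hr
  rw [hr, indicator_sub']
  rfl

lemma extendZero_smul [NormedSpace ℝ V] (c : ℝ) (v : VelocityL2 V) :
    ∀ᵐ r, extendZero (c • v) r = c • extendZero v r := by
  filter_upwards [extendZero_ae_eq (Lp.coeFn_smul c v)] with r hr
  rw [hr, extendZero, ← indicator_const_smul_apply]
  rfl

lemma extendZero_zero : ∀ᵐ r, extendZero (0 : VelocityL2 V) r = 0 := by
  filter_upwards [extendZero_sub (0 : VelocityL2 V) 0] with r hr
  rw [← sub_zero (0 : VelocityL2 V), hr, sub_self]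

lemma integrable_extendZero (v : VelocityL2 V) : Integrable (extendZero v) :=
  (integrable_indicator_iff measurableSet_Icc).2 ((Lp.memLp v).integrable one_le_two)

lemma integrable_norm_extendZero (v : VelocityL2 V) : Integrable fun r => ‖extendZero v r‖ :=
  (integrable_extendZero v).norm

lemma integral_norm_extendZero_le (v : VelocityL2 V) : ∫ r, ‖extendZero v r‖ ≤ ‖v‖ := by
  have hunit : IsProbabilityMeasure ((volume : Measure ℝ).restrict (Icc 0 1)) := ⟨by simp⟩
  rw [integral_norm_eq_lintegral_enorm (stronglyMeasurable_extendZero v).aestronglyMeasurable,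
    ← eLpNorm_one_eq_lintegral_enorm, Lp.norm_def]
  refine ENNReal.toReal_mono (Lp.eLpNorm_ne_top v) ?_
  refine (eLpNorm_indicator_eq_eLpNorm_restrict measurableSet_Icc).trans_le ?_
  exact eLpNorm_le_eLpNorm_of_exponent_le one_le_two (Lp.aestronglyMeasurable v)

end ExtendZero

section Triangle

variable {E : Type*} [NormedAddCommGroup E] [NormedSpace ℝ E]

lemma integral_integral_triangle_of_le {Z : ℝ → ℝ → E} {a b : ℝ} (hab : a ≤ b)
    (hZ : IntegrableOn (Function.uncurry Z) (Ioc a b ×ˢ Ioc a b)) :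
    ∫ p in a..b, ∫ q in a..p, Z p q = ∫ q in a..b, ∫ p in q..b, Z p q := by
  have hbelow : MeasurableSet {z : ℝ × ℝ | z.2 ≤ z.1} :=
    measurableSet_le measurable_snd measurable_fst
  have hint : IntegrableOn (Function.uncurry fun p q => (Iic p).indicator (Z p) q)
      (uIoc a b ×ˢ uIoc a b) := by
    rw [uIoc_of_le hab]
    exact hZ.indicator hbelow
  have hrow : ∀ p ∈ Ioc a b, ∫ q in a..p, Z p q = ∫ q in a..b, (Iic p).indicator (Z p) q := by
    intro p hp
    rw [intervalIntegral.integral_of_le hp.1.le, intervalIntegral.integral_of_le hab,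
      setIntegral_indicator measurableSet_Iic, Ioc_inter_Iic, min_eq_right hp.2]
  have hcolumn : ∀ q ∈ Ioc a b,
      ∫ p in q..b, Z p q = ∫ p in a..b, (Iic p).indicator (Z p) q := by
    intro q hq
    change _ = ∫ p in a..b, (Ici q).indicator (fun p => Z p q) p
    have hslice : Ioc a b ∩ Ici q = Icc q b := by
      ext p
      exact ⟨fun hp => ⟨hp.2, hp.1.2⟩, fun hp => ⟨⟨hq.1.trans_le hp.1, hp.2⟩, hp.1⟩⟩
    rw [intervalIntegral.integral_of_le hq.2, intervalIntegral.integral_of_le hab,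
      setIntegral_indicator measurableSet_Ici, hslice, integral_Icc_eq_integral_Ioc]
  rw [← uIoc_of_le hab] at hrow hcolumn
  rw [intervalIntegral.integral_congr_ae (Eventually.of_forall hrow),
    intervalIntegral.integral_congr_ae (Eventually.of_forall hcolumn),
    intervalIntegral_intervalIntegral_swap hint]

lemma integral_integral_triangle {Z : ℝ → ℝ → E} {s t : ℝ}
    (hZ : IntegrableOn (Function.uncurry Z) (uIoc s t ×ˢ uIoc s t)) :
    ∫ p in s..t, ∫ q in s..p, Z p q = ∫ q in s..t, ∫ p in q..t, Z p q := by
  rcases le_total s t with h | h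
  · rw [uIoc_of_le h] at hZ
    exact integral_integral_triangle_of_le h hZ
  · rw [uIoc_of_ge h] at hZ
    have hswap : IntegrableOn (Function.uncurry fun x y => Z y x) (Ioc t s ×ˢ Ioc t s) :=
      hZ.swap
    simp_rw [intervalIntegral.integral_symm t s, intervalIntegral.integral_symm _ s,
      intervalIntegral.integral_symm t _, intervalIntegral.integral_neg]
    rw [integral_integral_triangle_of_le h hswap]

end Triangle

section ProductRule

variable {E F : Type*} [NormedAddCommGroup E] [NormedSpace ℝ E]
  [NormedAddCommGroup F] [NormedSpace ℝ F]

lemma intervalIntegrable_bilin {G : Type*} [NormedAddCommGroup G] [NormedSpace ℝ G]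
    (B : G →L[ℝ] E →L[ℝ] F) {c : ℝ → G} {a : ℝ → E} {s t : ℝ} (hc : ContinuousOn c (uIcc s t))
    (ha : IntervalIntegrable a volume s t) :
    IntervalIntegrable (fun r => B (c r) (a r)) volume s t := by
  obtain ⟨M, hM⟩ := isCompact_uIcc.exists_bound_of_continuousOn hc
  rw [intervalIntegrable_iff] at ha ⊢
  exact B.integrable_of_bilin_of_bdd_left M
    ((hc.mono uIoc_subset_uIcc).aestronglyMeasurable measurableSet_uIoc)
    (ae_restrict_of_forall_mem measurableSet_uIoc fun r hr => hM r (uIoc_subset_uIcc hr)) ha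

lemma primitive_apply_primitive [CompleteSpace E] [CompleteSpace F] {J D : ℝ → E →L[ℝ] F}
    {a : ℝ → E} {s t : ℝ} (hD : IntervalIntegrable D volume s t)
    (ha : IntervalIntegrable a volume s t)
    (hJ : ∀ u ∈ uIcc s t, J u = J s + ∫ r in s..u, D r) :
    J t (∫ r in s..t, a r) = ∫ r in s..t, (D r (∫ q in s..r, a q) + J r (a r)) := by
  have hDu : ∀ u ∈ uIcc s t, IntervalIntegrable D volume s u := fun u hu =>
    hD.mono_set (uIcc_subset_uIcc_left hu)
  have hau : ∀ u ∈ uIcc s t, IntervalIntegrable a volume s u := fun u hu =>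
    ha.mono_set (uIcc_subset_uIcc_left hu)
  have hprod : IntegrableOn (Function.uncurry fun r q => D r (a q)) (uIoc s t ×ˢ uIoc s t) := by
    rw [IntegrableOn, Measure.volume_eq_prod, ← Measure.prod_restrict]
    exact (intervalIntegrable_iff.1 hD).op_fst_snd (op := fun L z => L z) (by fun_prop)
      ⟨1, fun L z => by rw [one_mul]; exact L.le_opNorm z⟩ (intervalIntegrable_iff.1 ha)
  have hA : ContinuousOn (fun r => ∫ q in s..r, a q) (uIcc s t) :=
    intervalIntegral.continuousOn_primitive_interval' ha left_mem_uIcc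
  have hJc : ContinuousOn J (uIcc s t) :=
    (continuousOn_const.add
      (intervalIntegral.continuousOn_primitive_interval' hD left_mem_uIcc)).congr hJ
  have hDA : IntervalIntegrable (fun r => D r (∫ q in s..r, a q)) volume s t :=
    intervalIntegrable_bilin (.flip (.id ℝ (E →L[ℝ] F))) hA hD
  have hJa : IntervalIntegrable (fun r => J r (a r)) volume s t :=
    intervalIntegrable_bilin (.id ℝ (E →L[ℝ] F)) hJc ha
  have hJta : IntervalIntegrable (fun r => J t (a r)) volume s t :=
    intervalIntegrable_bilin (.id ℝ (E →L[ℝ] F)) continuousOn_const ha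
  have htriangle : ∫ r in s..t, D r (∫ q in s..r, a q)
      = ∫ q in s..t, (J t (a q) - J q (a q)) := by
    calc ∫ r in s..t, D r (∫ q in s..r, a q) = ∫ r in s..t, ∫ q in s..r, D r (a q) :=
          intervalIntegral.integral_congr fun r hr =>
            ((D r).intervalIntegral_comp_comm (hau r hr)).symm
      _ = ∫ q in s..t, ∫ r in q..t, D r (a q) := integral_integral_triangle hprod
      _ = ∫ q in s..t, (J t (a q) - J q (a q)) := intervalIntegral.integral_congr fun q hq => by
          rw [← ContinuousLinearMap.intervalIntegral_apply
            (hD.mono_set (uIcc_subset_uIcc_right hq)), ← sub_apply, hJ t right_mem_uIcc, hJ q hq,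
            add_sub_add_left_eq_sub, intervalIntegral.integral_interval_sub_left hD (hDu q hq)]
  rw [intervalIntegral.integral_add hDA hJa, htriangle, intervalIntegral.integral_sub hJta hJa,
    sub_add_cancel, (J t).intervalIntegral_comp_comm ha]

end ProductRule

lemma isCaratheodory_of_linear {E : Type*} [NormedAddCommGroup E] [NormedSpace ℝ E]
    {L : ℝ → E →L[ℝ] E} {l : ℝ → ℝ} (hL : AEStronglyMeasurable L) (hl : ∀ r, ‖L r‖ ≤ l r)
    (hl' : Integrable l) : IsCaratheodory (fun r y => L r y) l where
  aestronglyMeasurable _ hγ :=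
    isBoundedBilinearMap_apply.continuous.comp_aestronglyMeasurable
      (hL.prodMk hγ.aestronglyMeasurable)
  norm_sub_le r x y := by
    rw [← map_sub]
    exact (L r).le_of_opNorm_le (hl r) _
  norm_zero_le r := by
    rw [map_zero, norm_zero]
    exact (norm_nonneg _).trans (hl r)
  integrable_rate := hl'

lemma isSolution_zero {E : Type*} [NormedAddCommGroup E] [NormedSpace ℝ E] {b : ℝ → E → E}
    (hb : ∀ r, b r 0 = 0) (s : ℝ) : IsSolution b s 0 fun _ => 0 where
  continuous := continuous_const
  eq_integral t := by
    simp only [hb, intervalIntegral.integral_zero, add_zero]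

section FlowBound

variable {V : Type*} [NormedAddCommGroup V] {C : ℝ}

/-- The Grönwall constant of the flow of `v`. -/
def flowBound (C : ℝ) (v : VelocityL2 V) : ℝ := 2 * Real.exp (2 * (C * ‖v‖))

lemma flowBound_pos (C : ℝ) (v : VelocityL2 V) : 0 < flowBound C v := by
  unfold flowBound; positivity

lemma continuous_flowBound (C : ℝ) : Continuous (flowBound C : VelocityL2 V → ℝ) := by
  unfold flowBound; fun_prop

lemma integral_mul_norm_extendZero_le (hC : 0 ≤ C) (v : VelocityL2 V) :
    ∫ r, C * ‖extendZero v r‖ ≤ C * ‖v‖ := by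
  rw [integral_const_mul]
  exact mul_le_mul_of_nonneg_left (integral_norm_extendZero_le v) hC

variable {E : Type*} [NormedAddCommGroup E] [NormedSpace ℝ E] {b : ℝ → E → E} {v : VelocityL2 V}
  {γ : ℝ → E} {e : ℝ → ℝ} {s T ε : ℝ} {x y : E}

lemma IsSolution.norm_sub_le_flowBound_mul (hC : 0 ≤ C)
    (hb : IsCaratheodory b fun r => C * ‖extendZero v r‖) {ρ d : ℝ → E} (hγ : IsSolution b s x γ)
    (hρ : ContinuousOn ρ (uIcc s T)) (hd : IntervalIntegrable d volume s T)
    (hρd : ∀ t ∈ uIcc s T, ρ t = y + ∫ r in s..t, d r)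
    (hde : ∀ᵐ r, r ∈ uIoc s T → ‖d r - b r (ρ r)‖ ≤ e r) (he0 : 0 ≤ e) (he : Integrable e)
    (hε : ∫ r, e r ≤ ε) : ‖ρ T - γ T‖ ≤ flowBound C v * (‖y - x‖ + ε) := by
  have hε0 : 0 ≤ ε := (integral_nonneg he0).trans hε
  refine (hγ.norm_sub_le_of_approx hb hρ hd hρd hde he0 he hε).trans ?_
  unfold flowBound
  gcongr
  exact integral_mul_norm_extendZero_le hC v

lemma IsSolution.norm_sub_le_of_isSolution (hC : 0 ≤ C)
    (hb : IsCaratheodory b fun r => C * ‖extendZero v r‖) {b' : ℝ → E → E} {l : ℝ → ℝ}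
    (hb' : IsCaratheodory b' l) {γ' : ℝ → E} (hγ : IsSolution b s x γ)
    (hγ' : IsSolution b' s y γ') (he0 : 0 ≤ e) (he : Integrable e)
    (hle : ∀ᵐ r, ‖b' r (γ' r) - b r (γ' r)‖ ≤ e r) (hε : ∫ r, e r ≤ ε) (T : ℝ) :
    ‖γ' T - γ T‖ ≤ flowBound C v * (‖y - x‖ + ε) :=
  hγ.norm_sub_le_flowBound_mul hC hb hγ'.continuous.continuousOn
    (hb'.intervalIntegrable hγ'.continuous s T) (fun t _ => hγ'.eq_integral t)
    (hle.mono fun _ h _ => h) he0 he hε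

end FlowBound

section Flow

variable {E : Type*} [NormedAddCommGroup E] [InnerProductSpace ℝ E] {Ω : Set E} {V : Type*}
  [NormedAddCommGroup V] [InnerProductSpace ℝ V] [RKHS ℝ V E E] {C : ℝ}

/-- The flow `φ_{s,t}^v` of `v`, extended by zero to all times: `t ↦ flowMap v s t x` solves
`γ' = v(·, γ)`, `γ(s) = x`. -/
def flowMap (v : VelocityL2 V) (s t : ℝ) (x : E) : E :=
  solution (fun r => ⇑(extendZero v r)) s x t

/-- The coefficient `Dv(r, φ_{s,r}(x))` of the linearised flow equation. -/
def linearisedField (v : VelocityL2 V) (s : ℝ) (x : E) (r : ℝ) : E →L[ℝ] E :=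
  fderiv ℝ (⇑(extendZero v r)) (flowMap v s r x)

/-- The derivative of `φ_{s,t}^v`, defined as the fundamental solution of the linearised flow
equation. -/
def flowJacobian (v : VelocityL2 V) (s t : ℝ) (x : E) : E →L[ℝ] E :=
  solution (fun r A => (linearisedField v s x r).comp A) s (.id ℝ E) t

/-- The modulus of continuity of `Dv(r, ·)`, integrated over the time `r`. -/
def integratedModulus (v : VelocityL2 V) (δ : ℝ) : ℝ := ∫ r, fderivModulus ⇑(extendZero v r) δ

lemma integratedModulus_nonneg (v : VelocityL2 V) (δ : ℝ) : 0 ≤ integratedModulus v δ :=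
  integral_nonneg fun _ => fderivModulus_nonneg _ _

namespace IsAdmissibleWith

lemma integrable_fderivModulus (hV : IsAdmissibleWith Ω V C) (v : VelocityL2 V) (δ : ℝ) :
    Integrable fun r => fderivModulus ⇑(extendZero v r) δ := by
  refine ((integrable_norm_extendZero v).const_mul (2 * C)).mono'
    ((hV.continuous_fderivModulus δ).comp_stronglyMeasurable
      (stronglyMeasurable_extendZero v)).aestronglyMeasurable (Eventually.of_forall fun _ => ?_)
  rw [Real.norm_of_nonneg (fderivModulus_nonneg _ _), mul_assoc]
  exact fderivModulus_le (hV.norm_fderiv_le _) _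

lemma integratedModulus_mono (hV : IsAdmissibleWith Ω V C) (v : VelocityL2 V) :
    Monotone (integratedModulus v) := fun _ _ h =>
  integral_mono (hV.integrable_fderivModulus v _) (hV.integrable_fderivModulus v _) fun _ =>
    fderivModulus_mono (hV.norm_fderiv_le _) h

lemma tendsto_integratedModulus (hV : IsAdmissibleWith Ω V C) (v : VelocityL2 V) :
    Tendsto (integratedModulus v) (𝓝 0) (𝓝 0) := by
  suffices h : Tendsto (integratedModulus v) (𝓝 0) (𝓝 (∫ _ : ℝ, (0 : ℝ))) by
    rwa [integral_zero] at h
  refine tendsto_integral_filter_of_dominated_convergence (fun r => 2 * (C * ‖extendZero v r‖))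
    (Eventually.of_forall fun δ => (hV.integrable_fderivModulus v δ).aestronglyMeasurable)
    (Eventually.of_forall fun _ => Eventually.of_forall fun r => ?_)
    (((integrable_norm_extendZero v).const_mul C).const_mul 2)
    (Eventually.of_forall fun r => tendsto_fderivModulus (hV.uniformContinuous _))
  rw [Real.norm_of_nonneg (fderivModulus_nonneg _ _)]
  exact fderivModulus_le (hV.norm_fderiv_le _) _

lemma stronglyMeasurable_eval (hV : IsAdmissibleWith Ω V C) (v : VelocityL2 V) {γ : ℝ → E}
    (hγ : Continuous γ) : StronglyMeasurable fun r => extendZero v r (γ r) :=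
  hV.continuous_eval.comp_stronglyMeasurable
    ((stronglyMeasurable_extendZero v).prodMk hγ.stronglyMeasurable)

lemma isCaratheodory (hV : IsAdmissibleWith Ω V C) (v : VelocityL2 V) :
    IsCaratheodory (fun r => ⇑(extendZero v r)) fun r => C * ‖extendZero v r‖ where
  aestronglyMeasurable _ hγ := (hV.stronglyMeasurable_eval v hγ).aestronglyMeasurable
  norm_sub_le _ x y := hV.norm_sub_le _ x y
  norm_zero_le _ := hV.norm_le _ _
  integrable_rate := (integrable_norm_extendZero v).const_mul C

lemma norm_linearisedField_le (hV : IsAdmissibleWith Ω V C) (v : VelocityL2 V) (s : ℝ) (x : E)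
    (r : ℝ) : ‖linearisedField v s x r‖ ≤ C * ‖extendZero v r‖ :=
  hV.norm_fderiv_le _ _

lemma norm_add_apply_sub_sub_le (hV : IsAdmissibleWith Ω V C) (u w : V) {δ : ℝ} {x y : E}
    (hδ : ‖y - x‖ ≤ δ) :
    ‖(u + w) y - u x - (fderiv ℝ u x (y - x) + w x)‖ ≤ (fderivModulus u δ + C * ‖w‖) * δ := by
  have hsplit : (u + w) y - u x - (fderiv ℝ u x (y - x) + w x)
      = (u y - u x - fderiv ℝ u x (y - x)) + (w y - w x) := by
    rw [RKHS.coe_add, Pi.add_apply]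
    abel
  have htaylor := (norm_sub_sub_fderiv_le (hV.differentiable u) (hV.norm_fderiv_le u) hδ).trans
    (mul_le_mul_of_nonneg_left hδ (fderivModulus_nonneg _ _))
  have hlip := (hV.norm_sub_le w y x).trans
    (mul_le_mul_of_nonneg_left hδ (mul_nonneg hV.nonneg (norm_nonneg w)))
  rw [hsplit, add_mul]
  exact (norm_add_le _ _).trans (add_le_add htaylor hlip)

variable [CompleteSpace E]

lemma isSolution_flowMap (hV : IsAdmissibleWith Ω V C) (v : VelocityL2 V) (s : ℝ) (x : E) :
    IsSolution (fun r => ⇑(extendZero v r)) s x fun t => flowMap v s t x :=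
  (hV.isCaratheodory v).isSolution_solution s x

lemma continuous_flowMap_time (hV : IsAdmissibleWith Ω V C) (v : VelocityL2 V) (s : ℝ) (x : E) :
    Continuous fun t => flowMap v s t x :=
  (hV.isSolution_flowMap v s x).continuous

lemma flowMap_eq_integral (hV : IsAdmissibleWith Ω V C) (v : VelocityL2 V) (s t : ℝ) (x : E) :
    flowMap v s t x = x + ∫ r in s..t, extendZero v r (flowMap v s r x) :=
  (hV.isSolution_flowMap v s x).eq_integral t

lemma flowMap_self (hV : IsAdmissibleWith Ω V C) (v : VelocityL2 V) (s : ℝ) (x : E) :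
    flowMap v s s x = x :=
  (hV.isCaratheodory v).solution_self s x

lemma flowMap_trans (hV : IsAdmissibleWith Ω V C) (v : VelocityL2 V) (s t u : ℝ) (x : E) :
    flowMap v t u (flowMap v s t x) = flowMap v s u x :=
  congrFun ((hV.isCaratheodory v).solution_trans s t x) u

lemma flowMap_flowMap_self (hV : IsAdmissibleWith Ω V C) (v : VelocityL2 V) (s t : ℝ) (x : E) :
    flowMap v t s (flowMap v s t x) = x := by
  rw [hV.flowMap_trans, hV.flowMap_self]

lemma intervalIntegrable_velocity (hV : IsAdmissibleWith Ω V C) (v w : VelocityL2 V) (s : ℝ)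
    (x : E) (a b : ℝ) :
    IntervalIntegrable (fun r => extendZero w r (flowMap v s r x)) volume a b :=
  (hV.isCaratheodory w).intervalIntegrable (hV.continuous_flowMap_time v s x) a b

lemma stronglyMeasurable_linearisedField (hV : IsAdmissibleWith Ω V C) (v : VelocityL2 V) (s : ℝ)
    (x : E) : StronglyMeasurable (linearisedField v s x) :=
  hV.continuous_fderiv_eval.comp_stronglyMeasurable
    ((stronglyMeasurable_extendZero v).prodMk
      (hV.continuous_flowMap_time v s x).stronglyMeasurable)

lemma isCaratheodory_linearisedField (hV : IsAdmissibleWith Ω V C) (v : VelocityL2 V) (s : ℝ)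
    (x : E) :
    IsCaratheodory (fun r y => linearisedField v s x r y) fun r => C * ‖extendZero v r‖ :=
  isCaratheodory_of_linear (hV.stronglyMeasurable_linearisedField v s x).aestronglyMeasurable
    (hV.norm_linearisedField_le v s x) ((integrable_norm_extendZero v).const_mul C)

lemma isCaratheodory_linearisedField_comp (hV : IsAdmissibleWith Ω V C) (v : VelocityL2 V)
    (s : ℝ) (x : E) :
    IsCaratheodory (fun r (A : E →L[ℝ] E) => (linearisedField v s x r).comp A)
      fun r => C * ‖extendZero v r‖ :=
  isCaratheodory_of_linear
    (L := fun r => ContinuousLinearMap.compL ℝ E E E (linearisedField v s x r))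
    ((ContinuousLinearMap.compL ℝ E E E).continuous.comp_aestronglyMeasurable
      (hV.stronglyMeasurable_linearisedField v s x).aestronglyMeasurable)
    (fun r => (ContinuousLinearMap.le_of_opNorm_le _
      (ContinuousLinearMap.norm_compL_le ℝ E E E) _).trans
        ((one_mul _).trans_le (hV.norm_linearisedField_le v s x r)))
    ((integrable_norm_extendZero v).const_mul C)

lemma isSolution_flowJacobian (hV : IsAdmissibleWith Ω V C) (v : VelocityL2 V) (s : ℝ) (x : E) :
    IsSolution (fun r A => (linearisedField v s x r).comp A) s (.id ℝ E)
      fun t => flowJacobian v s t x :=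
  (hV.isCaratheodory_linearisedField_comp v s x).isSolution_solution s _

lemma continuous_flowJacobian_time (hV : IsAdmissibleWith Ω V C) (v : VelocityL2 V) (s : ℝ)
    (x : E) : Continuous fun t => flowJacobian v s t x :=
  (hV.isSolution_flowJacobian v s x).continuous

lemma intervalIntegrable_linearisedField_comp (hV : IsAdmissibleWith Ω V C) (v : VelocityL2 V)
    (s : ℝ) (x : E) (a b : ℝ) :
    IntervalIntegrable (fun r => (linearisedField v s x r).comp (flowJacobian v s r x))
      volume a b :=
  (hV.isCaratheodory_linearisedField_comp v s x).intervalIntegrable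
    (hV.continuous_flowJacobian_time v s x) a b

lemma norm_flowMap_sub_le (hV : IsAdmissibleWith Ω V C) (v v' : VelocityL2 V) (x x' : E)
    (s t : ℝ) :
    ‖flowMap v' s t x' - flowMap v s t x‖ ≤ flowBound C v * (‖x' - x‖ + C * ‖v' - v‖) := by
  refine (hV.isSolution_flowMap v s x).norm_sub_le_of_isSolution hV.nonneg (hV.isCaratheodory v)
    (hV.isCaratheodory v') (hV.isSolution_flowMap v' s x')
    (fun r => mul_nonneg hV.nonneg (norm_nonneg (extendZero (v' - v) r)))
    ((integrable_norm_extendZero _).const_mul C) ?_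
    (integral_mul_norm_extendZero_le hV.nonneg _) t
  filter_upwards [extendZero_sub v' v] with r hr
  rw [hr, ← Pi.sub_apply, ← RKHS.coe_sub]
  exact hV.norm_le _ _

lemma norm_flowJacobian_le (hV : IsAdmissibleWith Ω V C) (v : VelocityL2 V) (s t : ℝ) (x : E) :
    ‖flowJacobian v s t x‖ ≤ flowBound C v := by
  have hb := hV.isCaratheodory_linearisedField_comp v s x
  have hzero := isSolution_zero (b := fun r (A : E →L[ℝ] E) => (linearisedField v s x r).comp A)
    (fun r => ContinuousLinearMap.comp_zero _) s
  have hle := hzero.norm_sub_le_of_isSolution hV.nonneg hb hb (hV.isSolution_flowJacobian v s x)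
    (e := 0) (ε := 0) le_rfl (integrable_zero _ _ _) (by simp) (by simp) t
  rw [sub_zero, sub_zero, add_zero] at hle
  exact hle.trans
    (mul_le_of_le_one_right (flowBound_pos C v).le ContinuousLinearMap.norm_id_le)

lemma norm_linearisedField_sub_le (hV : IsAdmissibleWith Ω V C) (v v' : VelocityL2 V) (x x' : E)
    (s : ℝ) : ∀ᵐ r, ‖linearisedField v' s x' r - linearisedField v s x r‖ ≤
      C * ‖extendZero (v' - v) r‖
        + fderivModulus ⇑(extendZero v r) (flowBound C v * (‖x' - x‖ + C * ‖v' - v‖)) := by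
  filter_upwards [extendZero_sub v' v] with r hr
  rw [hr]
  refine (norm_sub_le_norm_sub_add_norm_sub _
    (fderiv ℝ (⇑(extendZero v r)) (flowMap v' s r x')) _).trans (add_le_add ?_ ?_)
  · exact hV.norm_fderiv_sub_le _ _ _
  · exact norm_fderiv_sub_le_fderivModulus (hV.norm_fderiv_le _)
      (hV.norm_flowMap_sub_le v v' x x' s r)

lemma norm_flowJacobian_sub_le (hV : IsAdmissibleWith Ω V C) (v v' : VelocityL2 V) (x x' : E)
    (s t : ℝ) :
    ‖flowJacobian v' s t x' - flowJacobian v s t x‖ ≤ flowBound C v * (flowBound C v' *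
      (C * ‖v' - v‖ + integratedModulus v (flowBound C v * (‖x' - x‖ + C * ‖v' - v‖)))) := by
  set δ := flowBound C v * (‖x' - x‖ + C * ‖v' - v‖)
  let e : ℝ → ℝ := fun r => C * ‖extendZero (v' - v) r‖ + fderivModulus ⇑(extendZero v r) δ
  have he0 : 0 ≤ e := fun r =>
    add_nonneg (mul_nonneg hV.nonneg (norm_nonneg _)) (fderivModulus_nonneg _ _)
  have hev : Integrable fun r => C * ‖extendZero (v' - v) r‖ :=
    (integrable_norm_extendZero _).const_mul C
  have hle := (hV.isSolution_flowJacobian v s x).norm_sub_le_of_isSolution hV.nonneg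
    (hV.isCaratheodory_linearisedField_comp v s x)
    (hV.isCaratheodory_linearisedField_comp v' s x') (hV.isSolution_flowJacobian v' s x')
    (e := fun r => flowBound C v' * e r)
    (ε := flowBound C v' * (C * ‖v' - v‖ + integratedModulus v δ))
    (fun r => mul_nonneg (flowBound_pos C v').le (he0 r))
    ((hev.add (hV.integrable_fderivModulus v δ)).const_mul _) ?_ ?_ t
  · rwa [sub_self, norm_zero, zero_add] at hle
  · filter_upwards [hV.norm_linearisedField_sub_le v v' x x' s] with r hr
    rw [← ContinuousLinearMap.sub_comp, mul_comm]
    exact (ContinuousLinearMap.opNorm_comp_le _ _).trans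
      (mul_le_mul hr (hV.norm_flowJacobian_le v' s r x') (norm_nonneg _) (he0 r))
  · rw [integral_const_mul, integral_add hev (hV.integrable_fderivModulus v δ)]
    exact mul_le_mul_of_nonneg_left
      (add_le_add_left (integral_mul_norm_extendZero_le hV.nonneg _) _) (flowBound_pos C _).le

/-- The flow is differentiable jointly in the initial value and the velocity field; its derivative
solves the linearised flow equation. -/
lemma norm_flowMap_add_sub_sub_le (hV : IsAdmissibleWith Ω V C) (v w : VelocityL2 V) (x z : E)
    {ζ : ℝ → E} {s : ℝ} (hζ : IsSolution
      (fun r y => linearisedField v s x r y + extendZero w r (flowMap v s r x)) s z ζ) (t : ℝ) :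
    ‖flowMap (v + w) s t (x + z) - flowMap v s t x - ζ t‖ ≤
      flowBound C v * ((integratedModulus v (flowBound C v * (‖z‖ + C * ‖w‖)) + C * ‖w‖)
        * (flowBound C v * (‖z‖ + C * ‖w‖))) := by
  set δ := flowBound C v * (‖z‖ + C * ‖w‖)
  have hC := hV.nonneg
  have hδ0 : 0 ≤ δ := mul_nonneg (flowBound_pos C v).le (by positivity)
  have hew : Integrable fun r => C * ‖extendZero w r‖ :=
    (integrable_norm_extendZero w).const_mul C
  have hlin := hV.isCaratheodory_linearisedField v s x
  let d : ℝ → E := fun r => extendZero (v + w) r (flowMap (v + w) s r (x + z))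
    - extendZero v r (flowMap v s r x)
    - (linearisedField v s x r (ζ r) + extendZero w r (flowMap v s r x))
  have hγ' := fun u => hV.intervalIntegrable_velocity (v + w) (v + w) s (x + z) s u
  have hγ := fun u => hV.intervalIntegrable_velocity v v s x s u
  have hζd := fun u => (hlin.intervalIntegrable hζ.continuous s u).add
    (hV.intervalIntegrable_velocity v w s x s u)
  have hzero := isSolution_zero (fun r => map_zero (linearisedField v s x r)) s
  have hle := hzero.norm_sub_le_flowBound_mul (y := 0) (T := t) hV.nonneg hlin
    (ρ := fun u => flowMap (v + w) s u (x + z) - flowMap v s u x - ζ u)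
    (((hV.continuous_flowMap_time _ s _).sub (hV.continuous_flowMap_time _ s _)).sub
      hζ.continuous).continuousOn (d := d) (((hγ' t).sub (hγ t)).sub (hζd t))
    (e := fun r => (fderivModulus ⇑(extendZero v r) δ + C * ‖extendZero w r‖) * δ)
    (ε := (integratedModulus v δ + C * ‖w‖) * δ) (fun u _ => ?_) ?_
    (fun r => mul_nonneg (add_nonneg (fderivModulus_nonneg _ _) (by positivity)) hδ0)
    (((hV.integrable_fderivModulus v δ).add hew).mul_const _) ?_
  · simpa only [sub_zero, norm_zero, zero_add] using hle
  · simp only [d]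
    rw [intervalIntegral.integral_sub ((hγ' u).sub (hγ u)) (hζd u),
      intervalIntegral.integral_sub (hγ' u) (hγ u), hζ.eq_integral u, hV.flowMap_eq_integral v,
      hV.flowMap_eq_integral (v + w)]
    abel
  · filter_upwards [extendZero_add v w] with r hr _
    have hdist := hV.norm_flowMap_sub_le v (v + w) x (x + z) s r
    rw [add_sub_cancel_left, add_sub_cancel_left] at hdist
    convert hV.norm_add_apply_sub_sub_le (extendZero v r) (extendZero w r) hdist using 2
    simp only [d, hr, linearisedField, map_sub]
    abel
  · rw [integral_mul_const, integral_add (hV.integrable_fderivModulus v δ) hew]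
    gcongr
    · exact le_rfl
    · exact integral_mul_norm_extendZero_le hC w

end IsAdmissibleWith

end Flow

section TravelBound

variable {V : Type*} [NormedAddCommGroup V] {C : ℝ}

/-- A bound for the distance travelled along `v` between the times `s` and `t`. -/
def travelBound (C : ℝ) (v : VelocityL2 V) (s t : ℝ) : ℝ := |∫ r in s..t, C * ‖extendZero v r‖|

/-- A bound, uniform in the initial value, for the distance of `φ_{s',t'}^{v'}` and `φ_{s,t}^v`,
where `p = (v', s', t')`. -/
def flowMapDist (C : ℝ) (v : VelocityL2 V) (s t : ℝ) (p : VelocityL2 V × ℝ × ℝ) : ℝ :=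
  flowBound C v * (C * ‖p.1 - v‖) + flowBound C v * travelBound C v p.2.1 s
    + travelBound C v t p.2.2

lemma travelBound_self (v : VelocityL2 V) (s : ℝ) : travelBound C v s s = 0 := by
  rw [travelBound, intervalIntegral.integral_same, abs_zero]

lemma travelBound_le (hC : 0 ≤ C) (v : VelocityL2 V) (s t : ℝ) :
    travelBound C v s t ≤ C * ‖v‖ := by
  refine (abs_intervalIntegral_le_integral ((integrable_norm_extendZero v).const_mul C)
    (fun r => mul_nonneg hC (norm_nonneg _)) s t).trans ?_
  rw [integral_const_mul]
  exact mul_le_mul_of_nonneg_left (integral_norm_extendZero_le v) hC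

lemma continuous_travelBound (v : VelocityL2 V) :
    Continuous fun p : ℝ × ℝ => travelBound C v p.1 p.2 := by
  have hint : ∀ a b, IntervalIntegrable (fun r => C * ‖extendZero v r‖) volume a b := fun _ _ =>
    ((integrable_norm_extendZero v).const_mul C).intervalIntegrable
  have hprim := intervalIntegral.continuous_primitive hint 0
  have hsub : (fun p : ℝ × ℝ => travelBound C v p.1 p.2) = fun p =>
      |(∫ r in 0..p.2, C * ‖extendZero v r‖) - ∫ r in 0..p.1, C * ‖extendZero v r‖| := by
    funext p
    rw [travelBound, intervalIntegral.integral_interval_sub_left (hint 0 _) (hint 0 _)]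
  rw [hsub]
  fun_prop

lemma flowMapDist_self (v : VelocityL2 V) (s t : ℝ) : flowMapDist C v s t (v, s, t) = 0 := by
  simp only [flowMapDist, travelBound_self, sub_self, norm_zero, mul_zero, add_zero]

lemma continuous_flowMapDist (v : VelocityL2 V) (s t : ℝ) : Continuous (flowMapDist C v s t) := by
  have hs : Continuous fun p : VelocityL2 V × ℝ × ℝ => travelBound C v p.2.1 s :=
    (continuous_travelBound v).comp (by fun_prop : Continuous fun p : VelocityL2 V × ℝ × ℝ =>
      (p.2.1, s))
  have ht : Continuous fun p : VelocityL2 V × ℝ × ℝ => travelBound C v t p.2.2 :=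
    (continuous_travelBound v).comp (by fun_prop : Continuous fun p : VelocityL2 V × ℝ × ℝ =>
      (t, p.2.2))
  unfold flowMapDist
  fun_prop

lemma tendsto_flowMapDist (v : VelocityL2 V) (s t : ℝ) :
    Tendsto (flowMapDist C v s t) (𝓝 (v, s, t)) (𝓝 0) := by
  simpa only [flowMapDist_self] using (continuous_flowMapDist v s t).tendsto (v, s, t)

end TravelBound

section FlowRegularity

variable {E : Type*} [NormedAddCommGroup E] [InnerProductSpace ℝ E] {Ω : Set E} {V : Type*}
  [NormedAddCommGroup V] [InnerProductSpace ℝ V] [RKHS ℝ V E E] {C : ℝ}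

namespace IsAdmissibleWith

variable [CompleteSpace E]

lemma isSolution_flowJacobian_apply (hV : IsAdmissibleWith Ω V C) (v : VelocityL2 V) (s : ℝ)
    (x z : E) :
    IsSolution (fun r y => linearisedField v s x r y) s z fun t => flowJacobian v s t x z where
  continuous := (hV.continuous_flowJacobian_time v s x).clm_apply continuous_const
  eq_integral t := by
    have happly := congrArg (fun A : E →L[ℝ] E => A z)
      ((hV.isSolution_flowJacobian v s x).eq_integral t)
    rwa [add_apply, ContinuousLinearMap.intervalIntegral_apply
      (hV.intervalIntegrable_linearisedField_comp v s x s t)] at happly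

lemma hasFDerivAt_flowMap (hV : IsAdmissibleWith Ω V C) (v : VelocityL2 V) (s t : ℝ) (x : E) :
    HasFDerivAt (flowMap v s t) (flowJacobian v s t x) x := by
  rw [hasFDerivAt_iff_isLittleO_nhds_zero, Asymptotics.isLittleO_iff]
  intro c hc
  set κ := flowBound C v
  have hκ0 : 0 < κ := flowBound_pos C v
  have hmod : Tendsto (fun z : E => integratedModulus v (κ * ‖z‖)) (𝓝 0) (𝓝 0) := by
    have hz : Tendsto (fun z : E => κ * ‖z‖) (𝓝 0) (𝓝 0) := by
      simpa only [norm_zero, mul_zero] using (tendsto_norm_zero (E := E)).const_mul κ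
    exact (hV.tendsto_integratedModulus v).comp hz
  filter_upwards [hmod.eventually (gt_mem_nhds (by positivity : 0 < c / (κ * κ)))] with z hz
  have hsol := hV.isSolution_flowJacobian_apply v s x z
  have hle := hV.norm_flowMap_add_sub_sub_le v 0 x z (s := s)
    (ζ := fun r => flowJacobian v s r x z) ⟨hsol.continuous, fun u => ?_⟩ t
  · rw [add_zero, norm_zero, mul_zero, add_zero, add_zero] at hle
    calc _ ≤ κ * (integratedModulus v (κ * ‖z‖) * (κ * ‖z‖)) := hle
      _ ≤ κ * (c / (κ * κ) * (κ * ‖z‖)) := by gcongr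
      _ = c * ‖z‖ := by field_simp
  · rw [hsol.eq_integral u]
    congr 1
    refine intervalIntegral.integral_congr_ae ((extendZero_zero (V := V)).mono fun r hr _ => ?_)
    simp only [hr, RKHS.coe_zero, Pi.zero_apply, add_zero]

lemma fderiv_flowMap (hV : IsAdmissibleWith Ω V C) (v : VelocityL2 V) (s t : ℝ) (x : E) :
    fderiv ℝ (flowMap v s t) x = flowJacobian v s t x :=
  (hV.hasFDerivAt_flowMap v s t x).fderiv

lemma flowJacobian_comp (hV : IsAdmissibleWith Ω V C) (v : VelocityL2 V) (s t u : ℝ) (x : E) :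
    (flowJacobian v t u (flowMap v s t x)).comp (flowJacobian v s t x) = flowJacobian v s u x := by
  have hchain := (hV.hasFDerivAt_flowMap v t u (flowMap v s t x)).comp x
    (hV.hasFDerivAt_flowMap v s t x)
  have htrans : flowMap v t u ∘ flowMap v s t = flowMap v s u :=
    funext fun y => hV.flowMap_trans v s t u y
  rw [htrans] at hchain
  exact hchain.unique (hV.hasFDerivAt_flowMap v s u x)

lemma flowJacobian_self (hV : IsAdmissibleWith Ω V C) (v : VelocityL2 V) (s : ℝ) (x : E) :
    flowJacobian v s s x = .id ℝ E :=
  (hV.isCaratheodory_linearisedField_comp v s x).solution_self s _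

lemma norm_flowMap_sub_flowMap_le_travelBound (hV : IsAdmissibleWith Ω V C) (v : VelocityL2 V)
    (s : ℝ) (x : E) (a b : ℝ) :
    ‖flowMap v s b x - flowMap v s a x‖ ≤ travelBound C v a b := by
  rw [hV.flowMap_eq_integral v s b, hV.flowMap_eq_integral v s a, add_sub_add_left_eq_sub,
    intervalIntegral.integral_interval_sub_left (hV.intervalIntegrable_velocity v v s x _ _)
      (hV.intervalIntegrable_velocity v v s x _ _)]
  exact intervalIntegral.norm_integral_le_abs_of_norm_le
    (Eventually.of_forall fun _ => hV.norm_le _ _)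
    ((integrable_norm_extendZero v).const_mul C).intervalIntegrable

lemma norm_flowMap_sub_self_le (hV : IsAdmissibleWith Ω V C) (v : VelocityL2 V) (s t : ℝ)
    (x : E) : ‖flowMap v s t x - x‖ ≤ C * ‖v‖ := by
  simpa only [hV.flowMap_self] using
    (hV.norm_flowMap_sub_flowMap_le_travelBound v s x s t).trans (travelBound_le hV.nonneg v s t)

lemma norm_flowMap_sub_le_flowMapDist (hV : IsAdmissibleWith Ω V C) (v : VelocityL2 V) (s t : ℝ)
    (p : VelocityL2 V × ℝ × ℝ) (x : E) :
    ‖flowMap p.1 p.2.1 p.2.2 x - flowMap v s t x‖ ≤ flowMapDist C v s t p := by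
  obtain ⟨v', s', t'⟩ := p
  have hfield := hV.norm_flowMap_sub_le v v' x x s' t'
  have hstart := hV.norm_flowMap_sub_le v v x (flowMap v s' s x) s t'
  have hstart' := hV.norm_flowMap_sub_flowMap_le_travelBound v s' x s' s
  have htime := hV.norm_flowMap_sub_flowMap_le_travelBound v s x t t'
  rw [hV.flowMap_trans] at hstart
  rw [hV.flowMap_self] at hstart'
  simp only [sub_self, norm_zero, mul_zero, add_zero, zero_add] at hfield hstart
  have hκ := (flowBound_pos C v).le
  calc ‖flowMap v' s' t' x - flowMap v s t x‖
      = ‖(flowMap v' s' t' x - flowMap v s' t' x) + (flowMap v s' t' x - flowMap v s t' x)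
        + (flowMap v s t' x - flowMap v s t x)‖ := by congr 1; abel
    _ ≤ _ := norm_add₃_le.trans (add_le_add (add_le_add hfield
      (hstart.trans (mul_le_mul_of_nonneg_left hstart' hκ))) htime)

lemma continuous_flowMap (hV : IsAdmissibleWith Ω V C) :
    Continuous fun p : (VelocityL2 V × ℝ × ℝ) × E => flowMap p.1.1 p.1.2.1 p.1.2.2 p.2 := by
  rw [continuous_iff_continuousAt]
  rintro ⟨⟨v, s, t⟩, x⟩
  rw [ContinuousAt, tendsto_iff_norm_sub_tendsto_zero]
  refine squeeze_zero (g := fun p => flowBound C p.1.1 * ‖p.2 - x‖ + flowMapDist C v s t p.1)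
    (fun _ => norm_nonneg _) (fun p => ?_) ?_
  · have hlip := hV.norm_flowMap_sub_le p.1.1 p.1.1 x p.2 p.1.2.1 p.1.2.2
    simp only [sub_self, norm_zero, mul_zero, add_zero] at hlip
    refine (norm_sub_le_norm_sub_add_norm_sub _ (flowMap p.1.1 p.1.2.1 p.1.2.2 x) _).trans ?_
    exact add_le_add hlip (hV.norm_flowMap_sub_le_flowMapDist v s t p.1 x)
  · have hdist := continuous_flowMapDist (C := C) v s t
    have hbound := continuous_flowBound C (V := V)
    have hc : Continuous fun p : (VelocityL2 V × ℝ × ℝ) × E =>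
      flowBound C p.1.1 * ‖p.2 - x‖ + flowMapDist C v s t p.1 := by fun_prop
    simpa only [sub_self, norm_zero, mul_zero, flowMapDist_self, add_zero]
      using hc.tendsto ((v, s, t), x)

lemma norm_flowJacobian_sub_id_le (hV : IsAdmissibleWith Ω V C) (v : VelocityL2 V) (s t : ℝ)
    (x : E) : ‖flowJacobian v s t x - .id ℝ E‖ ≤ flowBound C v * travelBound C v s t := by
  have hconst : flowBound C v * travelBound C v s t
      = |∫ r in s..t, flowBound C v * (C * ‖extendZero v r‖)| := by
    rw [intervalIntegral.integral_const_mul, abs_mul, abs_of_pos (flowBound_pos C v), travelBound]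
  rw [(hV.isSolution_flowJacobian v s x).eq_integral t, add_sub_cancel_left, hconst]
  refine intervalIntegral.norm_integral_le_abs_of_norm_le (Eventually.of_forall fun r => ?_)
    (((integrable_norm_extendZero v).const_mul C).const_mul _).intervalIntegrable
  refine (ContinuousLinearMap.opNorm_comp_le _ _).trans ?_
  rw [mul_comm]
  exact mul_le_mul (hV.norm_flowJacobian_le v s r x) (hV.norm_linearisedField_le v s x r)
    (norm_nonneg _) (flowBound_pos C v).le

lemma tendsto_flowJacobian_sub {α : Type*} {l : Filter α} {v : VelocityL2 V} {x : E}
    {v' : α → VelocityL2 V} {x' : α → E} (hV : IsAdmissibleWith Ω V C) (s t : α → ℝ)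
    (hv : Tendsto v' l (𝓝 v)) (hx : Tendsto x' l (𝓝 x)) :
    Tendsto (fun a => flowJacobian (v' a) (s a) (t a) (x' a) - flowJacobian v (s a) (t a) x) l
      (𝓝 0) := by
  rw [tendsto_zero_iff_norm_tendsto_zero]
  refine squeeze_zero (fun _ => norm_nonneg _)
    (fun a => hV.norm_flowJacobian_sub_le v (v' a) x (x' a) (s a) (t a)) ?_
  have hv0 : Tendsto (fun a => C * ‖v' a - v‖) l (𝓝 0) := by
    simpa only [mul_zero] using (tendsto_iff_norm_sub_tendsto_zero.1 hv).const_mul C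
  have hδ : Tendsto (fun a => flowBound C v * (‖x' a - x‖ + C * ‖v' a - v‖)) l (𝓝 0) := by
    simpa only [add_zero, mul_zero] using
      ((tendsto_iff_norm_sub_tendsto_zero.1 hx).add hv0).const_mul (flowBound C v)
  have hmod := (hV.tendsto_integratedModulus v).comp hδ
  have hκ := ((continuous_flowBound C (V := V)).tendsto v).comp hv
  simpa only [add_zero, mul_zero, Function.comp_apply]
    using (hκ.mul (hv0.add hmod)).const_mul (flowBound C v)

lemma continuous_flowJacobian_times (hV : IsAdmissibleWith Ω V C) (v : VelocityL2 V) (x : E) :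
    Continuous fun p : ℝ × ℝ => flowJacobian v p.1 p.2 x := by
  rw [continuous_iff_continuousAt]
  rintro ⟨s, t⟩
  have hflow : Tendsto (fun p : ℝ × ℝ => flowMap v p.1 s x) (𝓝 (s, t)) (𝓝 x) := by
    have hc := (hV.continuous_flowMap.comp
      (by fun_prop : Continuous fun p : ℝ × ℝ => ((v, p.1, s), x))).tendsto (s, t)
    simpa only [Function.comp_def, hV.flowMap_self] using hc
  have hleft : Tendsto (fun p : ℝ × ℝ => flowJacobian v s p.2 (flowMap v p.1 s x)) (𝓝 (s, t))
      (𝓝 (flowJacobian v s t x)) := by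
    have ht := ((hV.continuous_flowJacobian_time v s x).comp
      (continuous_snd (X := ℝ))).tendsto (s, t)
    simpa only [sub_add_cancel, zero_add, Function.comp_def] using
      (hV.tendsto_flowJacobian_sub (v := v) (v' := fun _ => v) (fun _ => s) Prod.snd
        tendsto_const_nhds hflow).add ht
  have hright : Tendsto (fun p : ℝ × ℝ => flowJacobian v p.1 s x) (𝓝 (s, t))
      (𝓝 (.id ℝ E)) := by
    rw [tendsto_iff_norm_sub_tendsto_zero]
    refine squeeze_zero (fun _ => norm_nonneg _)
      (fun p => hV.norm_flowJacobian_sub_id_le v p.1 s x) ?_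
    have hc := (((continuous_travelBound (C := C) v).comp (by fun_prop :
      Continuous fun p : ℝ × ℝ => (p.1, s))).const_mul (flowBound C v)).tendsto (s, t)
    simpa only [Function.comp_def, travelBound_self, mul_zero] using hc
  have hcomp : Continuous fun A : (E →L[ℝ] E) × (E →L[ℝ] E) => A.1.comp A.2 := by fun_prop
  exact ((hcomp.tendsto (flowJacobian v s t x, .id ℝ E)).comp
    (hleft.prodMk_nhds hright)).congr fun p => hV.flowJacobian_comp v p.1 s p.2 x

lemma continuous_flowJacobian (hV : IsAdmissibleWith Ω V C) :
    Continuous fun p : (VelocityL2 V × ℝ × ℝ) × E =>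
      flowJacobian p.1.1 p.1.2.1 p.1.2.2 p.2 := by
  rw [continuous_iff_continuousAt]
  rintro ⟨⟨v, s, t⟩, x⟩
  have hsub := hV.tendsto_flowJacobian_sub (v := v) (x := x)
    (fun p : (VelocityL2 V × ℝ × ℝ) × E => p.1.2.1) (fun p => p.1.2.2)
    ((by fun_prop : Continuous fun p : (VelocityL2 V × ℝ × ℝ) × E => p.1.1).tendsto _)
    (continuous_snd.tendsto ((v, s, t), x))
  have htimes := ((hV.continuous_flowJacobian_times v x).comp
    (by fun_prop : Continuous fun p : (VelocityL2 V × ℝ × ℝ) × E => p.1.2)).tendsto ((v, s, t), x)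
  simpa only [ContinuousAt, Function.comp_def, sub_add_cancel, zero_add] using hsub.add htimes

lemma flowMap_of_notMem (hV : IsAdmissibleWith Ω V C) (v : VelocityL2 V) (s t : ℝ) {x : E}
    (hx : x ∉ Ω) : flowMap v s t x = x := by
  have hconst : IsSolution (fun r => ⇑(extendZero v r)) s x fun _ => x :=
    ⟨continuous_const, fun t => by
      simp only [hV.eq_zero _ x hx, intervalIntegral.integral_zero, add_zero]⟩
  exact (congrFun ((hV.isCaratheodory v).eq_solution hconst) t).symm

lemma flowMap_mem_iff (hV : IsAdmissibleWith Ω V C) (v : VelocityL2 V) (s t : ℝ) {x : E} :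
    flowMap v s t x ∈ Ω ↔ x ∈ Ω := by
  refine ⟨fun h => by_contra fun hx => hx ?_, fun h => by_contra fun hx => hx ?_⟩
  · rwa [hV.flowMap_of_notMem v s t hx] at h
  · have hback := hV.flowMap_of_notMem v t s hx
    rw [hV.flowMap_flowMap_self] at hback
    rwa [← hback]

lemma bijective_flowMap (hV : IsAdmissibleWith Ω V C) (v : VelocityL2 V) (s t : ℝ) :
    Function.Bijective (flowMap v s t) :=
  Function.bijective_iff_has_inverse.2
    ⟨flowMap v t s, hV.flowMap_flowMap_self v s t, hV.flowMap_flowMap_self v t s⟩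

lemma invFun_flowMap (hV : IsAdmissibleWith Ω V C) (v : VelocityL2 V) (s t : ℝ) :
    Function.invFun (flowMap v s t) = flowMap v t s :=
  Function.invFun_eq_of_injective_of_rightInverse (hV.bijective_flowMap v s t).1
    (hV.flowMap_flowMap_self v t s)

lemma bijOn_flowMap (hV : IsAdmissibleWith Ω V C) (v : VelocityL2 V) (s t : ℝ) :
    BijOn (flowMap v s t) Ω Ω :=
  ⟨fun _ hx => (hV.flowMap_mem_iff v s t).2 hx, (hV.bijective_flowMap v s t).1.injOn,
    fun x hx => ⟨flowMap v t s x, (hV.flowMap_mem_iff v t s).2 hx,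
      hV.flowMap_flowMap_self v t s x⟩⟩

end IsAdmissibleWith

end FlowRegularity

section FlowOnEuclideanSpace

variable {n : ℕ} {Ω : Set (Space n)} {V : Type*} [NormedAddCommGroup V] [InnerProductSpace ℝ V]
  [RKHS ℝ V (Space n) (Space n)] {C : ℝ}

namespace IsAdmissibleWith

lemma isFlowLine_flowMap (hV : IsAdmissibleWith Ω V C) (v : VelocityL2 V) (x : Space n) :
    IsFlowLine v x fun t => flowMap v 0 t x where
  continuousOn := (hV.continuous_flowMap_time v 0 x).continuousOn
  integrable := by
    have hint := hV.intervalIntegrable_velocity v v 0 x 0 1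
    rw [intervalIntegrable_iff_integrableOn_Icc_of_le zero_le_one] at hint
    exact hint.congr_fun (fun r hr => by simp only [extendZero_of_mem v hr]) measurableSet_Icc
  eq_integral t ht := by
    rw [hV.flowMap_eq_integral v 0 t]
    congr 1
    refine intervalIntegral.integral_congr fun r hr => ?_
    rw [uIcc_of_le ht.1] at hr
    simp only [extendZero_of_mem v ⟨hr.1, hr.2.trans ht.2⟩]

lemma isFlowLine_flow (hV : IsAdmissibleWith Ω V C) (v : VelocityL2 V) (x : Space n) :
    IsFlowLine v x fun t => flow v t x :=
  Classical.epsilon_spec (p := IsFlowLine v x) ⟨_, hV.isFlowLine_flowMap v x⟩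

lemma flow_eq_flowMap (hV : IsAdmissibleWith Ω V C) (v : VelocityL2 V) {t : ℝ}
    (ht : t ∈ Icc (0 : ℝ) 1) : flow v t = flowMap v 0 t := by
  funext x
  have hline := hV.isFlowLine_flow v x
  have hsub : uIcc 0 t ⊆ Icc (0 : ℝ) 1 := by
    rw [uIcc_of_le ht.1]
    exact Icc_subset_Icc_right ht.2
  have hcongr : ∀ r ∈ Icc (0 : ℝ) 1, v r (flow v r x) = extendZero v r (flow v r x) :=
    fun r hr => by rw [extendZero_of_mem v hr]
  refine (hV.isCaratheodory v).eq_solution_of_mem_uIcc (γ := fun t => flow v t x)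
    (hline.continuousOn.mono hsub) ?_ fun u hu => ?_
  · rw [intervalIntegrable_iff_integrableOn_Icc_of_le ht.1]
    exact (hline.integrable.congr_fun hcongr measurableSet_Icc).mono_set
      (Icc_subset_Icc_right ht.2)
  · rw [hline.eq_integral u (hsub hu)]
    congr 1
    exact intervalIntegral.integral_congr fun r hr =>
      hcongr r (hsub (uIcc_subset_uIcc_left hu hr))

lemma transition_eq_flowMap (hV : IsAdmissibleWith Ω V C) (v : VelocityL2 V) {s t : ℝ}
    (hs : s ∈ Icc (0 : ℝ) 1) (ht : t ∈ Icc (0 : ℝ) 1) : transition v s t = flowMap v s t := by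
  funext x
  rw [transition, hV.flow_eq_flowMap v hs, hV.flow_eq_flowMap v ht, hV.invFun_flowMap,
    Function.comp_apply, hV.flowMap_trans]

lemma det_flowJacobian_pos (hV : IsAdmissibleWith Ω V C) (v : VelocityL2 V) (s t : ℝ)
    (x : Space n) : 0 < (flowJacobian v s t x).det := by
  have hself : (flowJacobian v s s x).det = 1 := by
    rw [hV.flowJacobian_self]
    exact LinearMap.det_id
  have hne : ∀ t, (flowJacobian v s t x).det ≠ 0 := by
    intro t h
    have hmul : (flowJacobian v s s x).det
        = (flowJacobian v t s (flowMap v s t x)).det * (flowJacobian v s t x).det := by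
      rw [← hV.flowJacobian_comp v s t s x]
      exact LinearMap.det_comp _ _
    rw [hself, h, mul_zero] at hmul
    exact one_ne_zero hmul
  by_contra hneg
  obtain ⟨r, hr⟩ := mem_range_of_exists_le_of_exists_ge
    (ContinuousLinearMap.continuous_det.comp (hV.continuous_flowJacobian_time v s x))
    ⟨t, not_lt.1 hneg⟩ ⟨s, zero_le_one.trans_eq hself.symm⟩
  exact hne r hr

end IsAdmissibleWith

end FlowOnEuclideanSpace

lemma exists_abs_det_le {E : Type*} [NormedAddCommGroup E] [NormedSpace ℝ E]
    [FiniteDimensional ℝ E] (M : ℝ) :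
    ∃ K : ℝ, 0 < K ∧ ∀ A : E →L[ℝ] E, ‖A‖ ≤ M → |A.det| ≤ K := by
  have : ProperSpace (E →L[ℝ] E) := FiniteDimensional.proper ℝ _
  obtain ⟨K, hK⟩ := (isCompact_closedBall (0 : E →L[ℝ] E) M).exists_bound_of_continuousOn
    ContinuousLinearMap.continuous_det.continuousOn
  exact ⟨max K 1, lt_max_of_lt_right one_pos, fun A hA =>
    (hK A (mem_closedBall_zero_iff.2 hA)).trans (le_max_left _ _)⟩

section Variation

variable {E : Type*} [NormedAddCommGroup E] [InnerProductSpace ℝ E] {Ω : Set E} {V : Type*}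
  [NormedAddCommGroup V] [InnerProductSpace ℝ V] [RKHS ℝ V E E] {C : ℝ}

/-- The first-order displacement at time `t` of the trajectory through `x` at time `s`, caused by
an impulse `u` of velocity at time `q`. -/
def impulseResponse (v : VelocityL2 V) (s t q : ℝ) (x : E) (u : V) : E :=
  flowJacobian v q t (flowMap v s q x) (u (flowMap v s q x))

/-- The derivative of the flow `φ_{s,t}^v` with respect to `v` in the direction `w`, by Duhamel's
principle. -/
def flowVariation (v w : VelocityL2 V) (s t : ℝ) (x : E) : E :=
  ∫ q in s..t, impulseResponse v s t q x (extendZero w q)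

/-- A bound for the dependence of `flowJacobian v q t (flowMap v s q x)` on `v`. -/
def transportedJacobianDist (C : ℝ) (v v' : VelocityL2 V) : ℝ :=
  flowBound C v * (flowBound C v' * (C * ‖v' - v‖ + integratedModulus v
    (flowBound C v * (flowBound C v * (C * ‖v' - v‖) + C * ‖v' - v‖))))

/-- A bound for the dependence of `impulseResponse v` on `v`. -/
def impulseResponseDist (C : ℝ) (v v' : VelocityL2 V) : ℝ :=
  transportedJacobianDist C v v' * C + flowBound C v * (C * (flowBound C v * (C * ‖v' - v‖)))

lemma impulseResponseDist_nonneg (hC : 0 ≤ C) (v v' : VelocityL2 V) :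
    0 ≤ impulseResponseDist C v v' := by
  have hκ := (flowBound_pos C v).le
  have hκ' := (flowBound_pos C v').le
  have hmod := integratedModulus_nonneg v
    (flowBound C v * (flowBound C v * (C * ‖v' - v‖) + C * ‖v' - v‖))
  unfold impulseResponseDist transportedJacobianDist
  positivity

lemma flowVariation_smul (v w : VelocityL2 V) (s t : ℝ) (x : E) (c : ℝ) :
    flowVariation v (c • w) s t x = c • flowVariation v w s t x := by
  rw [flowVariation, flowVariation, ← intervalIntegral.integral_smul]
  refine intervalIntegral.integral_congr_ae ?_
  filter_upwards [extendZero_smul c w] with q hq _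
  rw [hq, impulseResponse, impulseResponse, RKHS.coe_smul, Pi.smul_apply, map_smul]

namespace IsAdmissibleWith

lemma tendsto_impulseResponseDist (hV : IsAdmissibleWith Ω V C) (v : VelocityL2 V) :
    Tendsto (impulseResponseDist C v) (𝓝 v) (𝓝 0) := by
  have hv : Tendsto (fun v' => C * ‖v' - v‖) (𝓝 v) (𝓝 0) := by
    simpa only [id_eq, mul_zero] using
      (tendsto_iff_norm_sub_tendsto_zero.1 (tendsto_id (x := 𝓝 v))).const_mul C
  have hδ : Tendsto (fun v' => flowBound C v * (flowBound C v * (C * ‖v' - v‖) + C * ‖v' - v‖))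
      (𝓝 v) (𝓝 0) := by
    simpa only [mul_zero, add_zero] using
      ((hv.const_mul (flowBound C v)).add hv).const_mul (flowBound C v)
  have hmod := (hV.tendsto_integratedModulus v).comp hδ
  have hκ := (continuous_flowBound C (V := V)).tendsto v
  unfold impulseResponseDist transportedJacobianDist
  simpa only [add_zero, mul_zero, zero_mul, Function.comp_apply] using
    (((hκ.mul (hv.add hmod)).const_mul (flowBound C v)).mul_const C).add
      (((hv.const_mul (flowBound C v)).const_mul C).const_mul (flowBound C v))

variable [CompleteSpace E]

lemma continuous_flowMap_comp (hV : IsAdmissibleWith Ω V C) {α : Type*} [TopologicalSpace α]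
    {v : α → VelocityL2 V} {s t : α → ℝ} {x : α → E} (hv : Continuous v) (hs : Continuous s)
    (ht : Continuous t) (hx : Continuous x) :
    Continuous fun a => flowMap (v a) (s a) (t a) (x a) :=
  hV.continuous_flowMap.comp (((hv.prodMk (hs.prodMk ht))).prodMk hx)

lemma continuous_flowJacobian_comp (hV : IsAdmissibleWith Ω V C) {α : Type*}
    [TopologicalSpace α] {v : α → VelocityL2 V} {s t : α → ℝ} {x : α → E} (hv : Continuous v)
    (hs : Continuous s) (ht : Continuous t) (hx : Continuous x) :
    Continuous fun a => flowJacobian (v a) (s a) (t a) (x a) :=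
  hV.continuous_flowJacobian.comp ((hv.prodMk (hs.prodMk ht)).prodMk hx)

lemma continuous_impulseResponse (hV : IsAdmissibleWith Ω V C) {α : Type*} [TopologicalSpace α]
    {v : α → VelocityL2 V} {s q : α → ℝ} {x : α → E} {u : α → V} (t : ℝ) (hv : Continuous v)
    (hs : Continuous s) (hq : Continuous q) (hx : Continuous x) (hu : Continuous u) :
    Continuous fun a => impulseResponse (v a) (s a) t (q a) (x a) (u a) := by
  have hflow := hV.continuous_flowMap_comp hv hs hq hx
  exact (hV.continuous_flowJacobian_comp hv hq continuous_const hflow).clm_apply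
    (hV.continuous_eval.comp (hu.prodMk hflow))

lemma norm_impulseResponse_le (hV : IsAdmissibleWith Ω V C) (v : VelocityL2 V) (s t q : ℝ)
    (x : E) (u : V) : ‖impulseResponse v s t q x u‖ ≤ flowBound C v * (C * ‖u‖) :=
  (ContinuousLinearMap.le_opNorm _ _).trans
    (mul_le_mul (hV.norm_flowJacobian_le _ _ _ _) (hV.norm_le _ _) (norm_nonneg _)
      (flowBound_pos C v).le)

lemma norm_flowJacobian_flowMap_sub_le (hV : IsAdmissibleWith Ω V C) (v v' : VelocityL2 V)
    (s t q : ℝ) (x : E) :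
    ‖flowJacobian v' q t (flowMap v' s q x) - flowJacobian v q t (flowMap v s q x)‖
      ≤ transportedJacobianDist C v v' := by
  have hκ := (flowBound_pos C v).le
  have hκ' := (flowBound_pos C v').le
  have hflow := hV.norm_flowMap_sub_le v v' x x s q
  rw [sub_self, norm_zero, zero_add] at hflow
  refine (hV.norm_flowJacobian_sub_le v v' _ _ q t).trans ?_
  unfold transportedJacobianDist
  gcongr
  exact hV.integratedModulus_mono v (by gcongr)

lemma norm_impulseResponse_sub_le (hV : IsAdmissibleWith Ω V C) (v v' : VelocityL2 V)
    (s t q : ℝ) (x : E) (u : V) :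
    ‖impulseResponse v' s t q x u - impulseResponse v s t q x u‖
      ≤ impulseResponseDist C v v' * ‖u‖ := by
  set y := flowMap v s q x with hy
  set y' := flowMap v' s q x with hy'
  have hflow := hV.norm_flowMap_sub_le v v' x x s q
  rw [sub_self, norm_zero, zero_add] at hflow
  have hjac := hV.norm_flowJacobian_flowMap_sub_le v v' s t q x
  have hsplit : impulseResponse v' s t q x u - impulseResponse v s t q x u
      = (flowJacobian v' q t y' - flowJacobian v q t y) (u y')
        + flowJacobian v q t y (u y' - u y) := by
    simp only [impulseResponse, sub_apply, map_sub, ← hy, ← hy']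
    abel
  have hmul : ‖(flowJacobian v' q t y' - flowJacobian v q t y) (u y')‖
      ≤ transportedJacobianDist C v v' * (C * ‖u‖) :=
    (ContinuousLinearMap.le_opNorm _ _).trans
      (mul_le_mul hjac (hV.norm_le _ _) (norm_nonneg _) ((norm_nonneg _).trans hjac))
  have hlip : ‖flowJacobian v q t y (u y' - u y)‖
      ≤ flowBound C v * (C * ‖u‖ * (flowBound C v * (C * ‖v' - v‖))) :=
    (ContinuousLinearMap.le_opNorm _ _).trans
      (mul_le_mul (hV.norm_flowJacobian_le _ _ _ _) ((hV.norm_sub_le _ _ _).trans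
        (mul_le_mul_of_nonneg_left hflow (mul_nonneg hV.nonneg (norm_nonneg u))))
        (norm_nonneg _) (flowBound_pos C v).le)
  rw [hsplit]
  refine (norm_add_le _ _).trans ((add_le_add hmul hlip).trans_eq ?_)
  unfold impulseResponseDist
  ring

lemma stronglyMeasurable_impulseResponse (hV : IsAdmissibleWith Ω V C) (v w : VelocityL2 V)
    (s t : ℝ) (x : E) :
    StronglyMeasurable fun q => impulseResponse v s t q x (extendZero w q) :=
  (hV.continuous_impulseResponse (v := fun _ => v) (s := fun _ => s) (x := fun _ => x)
    (q := Prod.fst) (u := Prod.snd) t continuous_const continuous_const continuous_fst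
    continuous_const continuous_snd).comp_stronglyMeasurable
      (stronglyMeasurable_id.prodMk (stronglyMeasurable_extendZero w))

lemma integrable_impulseResponse (hV : IsAdmissibleWith Ω V C) (v w : VelocityL2 V) (s t : ℝ)
    (x : E) : Integrable fun q => impulseResponse v s t q x (extendZero w q) :=
  (((integrable_norm_extendZero w).const_mul C).const_mul (flowBound C v)).mono'
    (hV.stronglyMeasurable_impulseResponse v w s t x).aestronglyMeasurable
    (Eventually.of_forall fun _ => hV.norm_impulseResponse_le _ _ _ _ _ _)

lemma flowJacobian_impulseResponse (hV : IsAdmissibleWith Ω V C) (v : VelocityL2 V)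
    (s t q : ℝ) (x : E) (u : V) :
    flowJacobian v s t x (impulseResponse v s s q x u) = impulseResponse v s t q x u := by
  have hcomp := hV.flowJacobian_comp v q s t (flowMap v s q x)
  rw [hV.flowMap_flowMap_self] at hcomp
  exact congrArg (fun A : E →L[ℝ] E => A (u (flowMap v s q x))) hcomp

lemma impulseResponse_self (hV : IsAdmissibleWith Ω V C) (v : VelocityL2 V) (s t : ℝ) (x : E)
    (u : V) : impulseResponse v s t t x u = u (flowMap v s t x) := by
  rw [impulseResponse, hV.flowJacobian_self, ContinuousLinearMap.id_apply]

lemma flowVariation_eq_flowJacobian_apply (hV : IsAdmissibleWith Ω V C) (v w : VelocityL2 V)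
    (s t : ℝ) (x : E) : flowVariation v w s t x
      = flowJacobian v s t x (∫ q in s..t, impulseResponse v s s q x (extendZero w q)) := by
  rw [← ContinuousLinearMap.intervalIntegral_comp_comm _
    (hV.integrable_impulseResponse v w s s x).intervalIntegrable]
  simp only [hV.flowJacobian_impulseResponse, flowVariation]

lemma isSolution_flowVariation (hV : IsAdmissibleWith Ω V C) (v w : VelocityL2 V) (s : ℝ) (x : E) :
    IsSolution (fun r y => linearisedField v s x r y + extendZero w r (flowMap v s r x)) s 0
      fun t => flowVariation v w s t x := by
  have hint := hV.integrable_impulseResponse v w s s x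
  simp only [hV.flowVariation_eq_flowJacobian_apply]
  refine ⟨(hV.continuous_flowJacobian_time v s x).clm_apply
    (intervalIntegral.continuous_primitive (fun _ _ => hint.intervalIntegrable) s), fun t => ?_⟩
  have hproduct := primitive_apply_primitive (J := fun r => flowJacobian v s r x)
    (hV.intervalIntegrable_linearisedField_comp v s x s t) hint.intervalIntegrable
    fun u _ => by
      rw [(hV.isSolution_flowJacobian v s x).eq_integral u, hV.flowJacobian_self]
  simp only [hV.flowJacobian_impulseResponse, hV.impulseResponse_self] at hproduct
  rw [zero_add, hproduct]
  rfl

lemma norm_flowMap_add_sub_sub_flowVariation_le (hV : IsAdmissibleWith Ω V C)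
    (v w : VelocityL2 V) (s t : ℝ) (x : E) :
    ‖flowMap (v + w) s t x - flowMap v s t x - flowVariation v w s t x‖ ≤
      flowBound C v * ((integratedModulus v (flowBound C v * (C * ‖w‖)) + C * ‖w‖)
        * (flowBound C v * (C * ‖w‖))) := by
  simpa only [add_zero, norm_zero, zero_add] using
    hV.norm_flowMap_add_sub_sub_le v w x 0 (hV.isSolution_flowVariation v w s x) t

lemma norm_flowVariation_le (hV : IsAdmissibleWith Ω V C) (v w : VelocityL2 V) (s t : ℝ)
    (x : E) : ‖flowVariation v w s t x‖ ≤ flowBound C v * (C * ‖w‖) := by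
  have hκ := (flowBound_pos C v).le
  have hint : Integrable fun r => flowBound C v * (C * ‖extendZero w r‖) :=
    ((integrable_norm_extendZero w).const_mul C).const_mul _
  refine (intervalIntegral.norm_integral_le_abs_of_norm_le
    (Eventually.of_forall fun q => hV.norm_impulseResponse_le v s t q x (extendZero w q))
    hint.intervalIntegrable).trans ((abs_intervalIntegral_le_integral hint (fun r =>
      mul_nonneg hκ (mul_nonneg hV.nonneg (norm_nonneg _))) _ _).trans ?_)
  rw [integral_const_mul]
  exact mul_le_mul_of_nonneg_left (integral_mul_norm_extendZero_le hV.nonneg w) hκ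

lemma hasDerivAt_flowMap (hV : IsAdmissibleWith Ω V C) (v w : VelocityL2 V) (s t : ℝ) (x : E)
    (e : ℝ) :
    HasDerivAt (fun e : ℝ => flowMap (v + e • w) s t x) (flowVariation (v + e • w) w s t x) e := by
  rw [hasDerivAt_iff_isLittleO_nhds_zero, Asymptotics.isLittleO_iff]
  intro c hc
  set v₁ := v + e • w with hv₁
  set κ := flowBound C v₁
  have hrate : Tendsto (fun h : ℝ => κ * ((integratedModulus v₁ (κ * (C * (|h| * ‖w‖)))
      + C * (|h| * ‖w‖)) * (κ * (C * ‖w‖)))) (𝓝 0) (𝓝 0) := by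
    have hw : Tendsto (fun h : ℝ => C * (|h| * ‖w‖)) (𝓝 0) (𝓝 0) :=
      Continuous.tendsto' (by fun_prop) _ _ (by rw [abs_zero, zero_mul, mul_zero])
    have hmod := (hV.tendsto_integratedModulus v₁).comp
      (Continuous.tendsto' (by fun_prop : Continuous fun h : ℝ => κ * (C * (|h| * ‖w‖))) 0 0
        (by rw [abs_zero, zero_mul, mul_zero, mul_zero]))
    simpa only [add_zero, zero_mul, mul_zero, Function.comp_apply] using
      ((hmod.add hw).mul_const (κ * (C * ‖w‖))).const_mul κ
  filter_upwards [hrate.eventually (gt_mem_nhds hc)] with h hh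
  have hle := hV.norm_flowMap_add_sub_sub_flowVariation_le v₁ (h • w) s t x
  rw [flowVariation_smul, norm_smul, Real.norm_eq_abs] at hle
  rw [add_smul, ← add_assoc, ← hv₁]
  refine hle.trans ?_
  calc κ * ((integratedModulus v₁ (κ * (C * (|h| * ‖w‖))) + C * (|h| * ‖w‖))
        * (κ * (C * (|h| * ‖w‖))))
      = κ * ((integratedModulus v₁ (κ * (C * (|h| * ‖w‖))) + C * (|h| * ‖w‖))
        * (κ * (C * ‖w‖))) * |h| := by ring
    _ ≤ c * ‖h‖ := by rw [Real.norm_eq_abs]; gcongr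

end IsAdmissibleWith

end Variation

section Composition

variable {n : ℕ} {Ω : Set (Space n)} {V : Type*} [NormedAddCommGroup V] [InnerProductSpace ℝ V]
  [RKHS ℝ V (Space n) (Space n)] {C : ℝ} {E : Type*} [NormedAddCommGroup E]

namespace IsAdmissibleWith

lemma continuous_flowMap_right (hV : IsAdmissibleWith Ω V C) (v : VelocityL2 V) (s t : ℝ) :
    Continuous (flowMap v s t) :=
  hV.continuous_flowMap_comp continuous_const continuous_const continuous_const continuous_id

lemma continuous_flowJacobian_right (hV : IsAdmissibleWith Ω V C) (v : VelocityL2 V) (s t : ℝ) :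
    Continuous (flowJacobian v s t) :=
  hV.continuous_flowJacobian_comp continuous_const continuous_const continuous_const continuous_id

lemma image_flowMap (hV : IsAdmissibleWith Ω V C) (v : VelocityL2 V) (s t : ℝ)
    (S : Set (Space n)) : flowMap v s t '' S = flowMap v t s ⁻¹' S :=
  congrFun (Set.image_eq_preimage_of_inverse (hV.flowMap_flowMap_self v s t)
    (hV.flowMap_flowMap_self v t s)) S

lemma geomAct_transition (hV : IsAdmissibleWith Ω V C) (v : VelocityL2 V) {t : ℝ}
    (ht : t ∈ Icc (0 : ℝ) 1) (u : Space n → ℝ) :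
    geomAct (transition v 0 t) u = u ∘ flowMap v t 0 := by
  rw [geomAct, hV.transition_eq_flowMap v (left_mem_Icc.2 zero_le_one) ht, hV.invFun_flowMap]

lemma comp_flowMap_eq_zero {g : Space n → E} {ρ M : ℝ} {v : VelocityL2 V} {x : Space n}
    (hV : IsAdmissibleWith Ω V C) (hg : tsupport g ⊆ Metric.closedBall 0 ρ) (hv : ‖v‖ ≤ M)
    (hx : x ∉ Metric.closedBall 0 (ρ + C * M)) (s t : ℝ) : g (flowMap v s t x) = 0 := by
  by_contra hne
  have hρ := mem_closedBall_zero_iff.1 (hg (subset_tsupport _ hne))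
  have htravel := (hV.norm_flowMap_sub_self_le v s t x).trans
    (mul_le_mul_of_nonneg_left hv hV.nonneg)
  have htri := norm_sub_norm_le x (flowMap v s t x)
  rw [norm_sub_rev] at htri
  exact hx (mem_closedBall_zero_iff.2 (by linarith))

lemma eLpNorm_comp_flowMap_sub_le {g : Space n → E} {ρ M δ : ℝ} {η : NNReal} {v : VelocityL2 V}
    {s t : ℝ} {p : VelocityL2 V × ℝ × ℝ} (hV : IsAdmissibleWith Ω V C)
    (hg : tsupport g ⊆ Metric.closedBall 0 ρ) (hgδ : ∀ ⦃x y⦄, dist x y < δ → dist (g x) (g y) < η)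
    (hv : ‖v‖ ≤ M) (hp : ‖p.1‖ ≤ M) (hpδ : flowMapDist C v s t p < δ) :
    eLpNorm (g ∘ flowMap p.1 p.2.1 p.2.2 - g ∘ flowMap v s t) 2 (volume.restrict Ω)
      ≤ η * volume (Metric.closedBall (0 : Space n) (ρ + C * M)) ^ (1 / 2 : ℝ) := by
  set B := Metric.closedBall (0 : Space n) (ρ + C * M)
  have hpointwise : ∀ x, ‖(g ∘ flowMap p.1 p.2.1 p.2.2 - g ∘ flowMap v s t) x‖ₑ
      ≤ ‖B.indicator (fun _ => (η : ℝ)) x‖ₑ := by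
    intro x
    rw [enorm_le_iff_norm_le, Pi.sub_apply, Function.comp_apply, Function.comp_apply]
    by_cases hx : x ∈ B
    · rw [indicator_of_mem hx, ← dist_eq_norm, Real.norm_of_nonneg η.coe_nonneg]
      exact (hgδ ((dist_eq_norm _ _).trans_lt
        ((hV.norm_flowMap_sub_le_flowMapDist v s t p x).trans_lt hpδ))).le
    · rw [hV.comp_flowMap_eq_zero hg hp hx, hV.comp_flowMap_eq_zero hg hv hx, sub_zero, norm_zero]
      exact norm_nonneg _
  refine (eLpNorm_mono_enorm hpointwise).trans ((eLpNorm_indicator_const_le _ _).trans ?_)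
  rw [Real.enorm_of_nonneg η.coe_nonneg, ENNReal.ofReal_coe_nnreal, ENNReal.toReal_ofNat]
  gcongr
  exact Measure.restrict_le_self

lemma tendsto_eLpNorm_comp_flowMap_sub (hV : IsAdmissibleWith Ω V C) {g : Space n → E}
    (hg : Continuous g) (hgc : HasCompactSupport g) (v : VelocityL2 V) (s t : ℝ) :
    Tendsto (fun p : VelocityL2 V × ℝ × ℝ =>
      eLpNorm (g ∘ flowMap p.1 p.2.1 p.2.2 - g ∘ flowMap v s t) 2 (volume.restrict Ω))
      (𝓝 (v, s, t)) (𝓝 0) := by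
  obtain ⟨ρ, hρ⟩ := hgc.isBounded.subset_closedBall (0 : Space n)
  have hvol : volume (Metric.closedBall (0 : Space n) (ρ + C * (‖v‖ + 1))) ^ (1 / 2 : ℝ) ≠ ⊤ :=
    ENNReal.rpow_ne_top_of_nonneg (by norm_num) measure_closedBall_lt_top.ne
  rw [ENNReal.tendsto_nhds_zero]
  intro ε hε
  obtain ⟨η, hη, hηε⟩ : ∃ η : NNReal, 0 < η ∧
      η * volume (Metric.closedBall (0 : Space n) (ρ + C * (‖v‖ + 1))) ^ (1 / 2 : ℝ) ≤ ε := by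
    rcases eq_or_ne ε ⊤ with rfl | -
    · exact ⟨1, one_pos, le_top⟩
    · obtain ⟨η, hη, hlt⟩ := ENNReal.exists_nnreal_pos_mul_lt hvol hε.ne'
      exact ⟨η, hη, hlt.le⟩
  obtain ⟨δ, hδ, hgδ⟩ := Metric.uniformContinuous_iff.1
    (hg.uniformContinuous_of_tendsto_cocompact hgc.is_zero_at_infty) η hη
  have hnorm : ∀ᶠ p : VelocityL2 V × ℝ × ℝ in 𝓝 (v, s, t), ‖p.1‖ ≤ ‖v‖ + 1 :=
    (continuous_fst.norm.tendsto (v, s, t)).eventually (ge_mem_nhds (lt_add_one _))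
  filter_upwards [hnorm, (tendsto_flowMapDist (C := C) v s t).eventually (gt_mem_nhds hδ)]
    with p hp hpδ
  exact (hV.eLpNorm_comp_flowMap_sub_le hρ hgδ (lt_add_one _).le hp hpδ).trans hηε

lemma exists_map_flowMap_le (hV : IsAdmissibleWith Ω V C) (hΩ : MeasurableSet Ω) (M : ℝ) :
    ∃ K : ℝ, 0 < K ∧ ∀ v : VelocityL2 V, flowBound C v ≤ M → ∀ s t,
      Measure.map (flowMap v s t) (volume.restrict Ω)
        ≤ ENNReal.ofReal K • volume.restrict Ω := by
  obtain ⟨K, hK0, hK⟩ := exists_abs_det_le (E := Space n) M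
  refine ⟨K, hK0, fun v hv s t => Measure.le_iff.2 fun S hS => ?_⟩
  have hmeas := (hV.continuous_flowMap_right v s t).measurable
  have hpreimage : flowMap v s t ⁻¹' S ∩ Ω = flowMap v t s '' (S ∩ Ω) := by
    rw [hV.image_flowMap, preimage_inter]
    exact congrArg _ (Set.ext fun x => (hV.flowMap_mem_iff v s t).symm)
  rw [Measure.map_apply hmeas hS, Measure.restrict_apply (hmeas hS), Measure.smul_apply,
    Measure.restrict_apply hS, hpreimage,
    ← lintegral_abs_det_fderiv_eq_addHaar_image volume (hS.inter hΩ)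
      (fun x _ => (hV.hasFDerivAt_flowMap v t s x).hasFDerivWithinAt)
      (hV.bijective_flowMap v t s).1.injOn, smul_eq_mul, ← setLIntegral_const]
  exact lintegral_mono fun x => ENNReal.ofReal_le_ofReal
    (hK _ ((hV.norm_flowJacobian_le v t s x).trans hv))

lemma quasiMeasurePreserving_flowMap (hV : IsAdmissibleWith Ω V C) (hΩ : MeasurableSet Ω)
    (v : VelocityL2 V) (s t : ℝ) :
    Measure.QuasiMeasurePreserving (flowMap v s t) (volume.restrict Ω) (volume.restrict Ω) := by
  obtain ⟨K, _, hK⟩ := hV.exists_map_flowMap_le hΩ (flowBound C v)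
  exact ⟨(hV.continuous_flowMap_right v s t).measurable,
    Measure.absolutelyContinuous_of_le_smul (hK v le_rfl s t)⟩

lemma memLp_comp_flowMap (hV : IsAdmissibleWith Ω V C) (hΩ : MeasurableSet Ω) {h : Space n → E}
    (hh : MemLp h 2 (volume.restrict Ω)) (v : VelocityL2 V) (s t : ℝ) :
    MemLp (h ∘ flowMap v s t) 2 (volume.restrict Ω) := by
  obtain ⟨K, _, hK⟩ := hV.exists_map_flowMap_le hΩ (flowBound C v)
  exact (hh.of_measure_le_smul ENNReal.ofReal_ne_top (hK v le_rfl s t)).comp_of_map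
    (hV.continuous_flowMap_right v s t).aemeasurable

lemma exists_eLpNorm_comp_flowMap_le (hV : IsAdmissibleWith Ω V C) (hΩ : MeasurableSet Ω)
    (M : ℝ) : ∃ K : ℝ, 0 < K ∧ ∀ v : VelocityL2 V, flowBound C v ≤ M → ∀ s t,
      ∀ h : Space n → E, MemLp h 2 (volume.restrict Ω) →
        eLpNorm (h ∘ flowMap v s t) 2 (volume.restrict Ω)
          ≤ ENNReal.ofReal K * eLpNorm h 2 (volume.restrict Ω) := by
  obtain ⟨K, hK0, hK⟩ := hV.exists_map_flowMap_le hΩ M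
  refine ⟨K ^ (1 / 2 : ℝ), by positivity, fun v hv s t h hh => ?_⟩
  have hmap := (hh.of_measure_le_smul ENNReal.ofReal_ne_top (hK v hv s t)).aestronglyMeasurable
  rw [← eLpNorm_map_measure hmap (hV.continuous_flowMap_right v s t).aemeasurable]
  refine (eLpNorm_mono_measure h (hK v hv s t)).trans_eq ?_
  rw [eLpNorm_smul_measure_of_ne_top ENNReal.ofNat_ne_top, smul_eq_mul,
    ENNReal.ofReal_rpow_of_pos hK0, ENNReal.toReal_div, ENNReal.toReal_one, ENNReal.toReal_ofNat]

lemma exists_norm_toLp_comp_flowMap_le (hV : IsAdmissibleWith Ω V C) (hΩ : MeasurableSet Ω)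
    (M : ℝ) : ∃ K : ℝ, 0 < K ∧ ∀ v : VelocityL2 V, flowBound C v ≤ M → ∀ s t,
      ∀ F : Lp E 2 (volume.restrict Ω),
        ‖(hV.memLp_comp_flowMap hΩ (Lp.memLp F) v s t).toLp (F ∘ flowMap v s t)‖ ≤ K * ‖F‖ := by
  obtain ⟨K, hK0, hK⟩ := hV.exists_eLpNorm_comp_flowMap_le hΩ (E := E) M
  refine ⟨K, hK0, fun v hv s t F => ?_⟩
  rw [Lp.norm_toLp, Lp.norm_def, ← ENNReal.toReal_ofReal hK0.le, ← ENNReal.toReal_mul]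
  exact ENNReal.toReal_mono (ENNReal.mul_ne_top ENNReal.ofReal_ne_top (Lp.eLpNorm_ne_top F))
    (hK v hv s t F (Lp.memLp F))

end IsAdmissibleWith

end Composition

section Pullback

variable {n : ℕ} {Ω : Set (Space n)} {V : Type*} [NormedAddCommGroup V] [InnerProductSpace ℝ V]
  [RKHS ℝ V (Space n) (Space n)] {C : ℝ} {E : Type*} [NormedAddCommGroup E] [NormedSpace ℝ E]

namespace IsAdmissibleWith

/-- The operator `F ↦ F ∘ φ_{s,t}^v` on `L²(Ω)`. -/
def flowPullback (hV : IsAdmissibleWith Ω V C) (hΩ : MeasurableSet Ω) (v : VelocityL2 V)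
    (s t : ℝ) : Lp E 2 (volume.restrict Ω) →L[ℝ] Lp E 2 (volume.restrict Ω) :=
  LinearMap.mkContinuousOfExistsBound
    { toFun := fun F => (hV.memLp_comp_flowMap hΩ (Lp.memLp F) v s t).toLp (F ∘ flowMap v s t)
      map_add' := fun F G => by
        rw [← MemLp.toLp_add]
        exact MemLp.toLp_congr _ _
          ((hV.quasiMeasurePreserving_flowMap hΩ v s t).ae_eq_comp (Lp.coeFn_add F G))
      map_smul' := fun c F => by
        rw [RingHom.id_apply, ← MemLp.toLp_const_smul]
        exact MemLp.toLp_congr _ _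
          ((hV.quasiMeasurePreserving_flowMap hΩ v s t).ae_eq_comp (Lp.coeFn_smul c F)) }
    (by
      obtain ⟨K, _, hK⟩ := hV.exists_norm_toLp_comp_flowMap_le hΩ (E := E) (flowBound C v)
      exact ⟨K, hK v le_rfl s t⟩)

lemma flowPullback_apply (hV : IsAdmissibleWith Ω V C) (hΩ : MeasurableSet Ω) (v : VelocityL2 V)
    (s t : ℝ) (F : Lp E 2 (volume.restrict Ω)) :
    hV.flowPullback hΩ v s t F
      = (hV.memLp_comp_flowMap hΩ (Lp.memLp F) v s t).toLp (F ∘ flowMap v s t) := rfl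

lemma coeFn_flowPullback (hV : IsAdmissibleWith Ω V C) (hΩ : MeasurableSet Ω) (v : VelocityL2 V)
    (s t : ℝ) (F : Lp E 2 (volume.restrict Ω)) :
    hV.flowPullback hΩ v s t F =ᵐ[volume.restrict Ω] F ∘ flowMap v s t :=
  (hV.memLp_comp_flowMap hΩ (Lp.memLp F) v s t).coeFn_toLp

lemma flowPullback_toLp (hV : IsAdmissibleWith Ω V C) (hΩ : MeasurableSet Ω) (v : VelocityL2 V)
    (s t : ℝ) {h : Space n → E} (hh : MemLp h 2 (volume.restrict Ω)) :
    hV.flowPullback hΩ v s t (hh.toLp h)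
      = (hV.memLp_comp_flowMap hΩ hh v s t).toLp (h ∘ flowMap v s t) := by
  rw [flowPullback_apply]
  exact MemLp.toLp_congr _ _
    ((hV.quasiMeasurePreserving_flowMap hΩ v s t).ae_eq_comp hh.coeFn_toLp)

lemma exists_norm_flowPullback_le (hV : IsAdmissibleWith Ω V C) (hΩ : MeasurableSet Ω) (M : ℝ) :
    ∃ K : ℝ, 0 < K ∧ ∀ v : VelocityL2 V, flowBound C v ≤ M → ∀ s t,
      ∀ F : Lp E 2 (volume.restrict Ω), ‖hV.flowPullback hΩ v s t F‖ ≤ K * ‖F‖ :=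
  hV.exists_norm_toLp_comp_flowMap_le hΩ M

lemma tendsto_flowPullback_toLp (hV : IsAdmissibleWith Ω V C) (hΩ : MeasurableSet Ω)
    {g : Space n → E} (hg : Continuous g) (hgc : HasCompactSupport g)
    (hg2 : MemLp g 2 (volume.restrict Ω)) (v : VelocityL2 V) (s t : ℝ) :
    Tendsto (fun p : VelocityL2 V × ℝ × ℝ => hV.flowPullback hΩ p.1 p.2.1 p.2.2 (hg2.toLp g))
      (𝓝 (v, s, t)) (𝓝 (hV.flowPullback hΩ v s t (hg2.toLp g))) := by
  simp only [flowPullback_toLp]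
  exact (Lp.tendsto_Lp_iff_tendsto_eLpNorm'' _ _ _ _).2
    (hV.tendsto_eLpNorm_comp_flowMap_sub hg hgc v s t)

lemma continuous_flowPullback (hV : IsAdmissibleWith Ω V C) (hΩ : MeasurableSet Ω)
    (F : Lp E 2 (volume.restrict Ω)) :
    Continuous fun p : VelocityL2 V × ℝ × ℝ => hV.flowPullback hΩ p.1 p.2.1 p.2.2 F := by
  rw [continuous_iff_continuousAt]
  rintro ⟨v, s, t⟩
  obtain ⟨K, hK0, hK⟩ := hV.exists_norm_flowPullback_le hΩ (E := E) (flowBound C v + 1)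
  have hbound : ∀ᶠ p : VelocityL2 V × ℝ × ℝ in 𝓝 (v, s, t), flowBound C p.1 ≤ flowBound C v + 1 :=
    (((continuous_flowBound C).comp continuous_fst).tendsto (v, s, t)).eventually
      (ge_mem_nhds (lt_add_one _))
  rw [ContinuousAt, Metric.tendsto_nhds]
  intro ε hε
  obtain ⟨g, hgc, hgF, hg, hg2⟩ := (Lp.memLp F).exists_hasCompactSupport_eLpNorm_sub_le
    ENNReal.ofNat_ne_top (ε := ENNReal.ofReal (ε / (4 * K)))
    (ENNReal.ofReal_pos.2 (by positivity)).ne'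
  have hFg : ‖F - hg2.toLp g‖ ≤ ε / (4 * K) := by
    rw [← Lp.toLp_coeFn F (Lp.memLp F), ← MemLp.toLp_sub, Lp.norm_toLp]
    exact ENNReal.toReal_le_of_le_ofReal (by positivity) hgF
  have happrox : ∀ v' : VelocityL2 V, flowBound C v' ≤ flowBound C v + 1 → ∀ s' t',
      ‖hV.flowPullback hΩ v' s' t' F - hV.flowPullback hΩ v' s' t' (hg2.toLp g)‖ ≤ ε / 4 := by
    intro v' hv' s' t'
    rw [← map_sub]
    refine (hK v' hv' s' t' _).trans ((mul_le_mul_of_nonneg_left hFg hK0.le).trans_eq ?_)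
    field_simp
  filter_upwards [hbound, Metric.tendsto_nhds.1
    (hV.tendsto_flowPullback_toLp hΩ hg hgc hg2 v s t) (ε / 4) (by positivity)] with p hp hclose
  have hp' := happrox p.1 hp p.2.1 p.2.2
  have hv' := happrox v (le_add_of_nonneg_right zero_le_one) s t
  rw [← dist_eq_norm] at hp' hv'
  rw [dist_comm] at hv'
  linarith [dist_triangle4 (hV.flowPullback hΩ p.1 p.2.1 p.2.2 F)
    (hV.flowPullback hΩ p.1 p.2.1 p.2.2 (hg2.toLp g)) (hV.flowPullback hΩ v s t (hg2.toLp g))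
    (hV.flowPullback hΩ v s t F)]

end IsAdmissibleWith

lemma toL2_of_memLp {u : Space n → ℝ} (hu : MemLp u 2 (volume.restrict Ω)) :
    toL2 Ω u = hu.toLp u := by
  rw [toL2, dif_pos hu]

namespace IsAdmissibleWith

lemma deformed_eq_flowPullback (hV : IsAdmissibleWith Ω V C) (hΩ : MeasurableSet Ω)
    (v : VelocityL2 V) {t : ℝ} (ht : t ∈ Icc (0 : ℝ) 1) (F : ImageL2 Ω) :
    deformed v t F = hV.flowPullback hΩ v t 0 F := by
  rw [deformed, hV.geomAct_transition v ht,
    toL2_of_memLp (hV.memLp_comp_flowMap hΩ (Lp.memLp F) v t 0), flowPullback_apply]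

lemma memLp_jacComp (hV : IsAdmissibleWith Ω V C) (hΩ : MeasurableSet Ω) (v : VelocityL2 V)
    (s t : ℝ) (F : ImageL2 Ω) : MemLp (jacComp (flowMap v s t) F) 2 (volume.restrict Ω) := by
  obtain ⟨K, -, hK⟩ := exists_abs_det_le (E := Space n) (flowBound C v)
  have hcomp := hV.memLp_comp_flowMap hΩ (Lp.memLp F) v s t
  have hdet : Continuous fun x => (fderiv ℝ (flowMap v s t) x).det := by
    simp_rw [hV.fderiv_flowMap]
    exact ContinuousLinearMap.continuous_det.comp (hV.continuous_flowJacobian_right v s t)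
  refine hcomp.of_le_mul (c := K) (hdet.aestronglyMeasurable.mul hcomp.aestronglyMeasurable)
    (Eventually.of_forall fun x => ?_)
  rw [jacComp, norm_mul, Real.norm_eq_abs, hV.fderiv_flowMap]
  exact mul_le_mul_of_nonneg_right (hK _ (hV.norm_flowJacobian_le _ _ _ _)) (norm_nonneg _)

-- Substitute `x = φ_{s,t} y` in `∫_Ω G h(φ_{t,s})`.
lemma toL2_jacComp (hV : IsAdmissibleWith Ω V C) (hΩ : MeasurableSet Ω) (v : VelocityL2 V)
    (s t : ℝ) (G : ImageL2 Ω) :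
    toL2 Ω (jacComp (flowMap v s t) G)
      = ContinuousLinearMap.adjoint (hV.flowPullback hΩ v t s : ImageL2 Ω →L[ℝ] ImageL2 Ω) G := by
  refine ext_inner_right ℝ fun h => ?_
  rw [ContinuousLinearMap.adjoint_inner_left, L2.inner_def, L2.inner_def,
    toL2_of_memLp (hV.memLp_jacComp hΩ v s t G)]
  have hpull : ∫ x in Ω, inner ℝ (G x) ((hV.flowPullback hΩ v t s h : ImageL2 Ω) x)
      = ∫ x in flowMap v s t '' Ω, G x * h (flowMap v t s x) := by
    rw [(hV.bijOn_flowMap v s t).image_eq]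
    refine integral_congr_ae ?_
    filter_upwards [hV.coeFn_flowPullback hΩ v t s h] with x hx
    rw [hx, Function.comp_apply, RCLike.inner_apply, conj_trivial, mul_comm]
  rw [hpull, integral_image_eq_integral_abs_det_fderiv_smul volume hΩ
    (fun x _ => (hV.hasFDerivAt_flowMap v s t x).hasFDerivWithinAt)
    (hV.bijective_flowMap v s t).1.injOn]
  refine integral_congr_ae ?_
  filter_upwards [(hV.memLp_jacComp hΩ v s t G).coeFn_toLp] with x hx
  rw [hx, hV.flowMap_flowMap_self, abs_of_pos (hV.det_flowJacobian_pos v s t x), jacComp,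
    hV.fderiv_flowMap]
  simp only [RCLike.inner_apply, conj_trivial, smul_eq_mul]
  ring

end IsAdmissibleWith

end Pullback

section InnerL2

variable {α E : Type*} {m : MeasurableSpace α} {μ : Measure α} [NormedAddCommGroup E]
  [InnerProductSpace ℝ E] {n : ℕ} {Ω : Set (Space n)} {M : ℝ}

lemma memLp_inner_of_norm_le {p : ENNReal} {h z : α → E} (hh : MemLp h p μ)
    (hz : AEStronglyMeasurable z μ) (hM : ∀ y, ‖z y‖ ≤ M) :
    MemLp (fun y => inner ℝ (h y) (z y)) p μ := by
  refine hh.of_le_mul (c := M) (hh.aestronglyMeasurable.inner hz)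
    (Eventually.of_forall fun y => ?_)
  rw [mul_comm]
  exact (norm_inner_le_norm _ _).trans (mul_le_mul_of_nonneg_left (hM y) (norm_nonneg _))

lemma norm_toL2_inner_le {h z : Space n → E} (hh : MemLp h 2 (volume.restrict Ω))
    (hz : AEStronglyMeasurable z (volume.restrict Ω)) (hM : ∀ y, ‖z y‖ ≤ M) :
    ‖toL2 Ω (fun y => inner ℝ (h y) (z y))‖ ≤ M * ‖hh.toLp h‖ := by
  rw [toL2_of_memLp (memLp_inner_of_norm_le hh hz hM)]
  refine Lp.norm_le_mul_norm_of_ae_le_mul ?_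
  filter_upwards [(memLp_inner_of_norm_le hh hz hM).coeFn_toLp, hh.coeFn_toLp] with y hy hy'
  rw [hy, hy', mul_comm]
  exact (norm_inner_le_norm _ _).trans (mul_le_mul_of_nonneg_left (hM y) (norm_nonneg _))

lemma inner_toL2 {u : Space n → ℝ} (hu : MemLp u 2 (volume.restrict Ω)) (h : ImageL2 Ω) :
    inner ℝ h (toL2 Ω u) = ∫ y in Ω, h y * u y := by
  rw [toL2_of_memLp hu, L2.inner_def]
  refine integral_congr_ae ?_
  filter_upwards [hu.coeFn_toLp] with y hy
  rw [hy, RCLike.inner_apply, conj_trivial, mul_comm]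

end InnerL2

section FlowVariation

variable {E : Type*} [NormedAddCommGroup E] [InnerProductSpace ℝ E] [CompleteSpace E]
  {Ω : Set E} {V : Type*} [NormedAddCommGroup V] [InnerProductSpace ℝ V] [RKHS ℝ V E E] {C : ℝ}

namespace IsAdmissibleWith

lemma continuous_impulseResponse_right (hV : IsAdmissibleWith Ω V C) (v : VelocityL2 V)
    (s t q : ℝ) (u : V) : Continuous fun y => impulseResponse v s t q y u :=
  hV.continuous_impulseResponse t continuous_const continuous_const continuous_const
    continuous_id continuous_const

lemma flowVariation_add (hV : IsAdmissibleWith Ω V C) (v w w' : VelocityL2 V) (s t : ℝ) (x : E) :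
    flowVariation v (w + w') s t x = flowVariation v w s t x + flowVariation v w' s t x := by
  rw [flowVariation, flowVariation, flowVariation, ← intervalIntegral.integral_add
    (hV.integrable_impulseResponse v w s t x).intervalIntegrable
    (hV.integrable_impulseResponse v w' s t x).intervalIntegrable]
  refine intervalIntegral.integral_congr_ae ?_
  filter_upwards [extendZero_add w w'] with q hq _
  rw [hq, impulseResponse, impulseResponse, impulseResponse, RKHS.coe_add, Pi.add_apply, map_add]

lemma norm_flowVariation_sub_le (hV : IsAdmissibleWith Ω V C) (v v' w : VelocityL2 V) (s t : ℝ)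
    (x : E) : ‖flowVariation v' w s t x - flowVariation v w s t x‖
      ≤ impulseResponseDist C v v' * ‖w‖ := by
  have hdist := impulseResponseDist_nonneg hV.nonneg v v'
  have hint := (integrable_norm_extendZero w).const_mul (impulseResponseDist C v v')
  rw [flowVariation, flowVariation, ← intervalIntegral.integral_sub
    (hV.integrable_impulseResponse v' w s t x).intervalIntegrable
    (hV.integrable_impulseResponse v w s t x).intervalIntegrable]
  refine (intervalIntegral.norm_integral_le_abs_of_norm_le (Eventually.of_forall fun q =>
      hV.norm_impulseResponse_sub_le v v' s t q x (extendZero w q))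
    hint.intervalIntegrable).trans ((abs_intervalIntegral_le_integral hint (fun r =>
      mul_nonneg hdist (norm_nonneg _)) _ _).trans ?_)
  rw [integral_const_mul]
  exact mul_le_mul_of_nonneg_left (integral_norm_extendZero_le w) hdist

variable [SecondCountableTopology E] [MeasurableSpace E] [BorelSpace E] {α : Type*}
  [TopologicalSpace α] [TopologicalSpace.PseudoMetrizableSpace α] [SecondCountableTopology α]
  [MeasurableSpace α] [OpensMeasurableSpace α]

lemma stronglyMeasurable_impulseResponse_uncurry (hV : IsAdmissibleWith Ω V C)
    {v : α → VelocityL2 V} {s q : α → ℝ} {u : α → V} (t : ℝ) (hv : Continuous v)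
    (hs : Continuous s) (hq : Continuous q) (hu : StronglyMeasurable u) :
    StronglyMeasurable fun p : α × E =>
      impulseResponse (v p.1) (s p.1) t (q p.1) p.2 (u p.1) := by
  have hcont : Continuous fun p : (α × E) × V =>
      impulseResponse (v p.1.1) (s p.1.1) t (q p.1.1) p.1.2 p.2 :=
    hV.continuous_impulseResponse t (by fun_prop) (by fun_prop) (by fun_prop) (by fun_prop)
      (by fun_prop)
  have hpair : StronglyMeasurable fun p : α × E => (p, u p.1) :=
    stronglyMeasurable_id.prodMk (hu.comp_measurable measurable_fst)
  have hcomp := hcont.comp_stronglyMeasurable hpair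
  exact hcomp

lemma stronglyMeasurable_flowVariation_uncurry (hV : IsAdmissibleWith Ω V C)
    {v : α → VelocityL2 V} (w : VelocityL2 V) (s t : ℝ) (hv : Continuous v) :
    StronglyMeasurable fun p : α × E => flowVariation (v p.1) w s t p.2 := by
  have himpulse := hV.stronglyMeasurable_impulseResponse_uncurry (α := α × ℝ)
    (v := fun a => v a.1) (s := fun _ => s) (q := fun a => a.2) (u := fun a => extendZero w a.2) t
    (by fun_prop) (by fun_prop) (by fun_prop)
    ((stronglyMeasurable_extendZero w).comp_measurable measurable_snd)
  have hswap : StronglyMeasurable (Function.uncurry fun (p : α × E) (q : ℝ) =>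
      impulseResponse (v p.1) s t q p.2 (extendZero w q)) :=
    himpulse.comp_measurable (g := fun z : (α × E) × ℝ => ((z.1.1, z.2), z.1.2)) (by fun_prop)
  unfold flowVariation intervalIntegral
  exact hswap.integral_prod_right.sub hswap.integral_prod_right

end IsAdmissibleWith

end FlowVariation

section ImageVariation

variable {n : ℕ} {Ω : Set (Space n)} {V : Type*} [NormedAddCommGroup V] [InnerProductSpace ℝ V]
  [RKHS ℝ V (Space n) (Space n)] {C : ℝ}

/-- The derivative with respect to `v`, in the direction `w`, of the deformed image at time `τ`,
where `g` is the gradient of the template. -/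
def imageVariation (Ω : Set (Space n)) (g : Space n → Space n) (v w : VelocityL2 V) (τ : ℝ) :
    ImageL2 Ω :=
  toL2 Ω fun y => inner ℝ (g (flowMap v τ 0 y)) (flowVariation v w τ 0 y)

/-- The first-order change of the deformed image at time `τ` caused by an impulse `u` of velocity
at time `q`, where `g` is the gradient of the template. -/
def imageImpulse (Ω : Set (Space n)) (g : Space n → Space n) (v : VelocityL2 V) (τ q : ℝ)
    (u : V) : ImageL2 Ω :=
  toL2 Ω fun y => inner ℝ (g (flowMap v τ 0 y)) (impulseResponse v τ 0 q y u)

namespace IsAdmissibleWith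

lemma aestronglyMeasurable_flowVariation (hV : IsAdmissibleWith Ω V C) (v w : VelocityL2 V)
    (s t : ℝ) (μ : Measure (Space n)) : AEStronglyMeasurable (flowVariation v w s t) μ :=
  ((hV.stronglyMeasurable_flowVariation_uncurry (α := ℝ) w s t continuous_const).comp_measurable
    (g := fun y : Space n => ((0 : ℝ), y)) (by fun_prop)).aestronglyMeasurable

variable {g : Space n → Space n}

lemma memLp_inner_flowVariation (hV : IsAdmissibleWith Ω V C) (hΩ : MeasurableSet Ω)
    (hg : MemLp g 2 (volume.restrict Ω)) (v w : VelocityL2 V) (τ : ℝ) :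
    MemLp (fun y => inner ℝ (g (flowMap v τ 0 y)) (flowVariation v w τ 0 y)) 2
      (volume.restrict Ω) :=
  memLp_inner_of_norm_le (hV.memLp_comp_flowMap hΩ hg v τ 0)
    (hV.aestronglyMeasurable_flowVariation v w τ 0 _) (hV.norm_flowVariation_le v w τ 0)

lemma memLp_inner_impulseResponse (hV : IsAdmissibleWith Ω V C) (hΩ : MeasurableSet Ω)
    (hg : MemLp g 2 (volume.restrict Ω)) (v : VelocityL2 V) (τ q : ℝ) (u : V) :
    MemLp (fun y => inner ℝ (g (flowMap v τ 0 y)) (impulseResponse v τ 0 q y u)) 2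
      (volume.restrict Ω) :=
  memLp_inner_of_norm_le (hV.memLp_comp_flowMap hΩ hg v τ 0)
    (hV.continuous_impulseResponse_right v τ 0 q u).aestronglyMeasurable
    fun y => hV.norm_impulseResponse_le v τ 0 q y u

lemma norm_imageVariation_le (hV : IsAdmissibleWith Ω V C) (hΩ : MeasurableSet Ω)
    (hg : MemLp g 2 (volume.restrict Ω)) (v w : VelocityL2 V) (τ : ℝ) :
    ‖imageVariation Ω g v w τ‖
      ≤ flowBound C v * (C * ‖w‖) * ‖hV.flowPullback hΩ v τ 0 (hg.toLp g)‖ := by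
  rw [flowPullback_toLp]
  exact norm_toL2_inner_le (hV.memLp_comp_flowMap hΩ hg v τ 0)
    (hV.aestronglyMeasurable_flowVariation v w τ 0 _) (hV.norm_flowVariation_le v w τ 0)

lemma norm_imageImpulse_le (hV : IsAdmissibleWith Ω V C) (hΩ : MeasurableSet Ω)
    (hg : MemLp g 2 (volume.restrict Ω)) (v : VelocityL2 V) (τ q : ℝ) (u : V) :
    ‖imageImpulse Ω g v τ q u‖
      ≤ flowBound C v * (C * ‖u‖) * ‖hV.flowPullback hΩ v τ 0 (hg.toLp g)‖ := by
  rw [flowPullback_toLp]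
  exact norm_toL2_inner_le (hV.memLp_comp_flowMap hΩ hg v τ 0)
    (hV.continuous_impulseResponse_right v τ 0 q u).aestronglyMeasurable
    fun y => hV.norm_impulseResponse_le v τ 0 q y u

lemma imageVariation_add (hV : IsAdmissibleWith Ω V C) (hΩ : MeasurableSet Ω)
    (hg : MemLp g 2 (volume.restrict Ω)) (v w w' : VelocityL2 V) (τ : ℝ) :
    imageVariation Ω g v (w + w') τ = imageVariation Ω g v w τ + imageVariation Ω g v w' τ := by
  rw [imageVariation, imageVariation, imageVariation,
    toL2_of_memLp (hV.memLp_inner_flowVariation hΩ hg v (w + w') τ),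
    toL2_of_memLp (hV.memLp_inner_flowVariation hΩ hg v w τ),
    toL2_of_memLp (hV.memLp_inner_flowVariation hΩ hg v w' τ), ← MemLp.toLp_add]
  congr 1
  funext y
  simp only [Pi.add_apply, hV.flowVariation_add, inner_add_right]

lemma imageVariation_smul (hV : IsAdmissibleWith Ω V C) (hΩ : MeasurableSet Ω)
    (hg : MemLp g 2 (volume.restrict Ω)) (v w : VelocityL2 V) (τ c : ℝ) :
    imageVariation Ω g v (c • w) τ = c • imageVariation Ω g v w τ := by
  rw [imageVariation, imageVariation,
    toL2_of_memLp (hV.memLp_inner_flowVariation hΩ hg v (c • w) τ),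
    toL2_of_memLp (hV.memLp_inner_flowVariation hΩ hg v w τ), ← MemLp.toLp_const_smul]
  congr 1
  funext y
  simp only [Pi.smul_apply, flowVariation_smul, inner_smul_right, smul_eq_mul]

lemma norm_imageVariation_sub_le (hV : IsAdmissibleWith Ω V C) (hΩ : MeasurableSet Ω)
    (hg : MemLp g 2 (volume.restrict Ω)) (v v' w : VelocityL2 V) (τ : ℝ) :
    ‖imageVariation Ω g v' w τ - imageVariation Ω g v w τ‖ ≤
      (flowBound C v' * C
          * ‖hV.flowPullback hΩ v' τ 0 (hg.toLp g) - hV.flowPullback hΩ v τ 0 (hg.toLp g)‖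
        + impulseResponseDist C v v' * ‖hV.flowPullback hΩ v τ 0 (hg.toLp g)‖) * ‖w‖ := by
  have hp := hV.memLp_comp_flowMap hΩ hg v τ 0
  have hp' := (hV.memLp_comp_flowMap hΩ hg v' τ 0).sub hp
  have hm := hV.aestronglyMeasurable_flowVariation v w τ 0 (volume.restrict Ω)
  have hm' := hV.aestronglyMeasurable_flowVariation v' w τ 0 (volume.restrict Ω)
  set z := fun y => flowVariation v' w τ 0 y - flowVariation v w τ 0 y with hz
  have hzm : AEStronglyMeasurable z (volume.restrict Ω) := hm'.sub hm
  have hzle : ∀ y, ‖z y‖ ≤ impulseResponseDist C v v' * ‖w‖ :=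
    hV.norm_flowVariation_sub_le v v' w τ 0
  have hsplit : imageVariation Ω g v' w τ - imageVariation Ω g v w τ =
      toL2 Ω (fun y => inner ℝ ((g ∘ flowMap v' τ 0 - g ∘ flowMap v τ 0) y)
        (flowVariation v' w τ 0 y))
      + toL2 Ω (fun y => inner ℝ ((g ∘ flowMap v τ 0) y) (z y)) := by
    rw [imageVariation, imageVariation,
      toL2_of_memLp (hV.memLp_inner_flowVariation hΩ hg v' w τ),
      toL2_of_memLp (hV.memLp_inner_flowVariation hΩ hg v w τ),
      toL2_of_memLp (memLp_inner_of_norm_le hp' hm' (hV.norm_flowVariation_le v' w τ 0)),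
      toL2_of_memLp (memLp_inner_of_norm_le hp hzm hzle), ← MemLp.toLp_sub, ← MemLp.toLp_add]
    congr 1
    funext y
    simp only [hz, Pi.sub_apply, Pi.add_apply, Function.comp_apply, inner_sub_left,
      inner_sub_right]
    ring
  rw [hsplit, flowPullback_toLp, flowPullback_toLp, ← MemLp.toLp_sub]
  refine (norm_add_le _ _).trans ((add_le_add
    (norm_toL2_inner_le hp' hm' (hV.norm_flowVariation_le v' w τ 0))
    (norm_toL2_inner_le hp hzm hzle)).trans_eq ?_)
  ring

end IsAdmissibleWith

end ImageVariation

section Bounds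

variable {E : Type*} [SeminormedAddCommGroup E] [NormedSpace ℝ E] {n : ℕ} {Ω : Set (Space n)}

lemma norm_add_smul_le (v w : E) {e : ℝ} (he : e ∈ Icc (0 : ℝ) 1) :
    ‖v + e • w‖ ≤ ‖v‖ + ‖w‖ := by
  refine (norm_add_le _ _).trans (add_le_add_right ?_ _)
  rw [norm_smul, Real.norm_of_nonneg he.1]
  exact mul_le_of_le_one_left (norm_nonneg w) he.2

lemma integral_norm_mul_le {u : Space n → ℝ} (hu : MemLp u 2 (volume.restrict Ω))
    (h : ImageL2 Ω) : ∫ y in Ω, ‖h y * u y‖ ≤ ‖h‖ * ‖toL2 Ω u‖ := by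
  have hcs := real_inner_le_norm ((Lp.memLp h).norm.toLp _) (hu.norm.toLp _)
  rw [Lp.norm_toLp, Lp.norm_toLp, eLpNorm_norm, eLpNorm_norm, L2.inner_def] at hcs
  rw [toL2_of_memLp hu, Lp.norm_toLp, Lp.norm_def]
  refine le_trans (integral_congr_ae ?_).le hcs
  filter_upwards [(Lp.memLp h).norm.coeFn_toLp, hu.norm.coeFn_toLp] with y hy hy'
  rw [hy, hy', norm_mul, RCLike.inner_apply, conj_trivial, mul_comm]

lemma flowBound_le_of_norm_le {V : Type*} [NormedAddCommGroup V] {C : ℝ} (hC : 0 ≤ C)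
    {v : VelocityL2 V} {ρ : ℝ} (h : ‖v‖ ≤ ρ) : flowBound C v ≤ 2 * Real.exp (2 * (C * ρ)) := by
  unfold flowBound
  gcongr

end Bounds

section Template

variable {n : ℕ} {Ω : Set (Space n)} {V : Type*} [NormedAddCommGroup V] [InnerProductSpace ℝ V]
  [RKHS ℝ V (Space n) (Space n)] {C : ℝ} {f₀ : Space n → ℝ} {g : Space n → Space n}
  {F : ImageL2 Ω}

/-- A differentiable image `f₀` with square integrable gradient, together with its class `F` in
`L²(Ω, ℝ)` and a strongly measurable representative `g` of its gradient. -/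
structure IsDifferentiableTemplate (Ω : Set (Space n)) (f₀ : Space n → ℝ) (g : Space n → Space n)
    (F : ImageL2 Ω) : Prop where
  differentiableOn : DifferentiableOn ℝ f₀ Ω
  stronglyMeasurable : StronglyMeasurable g
  memLp : MemLp g 2 (volume.restrict Ω)
  ae_eq_gradient : g =ᵐ[volume.restrict Ω] gradient f₀
  ae_eq : F =ᵐ[volume.restrict Ω] f₀

namespace IsAdmissibleWith

lemma continuous_flowMap_line (hV : IsAdmissibleWith Ω V C) (v w : VelocityL2 V) (s t : ℝ) :
    Continuous fun p : ℝ × Space n => flowMap (v + p.1 • w) s t p.2 :=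
  hV.continuous_flowMap_comp (by fun_prop) continuous_const continuous_const continuous_snd

lemma stronglyMeasurable_inner_flowVariation_line (hV : IsAdmissibleWith Ω V C)
    (hg : StronglyMeasurable g) (v w : VelocityL2 V) (τ : ℝ) :
    StronglyMeasurable fun p : ℝ × Space n =>
      inner ℝ (g (flowMap (v + p.1 • w) τ 0 p.2)) (flowVariation (v + p.1 • w) w τ 0 p.2) :=
  (hg.comp_measurable (hV.continuous_flowMap_line v w τ 0).measurable).inner
    (hV.stronglyMeasurable_flowVariation_uncurry (α := ℝ) (v := fun e => v + e • w) w τ 0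
      (by fun_prop))

lemma ae_ae_eq_comp_flowMap_line (hV : IsAdmissibleWith Ω V C) (hΩ : MeasurableSet Ω)
    {g' : Space n → Space n} (h : g =ᵐ[volume.restrict Ω] g') (v w : VelocityL2 V) (s t : ℝ) :
    ∀ᵐ y ∂(volume.restrict Ω), ∀ᵐ e : ℝ,
      g (flowMap (v + e • w) s t y) = g' (flowMap (v + e • w) s t y) := by
  obtain ⟨S, hS, hSm, hS0⟩ := exists_measurable_superset_of_null h
  have hmeas : Measurable fun p : Space n × ℝ => flowMap (v + p.2 • w) s t p.1 :=
    (hV.continuous_flowMap_comp (by fun_prop) continuous_const continuous_const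
      continuous_fst).measurable
  have hae : ∀ᵐ e : ℝ, ∀ᵐ y ∂(volume.restrict Ω), flowMap (v + e • w) s t y ∈ Sᶜ :=
    Eventually.of_forall fun e =>
      (hV.quasiMeasurePreserving_flowMap hΩ (v + e • w) s t).ae (compl_mem_ae_iff.2 hS0)
  have hcomm := (Measure.ae_ae_comm (μ := volume.restrict Ω) (ν := (volume : Measure ℝ))
    (p := fun y e => flowMap (v + e • w) s t y ∈ Sᶜ) (hmeas hSm.compl)).2 hae
  filter_upwards [hcomm] with y hy
  filter_upwards [hy] with e he
  by_contra hne
  exact he (hS hne)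

lemma exists_norm_imageVariation_le (hV : IsAdmissibleWith Ω V C) (hΩ : MeasurableSet Ω)
    (hg : MemLp g 2 (volume.restrict Ω)) (ρ : ℝ) :
    ∃ K : ℝ, 0 < K ∧ ∀ v w : VelocityL2 V, ‖v‖ ≤ ρ →
      ∀ τ, ‖imageVariation Ω g v w τ‖ ≤ K * ‖w‖ := by
  set B := 2 * Real.exp (2 * (C * ρ))
  obtain ⟨K, hK0, hK⟩ := hV.exists_norm_flowPullback_le hΩ (E := Space n) B
  have hC := hV.nonneg
  refine ⟨B * C * K * ‖hg.toLp g‖ + 1, by positivity, fun v w hv τ => ?_⟩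
  have hB := flowBound_le_of_norm_le hC hv
  have hpull := hK v hB τ 0 (hg.toLp g)
  calc ‖imageVariation Ω g v w τ‖
      ≤ flowBound C v * (C * ‖w‖) * ‖hV.flowPullback hΩ v τ 0 (hg.toLp g)‖ :=
        hV.norm_imageVariation_le hΩ hg v w τ
    _ ≤ B * (C * ‖w‖) * (K * ‖hg.toLp g‖) := by gcongr
    _ ≤ (B * C * K * ‖hg.toLp g‖ + 1) * ‖w‖ := by linarith [norm_nonneg w]

lemma integrable_mul_inner_flowVariation_line (hV : IsAdmissibleWith Ω V C)
    (hΩ : MeasurableSet Ω) (hgm : StronglyMeasurable g) (hg : MemLp g 2 (volume.restrict Ω))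
    (v w : VelocityL2 V) (τ : ℝ) (h : ImageL2 Ω) :
    Integrable (fun p : ℝ × Space n => h p.2 * inner ℝ (g (flowMap (v + p.1 • w) τ 0 p.2))
        (flowVariation (v + p.1 • w) w τ 0 p.2))
      ((volume.restrict (Ioc (0 : ℝ) 1)).prod (volume.restrict Ω)) := by
  have hm := ((Lp.stronglyMeasurable h).comp_measurable measurable_snd).mul
    (hV.stronglyMeasurable_inner_flowVariation_line hgm v w τ)
  obtain ⟨K, -, hK⟩ := hV.exists_norm_imageVariation_le hΩ hg (‖v‖ + ‖w‖)
  refine (integrable_prod_iff hm.aestronglyMeasurable).2 ⟨Eventually.of_forall fun e =>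
    (Lp.memLp h).integrable_mul (hV.memLp_inner_flowVariation hΩ hg (v + e • w) w τ), ?_⟩
  refine Integrable.mono' (g := fun _ => ‖h‖ * (K * ‖w‖)) (integrable_const _)
    hm.norm.integral_prod_right.aestronglyMeasurable ?_
  filter_upwards [ae_restrict_mem measurableSet_Ioc] with e he
  rw [Real.norm_of_nonneg (integral_nonneg fun _ => norm_nonneg _)]
  refine (integral_norm_mul_le (hV.memLp_inner_flowVariation hΩ hg (v + e • w) w τ) h).trans ?_
  exact mul_le_mul_of_nonneg_left (hK _ w (norm_add_smul_le v w ⟨he.1.le, he.2⟩) τ)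
    (norm_nonneg _)

lemma hasDerivAt_comp_flowMap_line (hV : IsAdmissibleWith Ω V C) (hΩ : IsOpen Ω)
    (hf₀ : DifferentiableOn ℝ f₀ Ω) (v w : VelocityL2 V) (s t : ℝ) {y : Space n} (hy : y ∈ Ω)
    (e : ℝ) :
    HasDerivAt (fun e : ℝ => f₀ (flowMap (v + e • w) s t y))
      (inner ℝ (gradient f₀ (flowMap (v + e • w) s t y)) (flowVariation (v + e • w) w s t y))
      e := by
  have hmem : flowMap (v + e • w) s t y ∈ Ω := (hV.flowMap_mem_iff _ _ _).2 hy
  have hf₀' := ((hf₀ _ hmem).differentiableAt (hΩ.mem_nhds hmem)).hasGradientAt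
  exact hf₀'.hasFDerivAt.comp_hasDerivAt e (hV.hasDerivAt_flowMap v w s t y e)

lemma integral_inner_flowVariation_line (hV : IsAdmissibleWith Ω V C) (hΩ : IsOpen Ω)
    (hf₀ : DifferentiableOn ℝ f₀ Ω) (v w : VelocityL2 V) (τ : ℝ) {y : Space n} (hy : y ∈ Ω)
    (hgf : ∀ᵐ e : ℝ,
      g (flowMap (v + e • w) τ 0 y) = gradient f₀ (flowMap (v + e • w) τ 0 y))
    (hint : IntervalIntegrable (fun e : ℝ => inner ℝ (g (flowMap (v + e • w) τ 0 y))
      (flowVariation (v + e • w) w τ 0 y)) volume 0 1) :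
    ∫ e in (0 : ℝ)..1,
        inner ℝ (g (flowMap (v + e • w) τ 0 y)) (flowVariation (v + e • w) w τ 0 y)
      = f₀ (flowMap (v + w) τ 0 y) - f₀ (flowMap v τ 0 y) := by
  have hae : (fun e : ℝ => inner ℝ (g (flowMap (v + e • w) τ 0 y))
      (flowVariation (v + e • w) w τ 0 y)) =ᵐ[volume] fun e : ℝ =>
        inner ℝ (gradient f₀ (flowMap (v + e • w) τ 0 y))
          (flowVariation (v + e • w) w τ 0 y) := by
    filter_upwards [hgf] with e he
    rw [he]
  rw [intervalIntegral.integral_congr_ae (hae.mono fun e he _ => he),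
    intervalIntegral.integral_eq_sub_of_hasDerivAt
      (fun e _ => hV.hasDerivAt_comp_flowMap_line hΩ hf₀ v w τ 0 hy e)
      (hint.congr_ae (ae_restrict_of_ae hae)), one_smul, zero_smul, add_zero]

lemma integral_inner_imageVariation_line (hV : IsAdmissibleWith Ω V C) (hΩ : MeasurableSet Ω)
    (hgm : StronglyMeasurable g) (hg : MemLp g 2 (volume.restrict Ω)) (v w : VelocityL2 V)
    (τ : ℝ) (h : ImageL2 Ω) :
    ∫ e in (0 : ℝ)..1, inner ℝ h (imageVariation Ω g (v + e • w) w τ)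
      = ∫ y in Ω, h y * ∫ e in (0 : ℝ)..1,
          inner ℝ (g (flowMap (v + e • w) τ 0 y)) (flowVariation (v + e • w) w τ 0 y) := by
  have hint := hV.integrable_mul_inner_flowVariation_line hΩ hgm hg v w τ h
  simp only [imageVariation, intervalIntegral.integral_of_le zero_le_one,
    ← integral_const_mul, inner_toL2 (hV.memLp_inner_flowVariation hΩ hg _ w τ) h]
  exact integral_integral_swap hint

/-- The fundamental theorem of calculus along the segment from `v` to `v + w`, tested against `h`
in order to avoid the measurability of `e ↦ imageVariation Ω g (v + e • w) w τ`. -/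
lemma inner_flowPullback_add_sub (hV : IsAdmissibleWith Ω V C) (hΩ : IsOpen Ω)
    (hF : IsDifferentiableTemplate Ω f₀ g F) (v w : VelocityL2 V) (τ : ℝ) (h : ImageL2 Ω) :
    inner ℝ h (hV.flowPullback hΩ.measurableSet (v + w) τ 0 F
        - hV.flowPullback hΩ.measurableSet v τ 0 F)
      = ∫ e in (0 : ℝ)..1, inner ℝ h (imageVariation Ω g (v + e • w) w τ) := by
  have hΩm := hΩ.measurableSet
  have hint :=
    hV.integrable_mul_inner_flowVariation_line hΩm hF.stronglyMeasurable hF.memLp v w τ h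
  rw [hV.integral_inner_imageVariation_line hΩm hF.stronglyMeasurable hF.memLp, L2.inner_def]
  refine integral_congr_ae ?_
  filter_upwards [Lp.coeFn_sub (hV.flowPullback hΩm (v + w) τ 0 F) (hV.flowPullback hΩm v τ 0 F),
    hV.coeFn_flowPullback hΩm (v + w) τ 0 F, hV.coeFn_flowPullback hΩm v τ 0 F,
    (hV.quasiMeasurePreserving_flowMap hΩm (v + w) τ 0).ae_eq_comp hF.ae_eq,
    (hV.quasiMeasurePreserving_flowMap hΩm v τ 0).ae_eq_comp hF.ae_eq,
    hV.ae_ae_eq_comp_flowMap_line hΩm hF.ae_eq_gradient v w τ 0, hint.prod_left_ae,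
    ae_restrict_mem hΩm] with y hsub hpull' hpull hf' hf hgrad hy_int hy
  rw [hsub, Pi.sub_apply, hpull', hpull, hf', hf, RCLike.inner_apply, conj_trivial, mul_comm]
  rcases eq_or_ne (h y) 0 with h0 | h0
  · rw [h0, zero_mul, zero_mul]
  have hy_line := (intervalIntegrable_iff_integrableOn_Ioc_of_le zero_le_one).2
    ((integrable_const_mul_iff (IsUnit.mk0 _ h0) _).1 hy_int)
  rw [hV.integral_inner_flowVariation_line hΩ hF.differentiableOn v w τ hy hgrad hy_line,
    Function.comp_apply, Function.comp_apply]

end IsAdmissibleWith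

end Template

section TemplateDerivative

variable {n : ℕ} {Ω : Set (Space n)} {V : Type*} [NormedAddCommGroup V] [InnerProductSpace ℝ V]
  [RKHS ℝ V (Space n) (Space n)] {C : ℝ} {f₀ : Space n → ℝ} {g : Space n → Space n}
  {F : ImageL2 Ω}

lemma norm_le_of_inner_self_eq_integral {H : Type*} [NormedAddCommGroup H]
    [InnerProductSpace ℝ H] {R : H} {X : ℝ → H} {B : ℝ} (hB : ∀ e ∈ Icc (0 : ℝ) 1, ‖X e‖ ≤ B)
    (h : inner ℝ R R = ∫ e in (0 : ℝ)..1, inner ℝ R (X e)) : ‖R‖ ≤ B := by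
  have hint : ‖∫ e in (0 : ℝ)..1, inner ℝ R (X e)‖ ≤ ‖R‖ * B * |(1 : ℝ) - 0| := by
    refine intervalIntegral.norm_integral_le_of_norm_le_const fun e he => ?_
    rw [uIoc_of_le zero_le_one] at he
    exact (norm_inner_le_norm _ _).trans
      (mul_le_mul_of_nonneg_left (hB e ⟨he.1.le, he.2⟩) (norm_nonneg _))
  rw [← h, real_inner_self_eq_norm_sq, sub_zero, abs_one, mul_one, norm_pow, norm_norm, sq] at hint
  rcases (norm_nonneg R).eq_or_lt with h0 | h0
  · rw [← h0]
    exact (norm_nonneg _).trans (hB 0 (left_mem_Icc.2 zero_le_one))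
  · exact le_of_mul_le_mul_left hint h0

namespace IsAdmissibleWith

/-- The derivative of `v ↦ φ_{0,τ}^v . F`, where `g` is the gradient of the image `F`. -/
def imageDeriv (hV : IsAdmissibleWith Ω V C) (hΩ : MeasurableSet Ω)
    (hg : MemLp g 2 (volume.restrict Ω)) (v : VelocityL2 V) (τ : ℝ) :
    VelocityL2 V →L[ℝ] ImageL2 Ω :=
  LinearMap.mkContinuousOfExistsBound
    { toFun := fun w => imageVariation Ω g v w τ
      map_add' := fun w w' => hV.imageVariation_add hΩ hg v w w' τ
      map_smul' := fun c w => hV.imageVariation_smul hΩ hg v w τ c }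
    (by
      obtain ⟨K, _, hK⟩ := hV.exists_norm_imageVariation_le hΩ hg ‖v‖
      exact ⟨K, fun w => hK v w le_rfl τ⟩)

lemma imageDeriv_apply (hV : IsAdmissibleWith Ω V C) (hΩ : MeasurableSet Ω)
    (hg : MemLp g 2 (volume.restrict Ω)) (v w : VelocityL2 V) (τ : ℝ) :
    hV.imageDeriv hΩ hg v τ w = imageVariation Ω g v w τ := rfl

lemma intervalIntegrable_inner_imageVariation (hV : IsAdmissibleWith Ω V C)
    (hΩ : MeasurableSet Ω) (hgm : StronglyMeasurable g) (hg : MemLp g 2 (volume.restrict Ω))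
    (v w : VelocityL2 V) (τ : ℝ) (h : ImageL2 Ω) : IntervalIntegrable
      (fun e : ℝ => inner ℝ h (imageVariation Ω g (v + e • w) w τ)) volume 0 1 := by
  rw [intervalIntegrable_iff_integrableOn_Ioc_of_le zero_le_one]
  refine (hV.integrable_mul_inner_flowVariation_line hΩ hgm hg v w τ h).integral_prod_left.congr
    (Eventually.of_forall fun e => ?_)
  exact (inner_toL2 (hV.memLp_inner_flowVariation hΩ hg (v + e • w) w τ) h).symm

lemma exists_norm_flowPullback_add_sub_le (hV : IsAdmissibleWith Ω V C) (hΩ : IsOpen Ω)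
    (hF : IsDifferentiableTemplate Ω f₀ g F) (v : VelocityL2 V) :
    ∃ K : ℝ, 0 < K ∧ ∀ w : VelocityL2 V, ‖w‖ ≤ 1 → ∀ τ,
      ‖hV.flowPullback hΩ.measurableSet (v + w) τ 0 F - hV.flowPullback hΩ.measurableSet v τ 0 F‖
        ≤ K * ‖w‖ := by
  obtain ⟨K, hK0, hK⟩ := hV.exists_norm_imageVariation_le hΩ.measurableSet hF.memLp (‖v‖ + 1)
  exact ⟨K, hK0, fun w hw τ => norm_le_of_inner_self_eq_integral
    (fun e he => hK (v + e • w) w ((norm_add_smul_le v w he).trans (add_le_add_right hw _)) τ)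
    (hV.inner_flowPullback_add_sub hΩ hF v w τ _)⟩

lemma tendsto_imageVariation_modulus (hV : IsAdmissibleWith Ω V C) (hΩ : MeasurableSet Ω)
    (G : Lp (Space n) 2 (volume.restrict Ω)) (v : VelocityL2 V) (τ : ℝ) :
    Tendsto (fun v' => flowBound C v' * C
        * ‖hV.flowPullback hΩ v' τ 0 G - hV.flowPullback hΩ v τ 0 G‖
      + impulseResponseDist C v v' * ‖hV.flowPullback hΩ v τ 0 G‖) (𝓝 v) (𝓝 0) := by
  have hcont : Continuous fun v' : VelocityL2 V => hV.flowPullback hΩ v' τ 0 G :=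
    (hV.continuous_flowPullback hΩ G).comp (f := fun v' : VelocityL2 V => (v', τ, (0 : ℝ)))
      (by fun_prop)
  have hpull := (tendsto_sub_nhds_zero_iff.2 (hcont.tendsto v)).norm
  have hbound := ((continuous_flowBound C (V := V)).tendsto v).mul_const C
  simpa only [norm_zero, mul_zero, zero_mul, add_zero] using
    (hbound.mul hpull).add
      ((hV.tendsto_impulseResponseDist v).mul_const ‖hV.flowPullback hΩ v τ 0 G‖)

lemma hasFDerivAt_flowPullback (hV : IsAdmissibleWith Ω V C) (hΩ : IsOpen Ω)
    (hF : IsDifferentiableTemplate Ω f₀ g F) (v : VelocityL2 V) (τ : ℝ) :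
    HasFDerivAt (fun v => hV.flowPullback hΩ.measurableSet v τ 0 F)
      (hV.imageDeriv hΩ.measurableSet hF.memLp v τ) v := by
  have hΩm := hΩ.measurableSet
  rw [hasFDerivAt_iff_isLittleO_nhds_zero, Asymptotics.isLittleO_iff]
  intro c hc
  obtain ⟨δ, hδ, hball⟩ := Metric.eventually_nhds_iff.1
    ((hV.tendsto_imageVariation_modulus hΩm (hF.memLp.toLp g) v τ).eventually (gt_mem_nhds hc))
  filter_upwards [Metric.ball_mem_nhds (0 : VelocityL2 V) hδ] with w hw
  rw [mem_ball_zero_iff] at hw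
  rw [imageDeriv_apply]
  refine norm_le_of_inner_self_eq_integral
    (X := fun e => imageVariation Ω g (v + e • w) w τ - imageVariation Ω g v w τ)
    (fun e he => ?_) ?_
  · refine (hV.norm_imageVariation_sub_le hΩm hF.memLp v (v + e • w) w τ).trans
      (mul_le_mul_of_nonneg_right (hball ?_).le (norm_nonneg _))
    rw [dist_eq_norm, add_sub_cancel_left, norm_smul, Real.norm_of_nonneg he.1]
    exact (mul_le_of_le_one_left (norm_nonneg _) he.2).trans_lt hw
  · simp_rw [inner_sub_right _ _ (imageVariation Ω g v w τ)]
    rw [intervalIntegral.integral_sub (hV.intervalIntegrable_inner_imageVariation hΩm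
        hF.stronglyMeasurable hF.memLp v w τ _) intervalIntegrable_const,
      hV.inner_flowPullback_add_sub hΩ hF v w τ, intervalIntegral.integral_const, sub_zero,
      one_smul]

end IsAdmissibleWith

end TemplateDerivative

section WeakMeasurability

lemma aestronglyMeasurable_of_inner {α H : Type*} {m : MeasurableSpace α} {μ : Measure α}
    [NormedAddCommGroup H] [InnerProductSpace ℝ H] [SecondCountableTopology H] {G : α → H}
    (h : ∀ u, AEStronglyMeasurable (fun a => inner ℝ (G a) u) μ) : AEStronglyMeasurable G μ := by
  let d := TopologicalSpace.denseSeq H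
  let U : ℕ → Submodule ℝ H := fun k => Submodule.span ℝ (d '' Iic k)
  have : ∀ k, FiniteDimensional ℝ (U k) := fun k =>
    FiniteDimensional.span_of_finite ℝ ((finite_Iic k).image d)
  have hU : Monotone U := fun i j hij => Submodule.span_mono (image_mono (Iic_subset_Iic.2 hij))
  have hd : ⊤ ≤ (⨆ k, U k).topologicalClosure := by
    intro x _
    refine closure_mono ?_ (TopologicalSpace.denseRange_denseSeq H x)
    rintro _ ⟨k, rfl⟩
    exact (le_iSup U k) (Submodule.subset_span ⟨k, mem_Iic.2 le_rfl, rfl⟩)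
  refine aestronglyMeasurable_of_tendsto_ae atTop (f := fun k a => (U k).starProjection (G a))
    (fun k => ?_) (Eventually.of_forall fun a => Submodule.starProjection_tendsto_self U hU _ hd)
  have hproj : (fun a => (U k).starProjection (G a)) = fun a =>
      ∑ i, inner ℝ (G a) (stdOrthonormalBasis ℝ (U k) i : H) •
        (stdOrthonormalBasis ℝ (U k) i : H) := by
    ext1 a
    rw [(stdOrthonormalBasis ℝ (U k)).starProjection_eq_sum_rankOne]
    simp [real_inner_comm]
  rw [hproj]
  fun_prop (disch := exact h _)

instance {n : ℕ} (Ω : Set (Space n)) : SecondCountableTopology (ImageL2 Ω) := by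
  have : Fact ((2 : ENNReal) ≠ ⊤) := ⟨ENNReal.ofNat_ne_top⟩
  infer_instance

namespace IsAdmissibleWith

variable {E : Type*} [NormedAddCommGroup E] [InnerProductSpace ℝ E] [CompleteSpace E] {Ω : Set E}
  {V : Type*} [NormedAddCommGroup V] [InnerProductSpace ℝ V] [CompleteSpace V] [RKHS ℝ V E E]
  {C : ℝ}

lemma norm_kerFun_le (hV : IsAdmissibleWith Ω V C) (x : E) : ‖RKHS.kerFun (𝕜 := ℝ) V x‖ ≤ C := by
  rw [← ContinuousLinearMap.adjoint.norm_map]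
  refine ContinuousLinearMap.opNorm_le_bound _ hV.nonneg fun u => ?_
  rw [RKHS.adjoint_kerFun]
  exact hV.norm_le u x

lemma continuous_kerFun (hV : IsAdmissibleWith Ω V C) :
    Continuous (RKHS.kerFun (𝕜 := ℝ) V : E → E →L[ℝ] V) := by
  refine (LipschitzWith.of_dist_le' (K := C) fun x y => ?_).continuous
  rw [dist_eq_norm, dist_eq_norm, ← ContinuousLinearMap.adjoint.norm_map, map_sub]
  refine ContinuousLinearMap.opNorm_le_bound _ (mul_nonneg hV.nonneg (norm_nonneg _))
    fun u => ?_
  rw [sub_apply, RKHS.adjoint_kerFun, RKHS.adjoint_kerFun]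
  exact (hV.norm_sub_le u x y).trans_eq (mul_right_comm _ _ _)

lemma secondCountableTopology [SecondCountableTopology E] (hV : IsAdmissibleWith Ω V C) :
    SecondCountableTopology V := by
  have hker : Continuous fun p : E × E => RKHS.kerFun (𝕜 := ℝ) V p.1 p.2 :=
    (hV.continuous_kerFun.comp continuous_fst).clm_apply continuous_snd
  have hrange : {u | ∃ (x : E) (a : E), RKHS.kerFun (𝕜 := ℝ) V x a = u}
      = range fun p : E × E => RKHS.kerFun (𝕜 := ℝ) V p.1 p.2 := by
    ext u
    simp only [mem_ofPred_eq, mem_range, Prod.exists]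
  have hsep := ((TopologicalSpace.isSeparable_range hker).span (R := ℝ)).closure
  rw [← hrange, ← Submodule.topologicalClosure_coe, RKHS.kerFun_dense, Submodule.top_coe] at hsep
  have : TopologicalSpace.SeparableSpace V := TopologicalSpace.isSeparable_univ_iff.1 hsep
  exact UniformSpace.secondCountable_of_separable V

end IsAdmissibleWith

end WeakMeasurability

section ParametricIntegral

variable {α H : Type*} {m : MeasurableSpace α} {μ : Measure α} [NormedAddCommGroup H]
  [InnerProductSpace ℝ H] [CompleteSpace H] [SecondCountableTopology H] {G : α → H}

lemma aestronglyMeasurable_of_hasGradientAt {φ : α → H → ℝ} {x₀ : α → H}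
    (hφ : ∀ h, AEStronglyMeasurable (fun a => φ a (x₀ a + h)) μ)
    (hd : ∀ᵐ a ∂μ, HasGradientAt (φ a) (G a) (x₀ a)) : AEStronglyMeasurable G μ := by
  refine aestronglyMeasurable_of_inner fun u => aestronglyMeasurable_of_tendsto_ae atTop
    (f := fun (k : ℕ) a => (k : ℝ) * (φ a (x₀ a + (k : ℝ)⁻¹ • u) - φ a (x₀ a)))
    (fun k => ?_) (hd.mono fun a ha => ?_)
  · have hφ₀ : AEStronglyMeasurable (fun a => φ a (x₀ a)) μ := by simpa only [add_zero] using hφ 0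
    exact ((hφ ((k : ℝ)⁻¹ • u)).sub hφ₀).const_mul (k : ℝ)
  · refine ha.hasFDerivAt.lim u (c := fun k : ℕ => (k : ℝ)) ?_
    simpa only [Real.norm_natCast] using tendsto_natCast_atTop_atTop

lemma hasGradientAt_integral {φ : H → α → ℝ} {x₀ : H} {s : Set H} {bound : α → ℝ}
    (hs : s ∈ 𝓝 x₀) (hφ : ∀ x, Integrable (φ x) μ) (hb : Integrable bound μ)
    (hlip : ∀ᵐ a ∂μ, ∀ x ∈ s, |φ x a - φ x₀ a| ≤ bound a * ‖x - x₀‖)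
    (hd : ∀ᵐ a ∂μ, HasGradientAt (fun x => φ x a) (G a) x₀) :
    Integrable G μ ∧ HasGradientAt (fun x => ∫ a, φ x a ∂μ) (∫ a, G a ∂μ) x₀ := by
  have hG : AEStronglyMeasurable G μ :=
    aestronglyMeasurable_of_hasGradientAt (fun h => (hφ (x₀ + h)).aestronglyMeasurable) hd
  obtain ⟨hint, hderiv⟩ := hasFDerivAt_integral_of_dominated_loc_of_lip' hs
    (fun x _ => (hφ x).aestronglyMeasurable) (hφ x₀)
    ((InnerProductSpace.toDual ℝ H).continuous.comp_aestronglyMeasurable hG) hlip hb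
    (hd.mono fun a ha => ha.hasFDerivAt)
  have hGint : Integrable G μ := hint.mono hG (Eventually.of_forall fun a =>
    ((InnerProductSpace.toDual ℝ H).norm_map (G a)).ge)
  refine ⟨hGint, ?_⟩
  convert hderiv.hasGradientAt using 1
  refine (InnerProductSpace.toDual ℝ H).injective (ContinuousLinearMap.ext fun h => ?_)
  rw [LinearIsometryEquiv.apply_symm_apply, InnerProductSpace.toDual_apply_apply,
    ContinuousLinearMap.integral_apply hint, real_inner_comm, ← integral_inner hGint]
  simp only [InnerProductSpace.toDual_apply_apply, real_inner_comm]

end ParametricIntegral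

section DataTerm

variable {n : ℕ} {Ω : Set (Space n)} {M : ℝ → ImageL2 Ω → ℝ}

namespace IsDifferentiableDataTerm

lemma hasGradientAt (hM : IsDifferentiableDataTerm M) {t : ℝ} (ht : t ∈ Icc (0 : ℝ) 1)
    (F : ImageL2 Ω) : HasGradientAt (M t) (gradient (M t) F) F :=
  (hM.differentiable t ht F).hasGradientAt

/-- `L t` bounds `M t`, its gradient, and its difference quotients on balls of radius `r`, at all
images in `S`. -/
structure IsUniformBound (M : ℝ → ImageL2 Ω → ℝ) (S : Set (ImageL2 Ω)) (r : ℝ) (L : ℝ → ℝ) :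
    Prop where
  abs_le : ∀ F ∈ S, ∀ t ∈ Icc (0 : ℝ) 1, |M t F| ≤ L t
  norm_gradient_le : ∀ F ∈ S, ∀ t ∈ Icc (0 : ℝ) 1, ‖gradient (M t) F‖ ≤ L t
  abs_sub_le : ∀ F ∈ S, ∀ t ∈ Icc (0 : ℝ) 1, ∀ F' ∈ Metric.ball F r,
    |M t F' - M t F| ≤ L t * ‖F' - F‖

lemma IsUniformBound.mono {S S' : Set (ImageL2 Ω)} {r r' : ℝ} {L L' : ℝ → ℝ}
    (h : IsUniformBound M S r L) (hS : S' ⊆ S) (hr : r' ≤ r) (hL : L ≤ L') :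
    IsUniformBound M S' r' L' where
  abs_le F hF t ht := (h.abs_le F (hS hF) t ht).trans (hL t)
  norm_gradient_le F hF t ht := (h.norm_gradient_le F (hS hF) t ht).trans (hL t)
  abs_sub_le F hF t ht F' hF' :=
    (h.abs_sub_le F (hS hF) t ht F' (Metric.ball_subset_ball hr hF')).trans
      (mul_le_mul_of_nonneg_right (hL t) (norm_nonneg _))

lemma IsUniformBound.union {S S' : Set (ImageL2 Ω)} {r : ℝ} {L : ℝ → ℝ}
    (h : IsUniformBound M S r L) (h' : IsUniformBound M S' r L) :
    IsUniformBound M (S ∪ S') r L where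
  abs_le F hF := hF.elim (h.abs_le F) (h'.abs_le F)
  norm_gradient_le F hF := hF.elim (h.norm_gradient_le F) (h'.norm_gradient_le F)
  abs_sub_le F hF := hF.elim (h.abs_sub_le F) (h'.abs_sub_le F)

lemma abs_sub_le (hM : IsDifferentiableDataTerm M) {t r B : ℝ} {F₀ F F' : ImageL2 Ω}
    (ht : t ∈ Icc (0 : ℝ) 1) (hB : ∀ G ∈ Metric.ball F₀ r, ‖gradient (M t) G‖ ≤ B)
    (hF : F ∈ Metric.ball F₀ r) (hF' : F' ∈ Metric.ball F₀ r) :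
    |M t F' - M t F| ≤ B * ‖F' - F‖ :=
  (convex_ball F₀ r).norm_image_sub_le_of_norm_hasFDerivWithin_le
    (fun G _ => (hM.hasGradientAt ht G).hasFDerivAt.hasFDerivWithinAt)
    (fun G hG => ((InnerProductSpace.toDual ℝ _).norm_map _).le.trans (hB G hG)) hF hF'

lemma exists_isUniformBound_ball (hM : IsDifferentiableDataTerm M) (F₀ : ImageL2 Ω) :
    ∃ r > 0, ∃ L, IntegrableOn L (Icc 0 1) ∧ IsUniformBound M (Metric.ball F₀ r) r L := by
  obtain ⟨r, hr, L, hL, hgrad⟩ := hM.dominated F₀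
  have hL0 : ∀ t ∈ Icc (0 : ℝ) 1, 0 ≤ L t := fun t ht =>
    (norm_nonneg _).trans (hgrad t ht F₀ (Metric.mem_ball_self hr))
  have hball : Metric.ball F₀ (r / 2) ⊆ Metric.ball F₀ r :=
    Metric.ball_subset_ball (half_le_self hr.le)
  refine ⟨r / 2, half_pos hr, fun t => |M t F₀| + L t * (r + 1),
    (hM.integrable F₀).abs.add (hL.mul_const _), ?_, ?_, ?_⟩ <;> intro F hF t ht
  · have hsub := hM.abs_sub_le ht (hgrad t ht) (Metric.mem_ball_self hr) (hball hF)
    have hnorm : L t * ‖F - F₀‖ ≤ L t * (r + 1) :=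
      mul_le_mul_of_nonneg_left (by linarith [mem_ball_iff_norm.1 (hball hF)]) (hL0 t ht)
    linarith [abs_sub_abs_le_abs_sub (M t F) (M t F₀)]
  · nlinarith [hgrad t ht F (hball hF), hL0 t ht, abs_nonneg (M t F₀)]
  · intro F' hF'
    have hF'₀ : F' ∈ Metric.ball F₀ r := by
      rw [Metric.mem_ball] at *
      linarith [dist_triangle F' F F₀]
    refine (hM.abs_sub_le ht (hgrad t ht) (hball hF) hF'₀).trans
      (mul_le_mul_of_nonneg_right ?_ (norm_nonneg _))
    nlinarith [hL0 t ht, abs_nonneg (M t F₀)]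

lemma exists_isUniformBound (hM : IsDifferentiableDataTerm M) {S : Set (ImageL2 Ω)}
    (hS : IsCompact S) :
    ∃ r > 0, ∃ L, IntegrableOn L (Icc 0 1) ∧ IsUniformBound M S r L := by
  refine hS.induction_on ?_ ?_ ?_ fun F₀ _ => ?_
  · exact ⟨1, one_pos, 0, integrableOn_zero, by constructor <;> simp⟩
  · rintro S₁ S₂ hS ⟨r, hr, L, hL, h⟩
    exact ⟨r, hr, L, hL, h.mono hS le_rfl le_rfl⟩
  · rintro S₁ S₂ ⟨r₁, hr₁, L₁, hL₁, h₁⟩ ⟨r₂, hr₂, L₂, hL₂, h₂⟩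
    exact ⟨min r₁ r₂, lt_min hr₁ hr₂, L₁ ⊔ L₂, hL₁.sup hL₂,
      (h₁.mono Subset.rfl (min_le_left _ _) le_sup_left).union
        (h₂.mono Subset.rfl (min_le_right _ _) le_sup_right)⟩
  · obtain ⟨r, hr, L, hL, h⟩ := hM.exists_isUniformBound_ball F₀
    exact ⟨_, mem_nhdsWithin_of_mem_nhds (Metric.ball_mem_nhds F₀ hr), r, hr, L, hL, h⟩

lemma aestronglyMeasurable_floor (hM : IsDifferentiableDataTerm M) (c : ℝ → ImageL2 Ω) (k : ℕ) :
    AEStronglyMeasurable (fun t => M t (c (⌊t * k⌋₊ / k))) (volume.restrict (Icc 0 1)) := by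
  have hfloor : Measurable fun t : ℝ => ⌊t * k⌋₊ :=
    Nat.measurable_floor.comp (measurable_mul_const _)
  have hcover : (⋃ i, (fun t : ℝ => ⌊t * k⌋₊) ⁻¹' {i}) = univ := by
    rw [← preimage_iUnion, iUnion_of_singleton, preimage_univ]
  rw [← Measure.restrict_univ (μ := volume.restrict (Icc (0 : ℝ) 1)), ← hcover,
    aestronglyMeasurable_iUnion_iff]
  intro i
  refine ((hM.integrable (c (i / k))).aestronglyMeasurable.restrict).congr ?_
  filter_upwards [ae_restrict_mem (hfloor (measurableSet_singleton i))] with t ht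
  rw [mem_preimage, mem_singleton_iff] at ht
  rw [ht]

lemma aestronglyMeasurable_comp (hM : IsDifferentiableDataTerm M) {c : ℝ → ImageL2 Ω}
    (hc : Continuous c) :
    AEStronglyMeasurable (fun t => M t (c t)) (volume.restrict (Icc 0 1)) := by
  refine aestronglyMeasurable_of_tendsto_ae atTop (hM.aestronglyMeasurable_floor c) ?_
  filter_upwards [ae_restrict_mem measurableSet_Icc] with t ht
  refine ((hM.differentiable t ht).continuous.tendsto _).comp ((hc.tendsto t).comp ?_)
  exact (tendsto_nat_floor_mul_div_atTop ht.1).comp tendsto_natCast_atTop_atTop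

lemma integrableOn_comp (hM : IsDifferentiableDataTerm M) {c : ℝ → ImageL2 Ω}
    (hc : Continuous c) : IntegrableOn (fun t => M t (c t)) (Icc 0 1) := by
  obtain ⟨r, -, L, hL, h⟩ := hM.exists_isUniformBound (isCompact_Icc.image hc)
  refine hL.mono' (hM.aestronglyMeasurable_comp hc) ?_
  filter_upwards [ae_restrict_mem measurableSet_Icc] with t ht
  exact h.abs_le _ (mem_image_of_mem _ ht) t ht

lemma integrableOn_gradient (hM : IsDifferentiableDataTerm M) {c : ℝ → ImageL2 Ω}
    (hc : Continuous c) : IntegrableOn (fun t => gradient (M t) (c t)) (Icc 0 1) := by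
  obtain ⟨r, -, L, hL, h⟩ := hM.exists_isUniformBound (isCompact_Icc.image hc)
  refine hL.mono' (aestronglyMeasurable_of_hasGradientAt (φ := M) (x₀ := c)
    (fun u => hM.aestronglyMeasurable_comp (by fun_prop)) ?_) ?_ <;>
    filter_upwards [ae_restrict_mem measurableSet_Icc] with t ht
  · exact hM.hasGradientAt ht (c t)
  · exact h.norm_gradient_le _ (mem_image_of_mem _ ht) t ht

lemma hasGradientAt_integral_comp (hM : IsDifferentiableDataTerm M) {H : Type*}
    [NormedAddCommGroup H] [InnerProductSpace ℝ H] [CompleteSpace H] [SecondCountableTopology H]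
    {c : H → ℝ → ImageL2 Ω} {c' : ℝ → H →L[ℝ] ImageL2 Ω} {x₀ : H} {ρ K : ℝ} (hρ : 0 < ρ)
    (hK : 0 < K) (hc : ∀ x, Continuous (c x))
    (hlip : ∀ x ∈ Metric.ball x₀ ρ, ∀ t, ‖c x t - c x₀ t‖ ≤ K * ‖x - x₀‖)
    (hd : ∀ t, HasFDerivAt (fun x => c x t) (c' t) x₀) :
    IntegrableOn (fun t => ContinuousLinearMap.adjoint (c' t) (gradient (M t) (c x₀ t)))
        (Icc 0 1) ∧
      HasGradientAt (fun x => ∫ t in Icc (0 : ℝ) 1, M t (c x t))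
        (∫ t in Icc (0 : ℝ) 1, ContinuousLinearMap.adjoint (c' t) (gradient (M t) (c x₀ t)))
        x₀ := by
  obtain ⟨r, hr, L, hL, h⟩ := hM.exists_isUniformBound (isCompact_Icc.image (hc x₀))
  refine hasGradientAt_integral (bound := fun t => L t * K)
    (Metric.ball_mem_nhds x₀ (lt_min hρ (div_pos hr hK))) (fun x => hM.integrableOn_comp (hc x))
    (hL.mul_const _) ?_ ?_ <;> filter_upwards [ae_restrict_mem measurableSet_Icc] with t ht
  · intro x hx
    have hmem := mem_image_of_mem (c x₀) ht
    rw [mem_ball_iff_norm, lt_min_iff, lt_div_iff₀' hK] at hx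
    have hdist := hlip x (mem_ball_iff_norm.2 hx.1) t
    rw [mul_assoc]
    exact (h.abs_sub_le _ hmem t ht _ (mem_ball_iff_norm.2 (hdist.trans_lt hx.2))).trans
      (mul_le_mul_of_nonneg_left hdist ((norm_nonneg _).trans (h.norm_gradient_le _ hmem t ht)))
  · have hcomp := (hM.hasGradientAt ht (c x₀ t)).hasFDerivAt.comp x₀ (hd t)
    refine hasGradientAt_iff_hasFDerivAt.2
      (hcomp.congr_fderiv (ContinuousLinearMap.ext fun w => ?_))
    rw [ContinuousLinearMap.comp_apply, InnerProductSpace.toDual_apply_apply,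
      InnerProductSpace.toDual_apply_apply, ContinuousLinearMap.adjoint_inner_left]

end IsDifferentiableDataTerm

end DataTerm

section Energy

variable {V : Type*} [NormedAddCommGroup V]

lemma integrableOn_norm_sq (v : VelocityL2 V) :
    IntegrableOn (fun t => ‖(v t : V)‖ ^ 2) (Icc 0 1) :=
  (Lp.memLp v).integrable_norm_pow two_ne_zero

/-- The kinetic energy `∫₀¹ ∫₀ᵗ ‖v(τ)‖² dτ dt`, with the order of integration exchanged. -/
def energy (v : VelocityL2 V) : ℝ :=
  ∫ t in Icc (0 : ℝ) 1, (1 - t) * ‖(v t : V)‖ ^ 2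

lemma integral_integral_norm_sq (v : VelocityL2 V) :
    ∫ t in (0 : ℝ)..1, ∫ τ in (0 : ℝ)..t, ‖(v τ : V)‖ ^ 2 = energy v := by
  have hint : IntegrableOn (Function.uncurry fun _ τ : ℝ => ‖(v τ : V)‖ ^ 2)
      (Ioc 0 1 ×ˢ Ioc 0 1) := by
    rw [IntegrableOn, Measure.volume_eq_prod, ← Measure.prod_restrict]
    exact ((integrableOn_norm_sq v).mono_set Ioc_subset_Icc_self).comp_snd _
  rw [integral_integral_triangle_of_le zero_le_one hint, energy, integral_Icc_eq_integral_Ioc,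
    intervalIntegral.integral_of_le zero_le_one]
  simp only [intervalIntegral.integral_const, smul_eq_mul]

end Energy

lemma hasL2GradientAt_comp_of_hasGradientAt {n : ℕ} {Ω : Set (Space n)} {X : Type*}
    [NormedAddCommGroup X] [NormedSpace ℝ X] {ι : X →L[ℝ] ImageL2 Ω} {Φ : ImageL2 Ω → ℝ}
    {G : ImageL2 Ω} {f : X} (h : HasGradientAt Φ G (ι f)) :
    HasL2GradientAt ι (fun x => Φ (ι x)) G f :=
  h.hasFDerivAt.comp f ι.hasFDerivAt

section TemplateGradient

variable {n : ℕ} {Ω : Set (Space n)} {V : Type*} [NormedAddCommGroup V] [InnerProductSpace ℝ V]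
  [RKHS ℝ V (Space n) (Space n)] {C : ℝ} {M : ℝ → ImageL2 Ω → ℝ}

namespace IsAdmissibleWith

lemma continuous_flowPullback_left (hV : IsAdmissibleWith Ω V C) (hΩ : MeasurableSet Ω)
    (v : VelocityL2 V) (t : ℝ) (F : ImageL2 Ω) :
    Continuous fun τ => hV.flowPullback hΩ v τ t F :=
  (hV.continuous_flowPullback hΩ F).comp (f := fun τ : ℝ => (v, τ, t)) (by fun_prop)

lemma pulledGradient_eq_adjoint (hV : IsAdmissibleWith Ω V C) (hΩ : MeasurableSet Ω)
    (v : VelocityL2 V) (F : ImageL2 Ω) {t τ : ℝ} (ht : t ∈ Icc (0 : ℝ) 1)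
    (hτ : τ ∈ Icc (0 : ℝ) 1) :
    pulledGradient M v F t τ =
      ContinuousLinearMap.adjoint (hV.flowPullback hΩ v τ t : ImageL2 Ω →L[ℝ] ImageL2 Ω)
        (gradient (M τ) (hV.flowPullback hΩ v τ 0 F)) := by
  rw [← hV.toL2_jacComp hΩ, ← hV.deformed_eq_flowPullback hΩ v hτ,
    ← hV.transition_eq_flowMap v ht hτ, pulledGradient]

lemma exists_norm_adjoint_flowPullback_le (hV : IsAdmissibleWith Ω V C) (hΩ : MeasurableSet Ω)
    (v : VelocityL2 V) :
    ∃ K : ℝ, 0 < K ∧ ∀ s t, ∀ F : ImageL2 Ω,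
      ‖ContinuousLinearMap.adjoint
        (hV.flowPullback hΩ v s t : ImageL2 Ω →L[ℝ] ImageL2 Ω) F‖ ≤ K * ‖F‖ := by
  obtain ⟨K, hK0, hK⟩ := hV.exists_norm_flowPullback_le hΩ (E := ℝ) (flowBound C v)
  refine ⟨K, hK0, fun s t F => ContinuousLinearMap.le_of_opNorm_le _ ?_ F⟩
  rw [ContinuousLinearMap.adjoint.norm_map]
  exact ContinuousLinearMap.opNorm_le_bound _ hK0.le (hK v le_rfl s t)

lemma integrableOn_pulledGradient (hV : IsAdmissibleWith Ω V C) (hΩ : MeasurableSet Ω)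
    (hM : IsDifferentiableDataTerm M) (v : VelocityL2 V) (F : ImageL2 Ω) {t : ℝ}
    (ht : t ∈ Icc (0 : ℝ) 1) : IntegrableOn (pulledGradient M v F t) (Icc 0 1) := by
  obtain ⟨K, -, hK⟩ := hV.exists_norm_adjoint_flowPullback_le hΩ v
  have hG := hM.integrableOn_gradient (hV.continuous_flowPullback_left hΩ v 0 F)
  refine IntegrableOn.congr_fun ?_
    (fun τ hτ => (hV.pulledGradient_eq_adjoint hΩ v F ht hτ).symm) measurableSet_Icc
  refine (hG.norm.const_mul K).mono' (aestronglyMeasurable_of_inner fun u => ?_)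
    (Eventually.of_forall fun τ => hK τ t _)
  simp_rw [ContinuousLinearMap.adjoint_inner_left]
  exact hG.aestronglyMeasurable.inner
    (hV.continuous_flowPullback_left hΩ v t u).aestronglyMeasurable

lemma isWellDefined (hV : IsAdmissibleWith Ω V C) (hΩ : MeasurableSet Ω)
    (hM : IsDifferentiableDataTerm M) : IsWellDefined Ω V M where
  flow_isFlowLine := hV.isFlowLine_flow
  flow_bijective v t ht := by
    rw [hV.flow_eq_flowMap v ht]
    exact ⟨hV.bijective_flowMap v 0 t, hV.bijOn_flowMap v 0 t⟩
  memLp_geomAct v t ht F := by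
    rw [hV.geomAct_transition v ht]
    exact hV.memLp_comp_flowMap hΩ (Lp.memLp F) v t 0
  memLp_jacComp v s hs t ht F := by
    rw [hV.transition_eq_flowMap v hs ht]
    exact hV.memLp_jacComp hΩ v s t F
  integrable_data v F :=
    (hM.integrableOn_comp (hV.continuous_flowPullback_left hΩ v 0 F)).congr_fun
      (fun t ht => by rw [hV.deformed_eq_flowPullback hΩ v ht]) measurableSet_Icc
  integrable_pulledGradient v F _ ht :=
    (hV.integrableOn_pulledGradient hΩ hM v F ht).mono_set (Icc_subset_Icc_left ht.1)

variable {X : Type*} [NormedAddCommGroup X] [NormedSpace ℝ X] (ι : X →L[ℝ] ImageL2 Ω)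

lemma objective_eq (hV : IsAdmissibleWith Ω V C) (hΩ : MeasurableSet Ω)
    (hM : IsDifferentiableDataTerm M) (R₁ : X → ℝ) (μ₁ μ₂ : ℝ) (f : X) (v : VelocityL2 V) :
    objective ι M R₁ μ₁ μ₂ f v =
      (∫ t in Icc (0 : ℝ) 1, M t (hV.flowPullback hΩ v t 0 (ι f))) + μ₂ * energy v
        + μ₁ * R₁ f := by
  have hdata : IntervalIntegrable (fun t => M t (hV.flowPullback hΩ v t 0 (ι f))) volume 0 1 :=
    (intervalIntegrable_iff_integrableOn_Icc_of_le zero_le_one).2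
      (hM.integrableOn_comp (hV.continuous_flowPullback_left hΩ v 0 (ι f)))
  have henergy : IntervalIntegrable (fun t => μ₂ * ∫ τ in (0 : ℝ)..t, ‖(v τ : V)‖ ^ 2)
      volume 0 1 := by
    refine (continuousOn_const.mul
      (intervalIntegral.continuousOn_primitive_interval ?_)).intervalIntegrable
    rw [uIcc_of_le zero_le_one]
    exact integrableOn_norm_sq v
  rw [objective, ← integral_integral_norm_sq, integral_Icc_eq_integral_Ioc,
    ← intervalIntegral.integral_of_le zero_le_one, ← intervalIntegral.integral_const_mul,
    ← intervalIntegral.integral_add hdata henergy]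
  congr 1
  refine intervalIntegral.integral_congr fun t ht => ?_
  rw [uIcc_of_le zero_le_one] at ht
  simp only [hV.deformed_eq_flowPullback hΩ v ht]

lemma hasGradientAt_integral_flowPullback (hV : IsAdmissibleWith Ω V C) (hΩ : MeasurableSet Ω)
    (hM : IsDifferentiableDataTerm M) (v : VelocityL2 V) (F : ImageL2 Ω) :
    HasGradientAt (fun G => ∫ t in Icc (0 : ℝ) 1, M t (hV.flowPullback hΩ v t 0 G))
      (∫ t in (0 : ℝ)..1, pulledGradient M v F 0 t) F := by
  obtain ⟨K, hK0, hK⟩ := hV.exists_norm_flowPullback_le hΩ (E := ℝ) (flowBound C v)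
  have hgrad := (hM.hasGradientAt_integral_comp one_pos hK0 (x₀ := F)
    (hV.continuous_flowPullback_left hΩ v 0)
    (fun G _ t => by simpa only [map_sub] using hK v le_rfl t 0 (G - F))
    (fun t => (hV.flowPullback hΩ v t 0).hasFDerivAt)).2
  rwa [intervalIntegral.integral_of_le zero_le_one, ← integral_Icc_eq_integral_Ioc,
    setIntegral_congr_fun measurableSet_Icc
      fun t ht => hV.pulledGradient_eq_adjoint hΩ v F (left_mem_Icc.2 zero_le_one) ht]

lemma hasL2GradientAt_objective (hV : IsAdmissibleWith Ω V C) (hΩ : MeasurableSet Ω)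
    (hM : IsDifferentiableDataTerm M) {R₁ : X → ℝ} (μ₁ μ₂ : ℝ) {f : X} {gradR : ImageL2 Ω}
    (hR : HasL2GradientAt ι R₁ gradR f) (v : VelocityL2 V) :
    HasL2GradientAt ι (fun h => objective ι M R₁ μ₁ μ₂ h v)
      ((∫ t in (0 : ℝ)..1, pulledGradient M v (ι f) 0 t) + μ₁ • gradR) f := by
  simp_rw [hV.objective_eq ι hΩ hM]
  have hdata := hasL2GradientAt_comp_of_hasGradientAt
    (hV.hasGradientAt_integral_flowPullback hΩ hM v (ι f))
  refine ((hdata.add_const (μ₂ * energy v)).add (HasFDerivAt.const_mul hR μ₁)).congr_fderiv ?_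
  rw [map_add, map_smul, ContinuousLinearMap.add_comp, ContinuousLinearMap.smul_comp]

end IsAdmissibleWith

end TemplateGradient

section EnergyGradient

variable {V : Type*} [NormedAddCommGroup V] [InnerProductSpace ℝ V]

lemma memLp_two_mul_one_sub_smul (v : VelocityL2 V) :
    MemLp (fun t : ℝ => (2 * (1 - t)) • (v t : V)) 2 (volume.restrict (Icc 0 1)) := by
  refine (Lp.memLp v).of_le_mul (c := 2)
    (Continuous.aestronglyMeasurable (by fun_prop) |>.smul (Lp.aestronglyMeasurable v)) ?_
  filter_upwards [ae_restrict_mem measurableSet_Icc] with t ht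
  rw [norm_smul, Real.norm_of_nonneg (by linarith [ht.2])]
  exact mul_le_mul_of_nonneg_right (by linarith [ht.1]) (norm_nonneg _)

/-- The gradient `t ↦ 2 (1 - t) v(t)` of the kinetic energy. -/
def energyGradient (v : VelocityL2 V) : VelocityL2 V :=
  (memLp_two_mul_one_sub_smul v).toLp _

lemma coeFn_energyGradient (v : VelocityL2 V) :
    energyGradient v =ᵐ[volume.restrict (Icc 0 1)] fun t => (2 * (1 - t)) • (v t : V) :=
  (memLp_two_mul_one_sub_smul v).coeFn_toLp

lemma integrableOn_one_sub_mul_norm_sq {V : Type*} [NormedAddCommGroup V] (v : VelocityL2 V) :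
    IntegrableOn (fun t => (1 - t) * ‖(v t : V)‖ ^ 2) (Icc 0 1) :=
  (integrableOn_norm_sq v).continuousOn_mul (by fun_prop) isCompact_Icc

lemma energy_add (v w : VelocityL2 V) :
    energy (v + w) = energy v + inner ℝ (energyGradient v) w + energy w := by
  have hinner := L2.integrable_inner (𝕜 := ℝ) (energyGradient v) w
  rw [energy, energy, energy, L2.inner_def,
    ← integral_add (integrableOn_one_sub_mul_norm_sq v) hinner,
    ← integral_add ?_ (integrableOn_one_sub_mul_norm_sq w)]
  · refine integral_congr_ae ?_
    filter_upwards [Lp.coeFn_add v w, coeFn_energyGradient v] with t hadd hgrad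
    rw [hadd, hgrad, Pi.add_apply, norm_add_sq_real, real_inner_smul_left]
    ring
  · exact (integrableOn_one_sub_mul_norm_sq v).add hinner

lemma abs_energy_le (w : VelocityL2 V) : |energy w| ≤ ‖w‖ ^ 2 := by
  rw [← real_inner_self_eq_norm_sq w, L2.inner_def, energy, ← Real.norm_eq_abs]
  refine norm_integral_le_of_norm_le (L2.integrable_inner (𝕜 := ℝ) w w) ?_
  filter_upwards [ae_restrict_mem measurableSet_Icc] with t ht
  rw [real_inner_self_eq_norm_sq, norm_mul, Real.norm_of_nonneg (by linarith [ht.2]),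
    Real.norm_of_nonneg (sq_nonneg _)]
  exact mul_le_of_le_one_left (sq_nonneg _) (by linarith [ht.1])

lemma hasGradientAt_energy [CompleteSpace V] (v : VelocityL2 V) :
    HasGradientAt energy (energyGradient v) v := by
  rw [hasGradientAt_iff_hasFDerivAt, hasFDerivAt_iff_isLittleO_nhds_zero]
  have hremainder : ∀ w : VelocityL2 V, energy (v + w) - energy v
      - InnerProductSpace.toDual ℝ _ (energyGradient v) w = energy w := fun w => by
    rw [energy_add, InnerProductSpace.toDual_apply_apply]
    ring
  simp_rw [hremainder]
  refine (Asymptotics.IsBigO.of_bound 1 (Eventually.of_forall fun w => ?_)).trans_isLittleO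
    (Asymptotics.isLittleO_norm_pow_id one_lt_two)
  simpa using abs_energy_le w

end EnergyGradient

section VelocityDerivative

variable {n : ℕ} {Ω : Set (Space n)} {V : Type*} [NormedAddCommGroup V] [InnerProductSpace ℝ V]
  [RKHS ℝ V (Space n) (Space n)] {C : ℝ} {g : Space n → Space n}

namespace IsAdmissibleWith

lemma imageImpulse_add (hV : IsAdmissibleWith Ω V C) (hΩ : MeasurableSet Ω)
    (hg : MemLp g 2 (volume.restrict Ω)) (v : VelocityL2 V) (τ q : ℝ) (u u' : V) :
    imageImpulse Ω g v τ q (u + u') = imageImpulse Ω g v τ q u + imageImpulse Ω g v τ q u' := by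
  simp only [imageImpulse, toL2_of_memLp (hV.memLp_inner_impulseResponse hΩ hg v τ q _),
    ← MemLp.toLp_add]
  congr 1
  funext y
  simp only [impulseResponse, RKHS.coe_add, Pi.add_apply, map_add, inner_add_right]

lemma imageImpulse_smul (hV : IsAdmissibleWith Ω V C) (hΩ : MeasurableSet Ω)
    (hg : MemLp g 2 (volume.restrict Ω)) (v : VelocityL2 V) (τ q c : ℝ) (u : V) :
    imageImpulse Ω g v τ q (c • u) = c • imageImpulse Ω g v τ q u := by
  simp only [imageImpulse, toL2_of_memLp (hV.memLp_inner_impulseResponse hΩ hg v τ q _),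
    ← MemLp.toLp_const_smul]
  congr 1
  funext y
  simp only [impulseResponse, RKHS.coe_smul, Pi.smul_apply, map_smul, inner_smul_right,
    smul_eq_mul]

/-- The impulse `u ↦ imageImpulse Ω g v τ q u` as a continuous linear map. -/
def imageImpulseCLM (hV : IsAdmissibleWith Ω V C) (hΩ : MeasurableSet Ω)
    (hg : MemLp g 2 (volume.restrict Ω)) (v : VelocityL2 V) (τ q : ℝ) : V →L[ℝ] ImageL2 Ω :=
  LinearMap.mkContinuous
    { toFun := imageImpulse Ω g v τ q
      map_add' := hV.imageImpulse_add hΩ hg v τ q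
      map_smul' := hV.imageImpulse_smul hΩ hg v τ q }
    (flowBound C v * C * ‖hV.flowPullback hΩ v τ 0 (hg.toLp g)‖)
    (fun u => (hV.norm_imageImpulse_le hΩ hg v τ q u).trans_eq (by ring))

lemma imageImpulseCLM_apply (hV : IsAdmissibleWith Ω V C) (hΩ : MeasurableSet Ω)
    (hg : MemLp g 2 (volume.restrict Ω)) (v : VelocityL2 V) (τ q : ℝ) (u : V) :
    hV.imageImpulseCLM hΩ hg v τ q u = imageImpulse Ω g v τ q u := rfl

lemma exists_norm_imageImpulseCLM_le (hV : IsAdmissibleWith Ω V C) (hΩ : MeasurableSet Ω)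
    (hg : MemLp g 2 (volume.restrict Ω)) (v : VelocityL2 V) :
    ∃ B : ℝ, 0 ≤ B ∧ ∀ τ q, ‖hV.imageImpulseCLM hΩ hg v τ q‖ ≤ B := by
  obtain ⟨K, hK0, hK⟩ := hV.exists_norm_flowPullback_le hΩ (E := Space n) (flowBound C v)
  have hbound := mul_nonneg (flowBound_pos C v).le hV.nonneg
  refine ⟨flowBound C v * C * (K * ‖hg.toLp g‖), by positivity, fun τ q => ?_⟩
  exact (LinearMap.mkContinuous_norm_le _ (by positivity) _).trans
    (mul_le_mul_of_nonneg_left (hK v le_rfl τ 0 _) hbound)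

lemma flowPullback_imageImpulse (hV : IsAdmissibleWith Ω V C) (hΩ : MeasurableSet Ω)
    (hg : MemLp g 2 (volume.restrict Ω)) (v : VelocityL2 V) (τ q : ℝ) (u : V) :
    hV.flowPullback hΩ v τ q (imageImpulse Ω g v q q u) = imageImpulse Ω g v τ q u := by
  simp only [imageImpulse, toL2_of_memLp (hV.memLp_inner_impulseResponse hΩ hg v _ q u),
    flowPullback_toLp]
  congr 1
  funext y
  simp only [Function.comp_apply, impulseResponse, hV.flowMap_trans, hV.flowMap_self]

lemma stronglyMeasurable_inner_impulseResponse (hV : IsAdmissibleWith Ω V C)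
    (hgm : StronglyMeasurable g) (v : VelocityL2 V) {u : ℝ → V} (hu : StronglyMeasurable u) :
    StronglyMeasurable fun p : (ℝ × ℝ) × Space n =>
      inner ℝ (g (flowMap v p.1.1 0 p.2)) (impulseResponse v p.1.1 0 p.1.2 p.2 (u p.1.2)) := by
  have hflow : Continuous fun p : (ℝ × ℝ) × Space n => flowMap v p.1.1 0 p.2 :=
    hV.continuous_flowMap_comp (by fun_prop) (by fun_prop) continuous_const continuous_snd
  exact (hgm.comp_measurable hflow.measurable).inner
    (hV.stronglyMeasurable_impulseResponse_uncurry (α := ℝ × ℝ) (v := fun _ => v)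
      (s := fun a => a.1) (q := fun a => a.2) (u := fun a => u a.2) 0 (by fun_prop)
      (by fun_prop) (by fun_prop) (hu.comp_measurable measurable_snd))

lemma aestronglyMeasurable_imageImpulse (hV : IsAdmissibleWith Ω V C) (hΩ : MeasurableSet Ω)
    (hgm : StronglyMeasurable g) (hg : MemLp g 2 (volume.restrict Ω)) (v : VelocityL2 V)
    {u : ℝ → V} (hu : StronglyMeasurable u) (μ : Measure (ℝ × ℝ)) :
    AEStronglyMeasurable (fun p : ℝ × ℝ => imageImpulse Ω g v p.1 p.2 (u p.2)) μ := by
  refine aestronglyMeasurable_of_inner fun h => ?_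
  have hmeas : StronglyMeasurable (Function.uncurry fun (p : ℝ × ℝ) (y : Space n) => h y *
      inner ℝ (g (flowMap v p.1 0 y)) (impulseResponse v p.1 0 p.2 y (u p.2))) :=
    ((Lp.stronglyMeasurable h).comp_measurable measurable_snd).mul
      (hV.stronglyMeasurable_inner_impulseResponse hgm v hu)
  refine (hmeas.integral_prod_right (ν := volume.restrict Ω)).aestronglyMeasurable.congr
    (Eventually.of_forall fun p => ?_)
  simp only [real_inner_comm h]
  exact (inner_toL2 (hV.memLp_inner_impulseResponse hΩ hg v p.1 p.2 (u p.2)) h).symm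

lemma integrable_inner_imageImpulse (hV : IsAdmissibleWith Ω V C) (hΩ : MeasurableSet Ω)
    (hgm : StronglyMeasurable g) (hg : MemLp g 2 (volume.restrict Ω)) (v : VelocityL2 V)
    {μ ν : Measure ℝ} [SFinite μ] [SFinite ν] {u : ℝ → V} (hu : StronglyMeasurable u)
    (hui : Integrable u ν) {G : ℝ → ImageL2 Ω} (hG : Integrable G μ) :
    Integrable (fun p : ℝ × ℝ => inner ℝ (G p.1) (imageImpulse Ω g v p.1 p.2 (u p.2)))
      (μ.prod ν) := by
  obtain ⟨B, -, hB⟩ := hV.exists_norm_imageImpulseCLM_le hΩ hg v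
  refine ((hG.norm.mul_prod hui.norm).const_mul B).mono'
    (hG.aestronglyMeasurable.comp_fst.inner
      (hV.aestronglyMeasurable_imageImpulse hΩ hgm hg v hu _))
    (Eventually.of_forall fun p => (norm_inner_le_norm _ _).trans ?_)
  refine (mul_le_mul_of_nonneg_left ?_ (norm_nonneg _)).trans_eq (mul_left_comm _ _ _)
  exact ContinuousLinearMap.le_of_opNorm_le _ (hB p.1 p.2) _

lemma integrable_mul_inner_impulseResponse (hV : IsAdmissibleWith Ω V C) (hΩ : MeasurableSet Ω)
    (hgm : StronglyMeasurable g) (hg : MemLp g 2 (volume.restrict Ω)) (v : VelocityL2 V)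
    {ν : Measure ℝ} [SFinite ν] {u : ℝ → V} (hu : StronglyMeasurable u) (hui : Integrable u ν)
    (τ : ℝ) (h : ImageL2 Ω) :
    Integrable (Function.uncurry fun (q : ℝ) (y : Space n) =>
      h y * inner ℝ (g (flowMap v τ 0 y)) (impulseResponse v τ 0 q y (u q)))
      (ν.prod (volume.restrict Ω)) := by
  obtain ⟨B, -, hB⟩ := hV.exists_norm_imageImpulseCLM_le hΩ hg v
  have hmeas : StronglyMeasurable (Function.uncurry fun (q : ℝ) (y : Space n) =>
      h y * inner ℝ (g (flowMap v τ 0 y)) (impulseResponse v τ 0 q y (u q))) :=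
    ((Lp.stronglyMeasurable h).comp_measurable measurable_snd).mul
      ((hV.stronglyMeasurable_inner_impulseResponse hgm v hu).comp_measurable
        (g := fun p : ℝ × Space n => ((τ, p.1), p.2)) (by fun_prop))
  rw [integrable_prod_iff hmeas.aestronglyMeasurable]
  refine ⟨Eventually.of_forall fun q =>
    (Lp.memLp h).integrable_mul (hV.memLp_inner_impulseResponse hΩ hg v τ q (u q)), ?_⟩
  refine (hui.norm.const_mul (‖h‖ * B)).mono'
    hmeas.norm.integral_prod_right.aestronglyMeasurable (Eventually.of_forall fun q => ?_)
  rw [Real.norm_of_nonneg (integral_nonneg fun _ => norm_nonneg _), mul_assoc]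
  exact (integral_norm_mul_le (hV.memLp_inner_impulseResponse hΩ hg v τ q (u q)) h).trans
    (mul_le_mul_of_nonneg_left (ContinuousLinearMap.le_of_opNorm_le _ (hB τ q) _)
      (norm_nonneg _))

lemma inner_flowVariation_zero (hV : IsAdmissibleWith Ω V C) (v w : VelocityL2 V) (τ : ℝ)
    (y e : Space n) :
    inner ℝ e (flowVariation v w τ 0 y) =
      -∫ q in (0 : ℝ)..τ, inner ℝ e (impulseResponse v τ 0 q y (extendZero w q)) := by
  rw [flowVariation, intervalIntegral.integral_symm, inner_neg_right, ← innerSL_apply_apply ℝ,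
    ← ContinuousLinearMap.intervalIntegral_comp_comm _
      (hV.integrable_impulseResponse v w τ 0 y).intervalIntegrable]
  rfl

lemma inner_imageVariation (hV : IsAdmissibleWith Ω V C) (hΩ : MeasurableSet Ω)
    (hgm : StronglyMeasurable g) (hg : MemLp g 2 (volume.restrict Ω)) (v w : VelocityL2 V)
    {τ : ℝ} (hτ : 0 ≤ τ) (h : ImageL2 Ω) :
    inner ℝ h (imageVariation Ω g v w τ) =
      -∫ q in (0 : ℝ)..τ, inner ℝ h (imageImpulse Ω g v τ q (extendZero w q)) := by
  have himpulse : ∀ q, inner ℝ h (imageImpulse Ω g v τ q (extendZero w q)) = ∫ y in Ω,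
      h y * inner ℝ (g (flowMap v τ 0 y)) (impulseResponse v τ 0 q y (extendZero w q)) :=
    fun q => inner_toL2 (hV.memLp_inner_impulseResponse hΩ hg v τ q (extendZero w q)) h
  simp_rw [himpulse]
  rw [intervalIntegral.integral_of_le hτ, integral_integral_swap
    (hV.integrable_mul_inner_impulseResponse hΩ hgm hg v (stronglyMeasurable_extendZero w)
      (integrable_extendZero w).restrict τ h), ← integral_neg]
  refine (inner_toL2 (hV.memLp_inner_flowVariation hΩ hg v w τ) h).trans ?_
  simp_rw [hV.inner_flowVariation_zero, integral_const_mul, mul_neg,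
    intervalIntegral.integral_of_le hτ]

lemma integral_inner_imageVariation (hV : IsAdmissibleWith Ω V C) (hΩ : MeasurableSet Ω)
    (hgm : StronglyMeasurable g) (hg : MemLp g 2 (volume.restrict Ω)) (v w : VelocityL2 V)
    {G : ℝ → ImageL2 Ω} (hG : IntegrableOn G (Icc 0 1)) :
    ∫ τ in Icc (0 : ℝ) 1, inner ℝ (G τ) (imageVariation Ω g v w τ) =
      -∫ q in Icc (0 : ℝ) 1, ∫ τ in q..1, inner ℝ (G τ) (imageImpulse Ω g v τ q (w q)) := by
  have hint : IntegrableOn (Function.uncurry fun τ q : ℝ =>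
      inner ℝ (G τ) (imageImpulse Ω g v τ q (extendZero w q))) (Ioc 0 1 ×ˢ Ioc 0 1) := by
    rw [IntegrableOn, Measure.volume_eq_prod, ← Measure.prod_restrict]
    exact hV.integrable_inner_imageImpulse hΩ hgm hg v (stronglyMeasurable_extendZero w)
      (integrable_extendZero w).restrict (hG.mono_set Ioc_subset_Icc_self)
  calc ∫ τ in Icc (0 : ℝ) 1, inner ℝ (G τ) (imageVariation Ω g v w τ)
      = -∫ τ in (0 : ℝ)..1, ∫ q in (0 : ℝ)..τ,
          inner ℝ (G τ) (imageImpulse Ω g v τ q (extendZero w q)) := by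
        rw [intervalIntegral.integral_of_le zero_le_one, ← integral_Icc_eq_integral_Ioc,
          ← integral_neg]
        exact setIntegral_congr_fun measurableSet_Icc fun τ hτ =>
          hV.inner_imageVariation hΩ hgm hg v w hτ.1 (G τ)
    _ = -∫ q in Icc (0 : ℝ) 1, ∫ τ in q..1,
          inner ℝ (G τ) (imageImpulse Ω g v τ q (extendZero w q)) := by
        rw [integral_integral_triangle_of_le zero_le_one hint,
          intervalIntegral.integral_of_le zero_le_one, ← integral_Icc_eq_integral_Ioc]
    _ = -∫ q in Icc (0 : ℝ) 1, ∫ τ in q..1, inner ℝ (G τ) (imageImpulse Ω g v τ q (w q)) := by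
        refine congrArg Neg.neg (setIntegral_congr_fun measurableSet_Icc fun q hq => ?_)
        simp only [extendZero_of_mem w hq]

end IsAdmissibleWith

end VelocityDerivative

section VelocityGradient

variable {n : ℕ} {Ω : Set (Space n)} {V : Type*} [NormedAddCommGroup V] [InnerProductSpace ℝ V]
  [RKHS ℝ V (Space n) (Space n)] {C : ℝ} {M : ℝ → ImageL2 Ω → ℝ} {f₀ : Space n → ℝ}
  {g : Space n → Space n} {F : ImageL2 Ω} {q : ℝ}

namespace IsAdmissibleWith

lemma inner_integral_pulledGradient (hV : IsAdmissibleWith Ω V C) (hΩ : MeasurableSet Ω)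
    (hM : IsDifferentiableDataTerm M) (v : VelocityL2 V) (F : ImageL2 Ω) (hq : q ∈ Icc (0 : ℝ) 1)
    (h : ImageL2 Ω) :
    inner ℝ (∫ τ in q..1, pulledGradient M v F q τ) h =
      ∫ τ in q..1, inner ℝ (gradient (M τ) (hV.flowPullback hΩ v τ 0 F))
        (hV.flowPullback hΩ v τ q h) := by
  have hint : IntervalIntegrable (pulledGradient M v F q) volume q 1 :=
    (intervalIntegrable_iff_integrableOn_Icc_of_le hq.2).2
      ((hV.integrableOn_pulledGradient hΩ hM v F hq).mono_set (Icc_subset_Icc_left hq.1))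
  rw [real_inner_comm, ← innerSL_apply_apply ℝ, ← ContinuousLinearMap.intervalIntegral_comp_comm _
    hint]
  refine intervalIntegral.integral_congr fun τ hτ => ?_
  rw [uIcc_of_le hq.2] at hτ
  simp only [innerSL_apply_apply]
  rw [hV.pulledGradient_eq_adjoint hΩ v F hq ⟨hq.1.trans hτ.1, hτ.2⟩,
    ContinuousLinearMap.adjoint_inner_right, real_inner_comm]

lemma exists_norm_pulledGradient_le (hV : IsAdmissibleWith Ω V C) (hΩ : MeasurableSet Ω)
    (hM : IsDifferentiableDataTerm M) (v : VelocityL2 V) (F : ImageL2 Ω) :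
    ∃ b : ℝ → ℝ, IntegrableOn b (Icc 0 1) ∧ ∀ q ∈ Icc (0 : ℝ) 1, ∀ τ ∈ Icc (0 : ℝ) 1,
      ‖pulledGradient M v F q τ‖ ≤ b τ := by
  obtain ⟨K, -, hK⟩ := hV.exists_norm_adjoint_flowPullback_le hΩ v
  refine ⟨_, (hM.integrableOn_gradient
    (hV.continuous_flowPullback_left hΩ v 0 F)).norm.const_mul K, fun q hq τ hτ => ?_⟩
  rw [hV.pulledGradient_eq_adjoint hΩ v F hq hτ]
  exact hK τ q _

lemma exists_norm_integral_pulledGradient_le (hV : IsAdmissibleWith Ω V C)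
    (hΩ : MeasurableSet Ω) (hM : IsDifferentiableDataTerm M) (v : VelocityL2 V) (F : ImageL2 Ω) :
    ∃ B : ℝ, ∀ q ∈ Icc (0 : ℝ) 1, ‖∫ τ in q..1, pulledGradient M v F q τ‖ ≤ B := by
  obtain ⟨b, hb, hle⟩ := hV.exists_norm_pulledGradient_le hΩ hM v F
  refine ⟨∫ τ in Icc (0 : ℝ) 1, b τ, fun q hq => ?_⟩
  have hsub : Ioc q 1 ⊆ Icc 0 1 := Ioc_subset_Icc_self.trans (Icc_subset_Icc_left hq.1)
  rw [intervalIntegral.integral_of_le hq.2]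
  refine (norm_integral_le_of_norm_le (hb.mono_set hsub) ?_).trans
    (setIntegral_mono_set hb ?_ hsub.eventuallyLE)
  · filter_upwards [ae_restrict_mem measurableSet_Ioc] with τ hτ using hle q hq τ (hsub hτ)
  · filter_upwards [ae_restrict_mem measurableSet_Icc] with τ hτ
    exact (norm_nonneg _).trans (hle q hq τ hτ)

lemma gradient_geomAct (hV : IsAdmissibleWith Ω V C) (hΩ : IsOpen Ω)
    (hf₀ : DifferentiableOn ℝ f₀ Ω) (v : VelocityL2 V) (hq : q ∈ Icc (0 : ℝ) 1) {y : Space n}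
    (hy : y ∈ Ω) :
    gradient (geomAct (transition v 0 q) f₀) y =
      ContinuousLinearMap.adjoint (flowJacobian v q 0 y) (gradient f₀ (flowMap v q 0 y)) := by
  have hmem : flowMap v q 0 y ∈ Ω := (hV.flowMap_mem_iff v q 0).2 hy
  have hcomp := ((hf₀ _ hmem).differentiableAt (hΩ.mem_nhds hmem)).hasGradientAt.hasFDerivAt.comp y
    (hV.hasFDerivAt_flowMap v q 0 y)
  rw [hV.geomAct_transition v hq]
  refine (hasGradientAt_iff_hasFDerivAt.2 (hcomp.congr_fderiv ?_)).gradient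
  refine ContinuousLinearMap.ext fun a => ?_
  rw [ContinuousLinearMap.comp_apply, InnerProductSpace.toDual_apply_apply,
    InnerProductSpace.toDual_apply_apply, ContinuousLinearMap.adjoint_inner_left]

lemma forceField_ae_eq (hV : IsAdmissibleWith Ω V C) (hΩ : IsOpen Ω)
    (hf₀ : DifferentiableOn ℝ f₀ Ω) (hg : g =ᵐ[volume.restrict Ω] gradient f₀)
    (v : VelocityL2 V) (F : ImageL2 Ω) (hq : q ∈ Icc (0 : ℝ) 1) :
    forceField M v F f₀ q =ᵐ[volume.restrict Ω] fun y =>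
      -((∫ τ in q..1, pulledGradient M v F q τ : ImageL2 Ω) y •
        ContinuousLinearMap.adjoint (flowJacobian v q 0 y) (g (flowMap v q 0 y))) := by
  filter_upwards [ae_restrict_mem hΩ.measurableSet,
    (hV.quasiMeasurePreserving_flowMap hΩ.measurableSet v q 0).ae_eq_comp hg] with y hy hgy
  rw [Function.comp_apply, Function.comp_apply] at hgy
  rw [forceField, hV.gradient_geomAct hΩ hf₀ v hq hy, hgy]

lemma memLp_adjoint_flowJacobian_comp (hV : IsAdmissibleWith Ω V C) (hΩ : MeasurableSet Ω)
    (hg : MemLp g 2 (volume.restrict Ω)) (v : VelocityL2 V) (s t : ℝ) :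
    MemLp (fun y => ContinuousLinearMap.adjoint (flowJacobian v s t y) (g (flowMap v s t y))) 2
      (volume.restrict Ω) := by
  have hcomp := hV.memLp_comp_flowMap hΩ hg v s t
  have hadj : Continuous fun y => ContinuousLinearMap.adjoint (flowJacobian v s t y) :=
    ContinuousLinearMap.adjoint.continuous.comp (hV.continuous_flowJacobian_right v s t)
  refine hcomp.of_le_mul (c := flowBound C v)
    (isBoundedBilinearMap_apply.continuous.comp_aestronglyMeasurable
      (hadj.aestronglyMeasurable.prodMk hcomp.aestronglyMeasurable))
    (Eventually.of_forall fun y => ContinuousLinearMap.le_of_opNorm_le _ ?_ _)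
  rw [ContinuousLinearMap.adjoint.norm_map]
  exact hV.norm_flowJacobian_le v s t y

lemma integrableOn_forceField (hV : IsAdmissibleWith Ω V C) (hΩ : IsOpen Ω)
    (hF : IsDifferentiableTemplate Ω f₀ g F) (v : VelocityL2 V) (hq : q ∈ Icc (0 : ℝ) 1) :
    IntegrableOn (forceField M v F f₀ q) Ω := by
  have hprod := memLp_one_iff_integrable.1
    ((hV.memLp_adjoint_flowJacobian_comp hΩ.measurableSet hF.memLp v q 0).smul (r := 1)
      (Lp.memLp (∫ τ in q..1, pulledGradient M v F q τ : ImageL2 Ω)))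
  exact hprod.neg.congr
    (hV.forceField_ae_eq hΩ hF.differentiableOn hF.ae_eq_gradient v F hq).symm

variable [CompleteSpace V]

lemma integrableOn_kernel (hV : IsAdmissibleWith Ω V C) {φ : Space n → Space n}
    (hφ : IntegrableOn φ Ω) (x : Space n) :
    IntegrableOn (fun y => RKHS.kernel V x y (φ y)) Ω := by
  have : SecondCountableTopologyEither (Space n) (Space n →L[ℝ] V) :=
    secondCountableTopologyEither_of_left _ _
  have hker : IntegrableOn (fun y => RKHS.kerFun (𝕜 := ℝ) V y (φ y)) Ω :=
    (hφ.norm.const_mul C).mono'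
      (isBoundedBilinearMap_apply.continuous.comp_aestronglyMeasurable
        (hV.continuous_kerFun.aestronglyMeasurable.prodMk hφ.aestronglyMeasurable))
      (Eventually.of_forall fun y => ContinuousLinearMap.le_of_opNorm_le _ (hV.norm_kerFun_le y) _)
  simp_rw [RKHS.kernel_apply]
  exact (ContinuousLinearMap.adjoint (RKHS.kerFun (𝕜 := ℝ) V x)).integrable_comp hker

/-- The Riesz representative in `V` of the functional `u ↦ ∫_Ω ⟨b, u⟩`, where `b` is the force
field at time `q`. -/
def forcePotential (hV : IsAdmissibleWith Ω V C) (hΩ : MeasurableSet Ω)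
    (hg : MemLp g 2 (volume.restrict Ω)) (M : ℝ → ImageL2 Ω → ℝ) (v : VelocityL2 V)
    (F : ImageL2 Ω) (q : ℝ) : V :=
  -ContinuousLinearMap.adjoint (hV.imageImpulseCLM hΩ hg v q q)
    (∫ τ in q..1, pulledGradient M v F q τ)

lemma inner_kernelOp (hV : IsAdmissibleWith Ω V C) {φ : Space n → Space n}
    (hφ : IntegrableOn φ Ω) (x a : Space n) :
    inner ℝ (kernelOp Ω V φ x) a = ∫ y in Ω, inner ℝ (φ y) (RKHS.kerFun (𝕜 := ℝ) V x a y) := by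
  rw [real_inner_comm, kernelOp, ← integral_inner (hV.integrableOn_kernel hφ x)]
  refine integral_congr_ae (Eventually.of_forall fun y => ?_)
  simp only
  rw [real_inner_comm, RKHS.kernel_inner, RKHS.kerFun_inner]

lemma forcePotential_apply (hV : IsAdmissibleWith Ω V C) (hΩ : IsOpen Ω)
    (hF : IsDifferentiableTemplate Ω f₀ g F) (M : ℝ → ImageL2 Ω → ℝ) (v : VelocityL2 V)
    (hq : q ∈ Icc (0 : ℝ) 1) (x : Space n) :
    hV.forcePotential hΩ.measurableSet hF.memLp M v F q x =
      kernelOp Ω V (forceField M v F f₀ q) x := by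
  have hΩm := hΩ.measurableSet
  refine ext_inner_right ℝ fun a => ?_
  have himpulse := inner_toL2
    (hV.memLp_inner_impulseResponse hΩm hF.memLp v q q (RKHS.kerFun (𝕜 := ℝ) V x a))
    (∫ τ in q..1, pulledGradient M v F q τ)
  rw [← RKHS.inner_kerFun, forcePotential, inner_neg_left, ContinuousLinearMap.adjoint_inner_left,
    imageImpulseCLM_apply, imageImpulse, himpulse,
    hV.inner_kernelOp (hV.integrableOn_forceField hΩ hF v hq), ← integral_neg]
  refine integral_congr_ae ?_
  filter_upwards [hV.forceField_ae_eq (M := M) hΩ hF.differentiableOn hF.ae_eq_gradient v F hq]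
    with y hy
  rw [hy, inner_neg_left, real_inner_smul_left, ContinuousLinearMap.adjoint_inner_left,
    impulseResponse, hV.flowMap_self]

lemma inner_forcePotential (hV : IsAdmissibleWith Ω V C) (hΩ : MeasurableSet Ω)
    (hg : MemLp g 2 (volume.restrict Ω)) (hM : IsDifferentiableDataTerm M) (v : VelocityL2 V)
    (F : ImageL2 Ω) (hq : q ∈ Icc (0 : ℝ) 1) (u : V) :
    inner ℝ (hV.forcePotential hΩ hg M v F q) u =
      -∫ τ in q..1, inner ℝ (gradient (M τ) (hV.flowPullback hΩ v τ 0 F))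
        (imageImpulse Ω g v τ q u) := by
  rw [forcePotential, inner_neg_left, ContinuousLinearMap.adjoint_inner_left,
    imageImpulseCLM_apply, hV.inner_integral_pulledGradient hΩ hM v F hq]
  simp only [hV.flowPullback_imageImpulse hΩ hg]

lemma exists_norm_forcePotential_le (hV : IsAdmissibleWith Ω V C) (hΩ : MeasurableSet Ω)
    (hg : MemLp g 2 (volume.restrict Ω)) (hM : IsDifferentiableDataTerm M) (v : VelocityL2 V)
    (F : ImageL2 Ω) :
    ∃ B : ℝ, ∀ q ∈ Icc (0 : ℝ) 1, ‖hV.forcePotential hΩ hg M v F q‖ ≤ B := by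
  obtain ⟨B, hB0, hB⟩ := hV.exists_norm_imageImpulseCLM_le hΩ hg v
  obtain ⟨K, hK⟩ := hV.exists_norm_integral_pulledGradient_le hΩ hM v F
  refine ⟨B * K, fun q hq => ?_⟩
  rw [forcePotential, norm_neg]
  refine (ContinuousLinearMap.le_of_opNorm_le _ ?_ _).trans
    (mul_le_mul_of_nonneg_left (hK q hq) hB0)
  rw [ContinuousLinearMap.adjoint.norm_map]
  exact hB q q

lemma memLp_forcePotential (hV : IsAdmissibleWith Ω V C) (hΩ : IsOpen Ω)
    (hF : IsDifferentiableTemplate Ω f₀ g F) (hM : IsDifferentiableDataTerm M)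
    (v : VelocityL2 V) :
    MemLp (hV.forcePotential hΩ.measurableSet hF.memLp M v F) 2 (volume.restrict (Icc 0 1)) := by
  have hΩm := hΩ.measurableSet
  have := hV.secondCountableTopology
  obtain ⟨B, hB⟩ := hV.exists_norm_forcePotential_le hΩm hF.memLp hM v F
  refine MemLp.of_bound (aestronglyMeasurable_of_inner fun u => ?_) B
    ((ae_restrict_mem measurableSet_Icc).mono hB)
  have hG := hM.integrableOn_gradient (hV.continuous_flowPullback_left hΩm v 0 F)
  have hint := (hV.integrable_inner_imageImpulse (u := fun _ => u) hΩm hF.stronglyMeasurable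
    hF.memLp v stronglyMeasurable_const
    (integrable_const (μ := volume.restrict (Icc (0 : ℝ) 1)) u) hG).indicator
    (s := {p : ℝ × ℝ | p.2 < p.1}) (measurableSet_lt measurable_snd measurable_fst)
  refine hint.integral_prod_right.neg.aestronglyMeasurable.congr ?_
  filter_upwards [ae_restrict_mem measurableSet_Icc] with q hq
  have hinter : Icc (0 : ℝ) 1 ∩ Ioi q = Ioc q 1 := by
    rw [← Ici_inter_Iic, inter_right_comm, inter_eq_right.2 (Ioi_subset_Ici hq.1), Ioi_inter_Iic]
  rw [hV.inner_forcePotential hΩm hF.memLp hM v F hq, Pi.neg_apply, neg_inj,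
    intervalIntegral.integral_of_le hq.2, ← hinter, ← setIntegral_indicator measurableSet_Ioi]
  rfl

lemma inner_toLp_forcePotential (hV : IsAdmissibleWith Ω V C) (hΩ : IsOpen Ω)
    (hF : IsDifferentiableTemplate Ω f₀ g F) (hM : IsDifferentiableDataTerm M)
    (v w : VelocityL2 V) :
    inner ℝ ((hV.memLp_forcePotential hΩ hF hM v).toLp _) w =
      ∫ τ in Icc (0 : ℝ) 1, inner ℝ (gradient (M τ) (hV.flowPullback hΩ.measurableSet v τ 0 F))
        (imageVariation Ω g v w τ) := by
  have hΩm := hΩ.measurableSet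
  rw [hV.integral_inner_imageVariation hΩm hF.stronglyMeasurable hF.memLp v w
    (hM.integrableOn_gradient (hV.continuous_flowPullback_left hΩm v 0 F)), ← integral_neg,
    L2.inner_def]
  refine integral_congr_ae ?_
  filter_upwards [(hV.memLp_forcePotential hΩ hF hM v).coeFn_toLp,
    ae_restrict_mem measurableSet_Icc] with q hcoe hq
  rw [hcoe, hV.inner_forcePotential hΩm hF.memLp hM v F hq]

lemma hasGradientAt_integral_flowPullback_velocity (hV : IsAdmissibleWith Ω V C) (hΩ : IsOpen Ω)
    (hF : IsDifferentiableTemplate Ω f₀ g F) (hM : IsDifferentiableDataTerm M)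
    (v : VelocityL2 V) :
    HasGradientAt
      (fun v => ∫ t in Icc (0 : ℝ) 1, M t (hV.flowPullback hΩ.measurableSet v t 0 F))
      ((hV.memLp_forcePotential hΩ hF hM v).toLp _) v := by
  have := hV.secondCountableTopology
  have : Fact ((2 : ENNReal) ≠ ⊤) := ⟨ENNReal.ofNat_ne_top⟩
  obtain ⟨K, hK0, hK⟩ := hV.exists_norm_flowPullback_add_sub_le hΩ hF v
  obtain ⟨hint, hgrad⟩ := hM.hasGradientAt_integral_comp one_pos hK0 (x₀ := v)
    (fun v => hV.continuous_flowPullback_left hΩ.measurableSet v 0 F)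
    (fun v' hv' t => by
      simpa only [add_sub_cancel] using hK (v' - v) (mem_ball_iff_norm.1 hv').le t)
    (fun t => hV.hasFDerivAt_flowPullback hΩ hF v t)
  suffices heq : (hV.memLp_forcePotential hΩ hF hM v).toLp _ = _ by rwa [heq]
  refine ext_inner_right ℝ fun w => ?_
  rw [hV.inner_toLp_forcePotential hΩ hF hM, real_inner_comm, ← integral_inner hint]
  refine integral_congr_ae (Eventually.of_forall fun t => ?_)
  simp only [ContinuousLinearMap.adjoint_inner_right]
  rw [real_inner_comm, imageDeriv_apply]

/-- The gradient of the objective in `v`. -/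
def velocityGradient (hV : IsAdmissibleWith Ω V C) (hΩ : IsOpen Ω)
    (hF : IsDifferentiableTemplate Ω f₀ g F) (hM : IsDifferentiableDataTerm M) (μ₂ : ℝ)
    (v : VelocityL2 V) : VelocityL2 V :=
  (hV.memLp_forcePotential hΩ hF hM v).toLp _ + μ₂ • energyGradient v

lemma coeFn_velocityGradient (hV : IsAdmissibleWith Ω V C) (hΩ : IsOpen Ω)
    (hF : IsDifferentiableTemplate Ω f₀ g F) (hM : IsDifferentiableDataTerm M) (μ₂ : ℝ)
    (v : VelocityL2 V) :
    hV.velocityGradient hΩ hF hM μ₂ v =ᵐ[volume.restrict (Icc 0 1)] fun t =>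
      hV.forcePotential hΩ.measurableSet hF.memLp M v F t + (2 * μ₂ * (1 - t)) • (v t : V) := by
  have hk := hV.memLp_forcePotential hΩ hF hM v
  filter_upwards [Lp.coeFn_add (hk.toLp _) (μ₂ • energyGradient v), hk.coeFn_toLp,
    Lp.coeFn_smul μ₂ (energyGradient v), coeFn_energyGradient v] with t hadd hpot hsmul henergy
  rw [velocityGradient, hadd, Pi.add_apply, hpot, hsmul, Pi.smul_apply, henergy, smul_smul,
    mul_left_comm, mul_assoc]

lemma hasGradientAt_objective {X : Type*} [NormedAddCommGroup X] [NormedSpace ℝ X]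
    (hV : IsAdmissibleWith Ω V C) (hΩ : IsOpen Ω) {ι : X →L[ℝ] ImageL2 Ω} {f : X}
    (hf : IsDifferentiableTemplate Ω f₀ g (ι f)) (hM : IsDifferentiableDataTerm M) (R₁ : X → ℝ)
    (μ₁ μ₂ : ℝ) (v : VelocityL2 V) :
    HasGradientAt (objective ι M R₁ μ₁ μ₂ f) (hV.velocityGradient hΩ hf hM μ₂ v) v := by
  have hdata := (hV.hasGradientAt_integral_flowPullback_velocity hΩ hf hM v).hasFDerivAt
  have henergy := (hasGradientAt_energy v).hasFDerivAt.const_mul μ₂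
  rw [hasGradientAt_iff_hasFDerivAt, funext (hV.objective_eq ι hΩ.measurableSet hM R₁ μ₁ μ₂ f)]
  refine ((hdata.add henergy).add_const (μ₁ * R₁ f)).congr_fderiv ?_
  rw [velocityGradient, map_add, map_smul]

end IsAdmissibleWith

end VelocityGradient

section Optimality

lemma eq_zero_of_hasGradientAt_of_isLocalMin {H : Type*} [NormedAddCommGroup H]
    [InnerProductSpace ℝ H] [CompleteSpace H] {Φ : H → ℝ} {G x : H} (h : HasGradientAt Φ G x)
    (hmin : IsLocalMin Φ x) : G = 0 :=
  (InnerProductSpace.toDual ℝ H).map_eq_zero_iff.1 (hmin.hasFDerivAt_eq_zero h.hasFDerivAt)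

variable {n : ℕ} {Ω : Set (Space n)} {X : Type*} [NormedAddCommGroup X] [NormedSpace ℝ X]
  {ι : X →L[ℝ] ImageL2 Ω}

lemma HasL2GradientAt.eq_zero_of_isLocalMin (hι : DenseRange ι) {Φ : X → ℝ} {G : ImageL2 Ω}
    {f : X} (h : HasL2GradientAt ι Φ G f) (hmin : IsLocalMin Φ f) : G = 0 :=
  hι.eq_zero_of_inner_left ℝ fun x => DFunLike.congr_fun (hmin.hasFDerivAt_eq_zero h) x

lemma gradients_eq_zero_of_isLocalMin {H : Type*} [NormedAddCommGroup H]
    [InnerProductSpace ℝ H] [CompleteSpace H] (hι : DenseRange ι) {J : X → H → ℝ} {f : X} {v : H}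
    {gradV : H} {gradF : ImageL2 Ω} (hgradV : HasGradientAt (J f) gradV v)
    (hgradF : HasL2GradientAt ι (fun h => J h v) gradF f)
    (hmin : IsLocalMin (fun p : X × H => J p.1 p.2) (f, v)) : gradV = 0 ∧ gradF = 0 :=
  ⟨eq_zero_of_hasGradientAt_of_isLocalMin hgradV
    (hmin.comp_continuous (g := fun w => (f, w)) (by fun_prop)),
    hgradF.eq_zero_of_isLocalMin hι
    (hmin.comp_continuous (g := fun h => (h, v)) (by fun_prop))⟩

end Optimality

end LDDMM

end

theorem mainTheorem2 {n : ℕ} (Ω : Set (LDDMM.Space n)) (hΩ : IsOpen Ω)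
    -- an admissible reproducing kernel Hilbert space of vector fields on `Ω`
    {V : Type*} [NormedAddCommGroup V] [InnerProductSpace ℝ V] [CompleteSpace V]
    [RKHS ℝ V (LDDMM.Space n) (LDDMM.Space n)] (hV : LDDMM.IsAdmissible Ω V)
    -- the space of templates
    {X : Type*} [NormedAddCommGroup X] [NormedSpace ℝ X]
    (ι : X →L[ℝ] LDDMM.ImageL2 Ω) (hι : DenseRange ι)
    -- data discrepancy, forward operators and data
    {Y : Type*} (D : Y → Y → ℝ) (A : ℝ → LDDMM.ImageL2 Ω → Y) (g : ℝ → Y)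
    (hD : LDDMM.IsDifferentiableDataTerm (LDDMM.dataTerm D A g))
    (R₁ : X → ℝ) (μ₁ μ₂ : ℝ)
    -- a differentiable template `f`, with pointwise representative `f₀`, and a velocity field
    (f : X) (f₀ : LDDMM.Space n → ℝ) (hff₀ : ι f =ᵐ[volume.restrict Ω] f₀)
    (hf₀ : DifferentiableOn ℝ f₀ Ω) (hgf₀ : MemLp (gradient f₀) 2 (volume.restrict Ω))
    (gradR : LDDMM.ImageL2 Ω) (hR : LDDMM.HasL2GradientAt ι R₁ gradR f)
    (v : LDDMM.VelocityL2 V) :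
    LDDMM.IsWellDefined Ω V (LDDMM.dataTerm D A g) ∧
    (∀ t ∈ Icc (0 : ℝ) 1, ∀ x, IntegrableOn (fun y =>
      RKHS.kernel V x y (LDDMM.forceField (LDDMM.dataTerm D A g) v (ι f) f₀ t y)) Ω) ∧
    ∃ (k : ℝ → V) (gradV : LDDMM.VelocityL2 V) (gradF : LDDMM.ImageL2 Ω),
      -- the gradient with respect to the velocity field
      (∀ t ∈ Icc (0 : ℝ) 1, ∀ x, k t x =
        LDDMM.kernelOp Ω V (LDDMM.forceField (LDDMM.dataTerm D A g) v (ι f) f₀ t) x) ∧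
      (∀ᵐ t ∂(volume.restrict (Icc (0 : ℝ) 1)), gradV t = k t + (2 * μ₂ * (1 - t)) • v t) ∧
      HasGradientAt (LDDMM.objective ι (LDDMM.dataTerm D A g) R₁ μ₁ μ₂ f) gradV v ∧
      -- the gradient with respect to the template
      gradF = (∫ t in (0 : ℝ)..1, LDDMM.pulledGradient (LDDMM.dataTerm D A g) v (ι f) 0 t)
        + μ₁ • gradR ∧
      LDDMM.HasL2GradientAt ι
        (fun h => LDDMM.objective ι (LDDMM.dataTerm D A g) R₁ μ₁ μ₂ h v) gradF f ∧
      -- the first-order optimality conditions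
      (IsLocalMin (fun p : X × LDDMM.VelocityL2 V =>
          LDDMM.objective ι (LDDMM.dataTerm D A g) R₁ μ₁ μ₂ p.1 p.2) (f, v) →
        gradV = 0 ∧ gradF = 0) := by
  obtain ⟨C, hV⟩ := hV.exists_isAdmissibleWith
  have hgm := hgf₀.aestronglyMeasurable
  have hf : LDDMM.IsDifferentiableTemplate Ω f₀ (hgm.mk _) (ι f) :=
    { differentiableOn := hf₀
      stronglyMeasurable := hgm.stronglyMeasurable_mk
      memLp := hgf₀.ae_eq hgm.ae_eq_mk
      ae_eq_gradient := hgm.ae_eq_mk.symm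
      ae_eq := hff₀ }
  have hgradV := hV.hasGradientAt_objective hΩ hf hD R₁ μ₁ μ₂ v
  have hgradF := hV.hasL2GradientAt_objective ι hΩ.measurableSet hD μ₁ μ₂ hR v
  exact ⟨hV.isWellDefined hΩ.measurableSet hD,
    fun t ht => hV.integrableOn_kernel (hV.integrableOn_forceField hΩ hf v ht),
    hV.forcePotential hΩ.measurableSet hf.memLp (LDDMM.dataTerm D A g) v (ι f), _, _,
    fun t ht => hV.forcePotential_apply hΩ hf _ v ht, hV.coeFn_velocityGradient hΩ hf hD μ₂ v,
    hgradV, rfl, hgradF, LDDMM.gradients_eq_zero_of_isLocalMin hι hgradV hgradF⟩
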